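/- Let $n\ge 0$, let $\mathcal O=\mathbb C[[x_1,\dots,x_n]]$ with the topology of coefficientwise convergence, let $\mathrm{vect}(n)=\bigoplus_i\mathcal O\,\partial_i$ be the Lie algebra of formal vector fields, with bracket $[X,Y]_j=\sum_i(X_i\partial_iY_j-Y_i\partial_iX_j)$, and let $\Omega^p=\mathcal O\otimes\wedge^p(\mathbb C^n)^*$ be the space of formal differential $p$-forms, with de Rham differential $d_{dR}$, interior product $\iota_X$ and Lie derivative $L_X=d_{dR}\iota_X+\iota_Xd_{dR}$. For $N=\Omega^p$ or $N=\mathbb C$ let $C^q(\mathrm{vect}(n);N)$ be the space of continuous alternating $q$-linear maps $\mathrm{vect}(n)^q\to N$, with the Chevalley–Eilenberg differential $$(d_{CE}\varphi)(X_0,\dots,X_q)=\sum_{i<j}(-1)^{i+j}\varphi([X_i,X_j],X_0,\dots,\widehat{X_i},\dots,\widehat{X_j},\dots,X_q)+\sum_i(-1)^iL_{X_i}\varphi(X_0,\dots,\widehat{X_i},\dots,X_q)$$ (without the second sum if $N=\mathbb C$). Let $\mathrm{Tot}=\mathrm{Tot}\,C^\bullet(\mathrm{vect}(n);\Omega^\bullet)=\bigoplus_{q,p}C^q(\mathrm{vect}(n);\Omega^p)$,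 where $C^q(\mathrm{vect}(n);\Omega^p)$ has total degree $q+p$, with total differential $D=d_{CE}+(-1)^qd_{dR}$ on $C^q(\mathrm{vect}(n);\Omega^p)$, and with product $\alpha\cdot\alpha'=(-1)^{pq'}\,\alpha\wedge\alpha'$ for $\alpha\in C^q(\mathrm{vect}(n);\Omega^p)$ and $\alpha'\in C^{q'}(\mathrm{vect}(n);\Omega^{p'})$, where $\alpha\wedge\alpha'$ is the shuffle product of cochains formed with the wedge product of forms. Let $C^\bullet(\mathrm{vect}(n);\mathbb C)$ carry the shuffle product and the differential $d_{CE}$. Both are commutative dg algebras. Let $\iota:\mathrm{Tot}\to\mathrm{Tot}$ be the operator of bidegree $(1,-1)$ given on $\varphi\in C^q(\mathrm{vect}(n);\Omega^p)$ by $$(\iota\varphi)(X_0,\dots,X_q)=(-1)^{q+1}\sum_{k=0}^q(-1)^k\,\iota_{X_k}\varphi(X_0,\dots,\widehat{X_k},\dots,X_q)$$ (and $\iota=0$ on $C^q(\mathrm{vect}(n);\Omega^0)$). Then $\iota^{n+1}=0$, so that $e^{\iota}=\sum_k\iota^k/k!$ is a finite sum. For $\alpha\in C^q(\mathrm{vect}(n);\Omega^p)$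 let $\alpha|_0\in C^q(\mathrm{vect}(n);\mathbb C)$ be $0$ if $p>0$, and $\alpha|_0(X_1,\dots,X_q)=\alpha(X_1,\dots,X_q)(0)$ if $p=0$; extend linearly to $\mathrm{Tot}$. **Proposition.** The map $$\Phi:\mathrm{Tot}\,C^\bullet(\mathrm{vect}(n);\Omega^\bullet)\to C^\bullet(\mathrm{vect}(n);\mathbb C),\qquad \Phi(\alpha)=e^{\iota}(\alpha)|_0,$$ is a quasi-isomorphism of commutative dg algebras. It is a quasi-inverse to the map $i:C^\bullet(\mathrm{vect}(n);\mathbb C)\to\mathrm{Tot}\,C^\bullet(\mathrm{vect}(n);\Omega^\bullet)$ induced by the inclusion of constants $\mathbb C\hookrightarrow\mathcal O$: the map $i$ is a morphism of commutative dg algebras and a quasi-isomorphism, $\Phi\circ i=\mathrm{id}$, and $$i\circ\Phi-\mathrm{id}=D\Psi+\Psi D,$$ where $\Psi=e^{-\iota}\circ\Psi_0\circ e^{\iota}$ has degree $-1$ and $\Psi_0$ is the homotopy of the formal Poincaré lemma for the contraction $h(t,x)=tx$: for $p\ge1$ and $\varphi\in C^q(\mathrm{vect}(n);\Omega^p)$,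 $$(\Psi_0\varphi)(X_1,\dots,X_q)=-(-1)^q\,K\big(\varphi(X_1,\dots,X_q)\big),\qquad K\Big(\sum_I\omega_I\,dx^I\Big)=\sum_I\Big(\int_0^1t^{p-1}\omega_I(tx)\,dt\Big)\,\iota_E\,dx^I,\qquad E=\sum_ix_i\partial_i,$$ and $\Psi_0=0$ on $C^q(\mathrm{vect}(n);\Omega^0)$. -/

import Mathlib

open CategoryTheory
open scoped MvPowerSeries.WithPiTopology

set_option linter.unusedSectionVars false

noncomputable section

namespace GelfandFuks

/-! ## Generalities on alternating maps -/

section General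

variable {M N N' N'' : Type} [AddCommGroup M] [Module ℂ M] [AddCommGroup N] [Module ℂ N]
  [AddCommGroup N'] [Module ℂ N'] [AddCommGroup N''] [Module ℂ N'']

theorem alt_sum_apply {ι κ : Type} (s : Finset κ) (f : κ → M [⋀^ι]→ₗ[ℂ] N) (v : ι → M) :
    (∑ j ∈ s, f j) v = ∑ j ∈ s, f j v := by
  classical
  induction s using Finset.induction_on with
  | empty => simp
  | insert a s ha ih => rw [Finset.sum_insert ha, Finset.sum_insert ha, ← ih]; rfl

/-- The shuffle product of alternating maps along a bilinear map `m` on the coefficients: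
`(a · b)(v_1, …, v_{k+l}) = ∑ sign(σ) m (a (v_{σ 1}, …, v_{σ k})) (b (v_{σ (k+1)}, …, v_{σ (k+l)}))`,
the sum being over all `(k, l)`-shuffles `σ`. -/
def altMul (m : N →ₗ[ℂ] N' →ₗ[ℂ] N'') (k l : ℕ) :
    (M [⋀^Fin k]→ₗ[ℂ] N) →ₗ[ℂ] (M [⋀^Fin l]→ₗ[ℂ] N') →ₗ[ℂ] (M [⋀^Fin (k + l)]→ₗ[ℂ] N'') :=
  LinearMap.mk₂ ℂ
    (fun a b => ((TensorProduct.lift m).compAlternatingMap (a.domCoprod b)).domDomCongr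
      finSumFinEquiv)
    (fun a a' b => by
      ext v
      simp [← AlternatingMap.domCoprod'_apply, TensorProduct.add_tmul])
    (fun c a b => by
      ext v
      simp [← AlternatingMap.domCoprod'_apply, ← TensorProduct.smul_tmul'])
    (fun a b b' => by
      ext v
      simp [← AlternatingMap.domCoprod'_apply, TensorProduct.tmul_add])
    (fun c a b => by
      ext v
      simp [← AlternatingMap.domCoprod'_apply, TensorProduct.tmul_smul])

theorem continuous_altMul {X : Type} [TopologicalSpace X] [TopologicalSpace N]
    [TopologicalSpace N'] [TopologicalSpace N''] [IsTopologicalAddGroup N'']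
    (m : N →ₗ[ℂ] N' →ₗ[ℂ] N'') (hm : Continuous fun x : N × N' => m x.1 x.2) (k l : ℕ)
    (a : X → M [⋀^Fin k]→ₗ[ℂ] N) (b : X → M [⋀^Fin l]→ₗ[ℂ] N') (v : X → Fin (k + l) → M)
    (ha : ∀ e : Fin k → Fin (k + l), Continuous fun x => a x (v x ∘ e))
    (hb : ∀ e : Fin l → Fin (k + l), Continuous fun x => b x (v x ∘ e)) :
    Continuous fun x => altMul m k l (a x) (b x) (v x) := by
  have h : ∀ x, altMul m k l (a x) (b x) (v x) =
      ∑ σ : Equiv.Perm.ModSumCongr (Fin k) (Fin l),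
        TensorProduct.lift m (AlternatingMap.domCoprod.summand (a x) (b x) σ
          (v x ∘ finSumFinEquiv)) := by
    intro x
    simp [altMul, AlternatingMap.domCoprod_apply, Function.comp_def]
  simp only [h]
  refine continuous_finsetSum _ fun σ _ => ?_
  induction σ using Quotient.inductionOn' with
  | h σ =>
    simp only [AlternatingMap.domCoprod.summand_mk'', smul_apply,
      MultilinearMap.domDomCongr_apply, MultilinearMap.domCoprod_apply]
    have h2 : Continuous fun x => m (a x (v x ∘ fun i => finSumFinEquiv (σ (Sum.inl i))))
        (b x (v x ∘ fun i => finSumFinEquiv (σ (Sum.inr i)))) :=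
      hm.comp ((ha _).prodMk (hb _))
    rcases Int.units_eq_one_or (Equiv.Perm.sign σ) with hs | hs
    · simpa [hs, Function.comp_def] using h2
    · simpa [hs, Function.comp_def, Pi.neg_def] using h2.neg

theorem continuous_vecCons {X Y : Type} [TopologicalSpace X] [TopologicalSpace Y] {r : ℕ}
    {f : X → Y} {g : X → Fin r → Y} (hf : Continuous f) (hg : Continuous g) :
    Continuous fun x => Matrix.vecCons (f x) (g x) :=
  continuous_pi fun j => Fin.cases hf (fun j => (continuous_apply j).comp hg) j

end General

/-! ## Formal functions, vector fields and differential forms on the formal `n`-disk -/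

/-- `𝒪 = ℂ[[x_1, …, x_n]]`, with the topology of convergence of coefficients. -/
abbrev FormalFun (n : ℕ) : Type := MvPowerSeries (Fin n) ℂ

/-- Formal vector fields `X = ∑ X_i ∂_i`, encoded by their coefficients `X_i ∈ 𝒪`. -/
abbrev Vect (n : ℕ) : Type := Fin n → FormalFun n

/-- Formal differential `p`-forms `𝒪 ⊗ ⋀^p (ℂ^n)^*`, encoded as alternating `p`-forms on `ℂ^n`
with values in `𝒪`: the coefficient of `dx_{i_1} ∧ ⋯ ∧ dx_{i_p}` is the value on
`(e_{i_1}, …, e_{i_p})`. -/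
abbrev Form (n p : ℕ) : Type := (Fin n → ℂ) [⋀^Fin p]→ₗ[ℂ] FormalFun n

/-- Formal forms carry the topology of convergence of all coefficients. -/
instance (n p : ℕ) : TopologicalSpace (Form n p) :=
  TopologicalSpace.induced (fun ω v => ω v) (inferInstanceAs
    (TopologicalSpace ((Fin p → Fin n → ℂ) → FormalFun n)))

theorem continuous_form_iff {X : Type} [TopologicalSpace X] {n p : ℕ} {f : X → Form n p} :
    Continuous f ↔ ∀ v, Continuous fun x => f x v := by
  rw [continuous_induced_rng, continuous_pi_iff]
  rfl

theorem continuous_form_apply {n p : ℕ} (v : Fin p → Fin n → ℂ) :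
    Continuous fun ω : Form n p => ω v :=
  continuous_form_iff.1 continuous_id v

instance (n p : ℕ) : IsTopologicalAddGroup (Form n p) where
  continuous_add := continuous_form_iff.2 fun v =>
    ((continuous_form_apply v).comp continuous_fst).add
      ((continuous_form_apply v).comp continuous_snd)
  continuous_neg := continuous_form_iff.2 fun v => (continuous_form_apply v).neg

theorem continuous_formalFun_iff {X : Type} [TopologicalSpace X] {n : ℕ} {f : X → FormalFun n} :
    Continuous f ↔ ∀ d, Continuous fun x => MvPowerSeries.coeff d (f x) := by
  refine ⟨fun h d => (MvPowerSeries.WithPiTopology.continuous_coeff ℂ d).comp h, fun h => ?_⟩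
  rw [continuous_iff_continuousAt]
  intro x
  exact (MvPowerSeries.WithPiTopology.tendsto_iff_coeff_tendsto _ _ _).2
    fun d => (h d).continuousAt

instance (n : ℕ) : ContinuousConstSMul ℂ (FormalFun n) where
  continuous_const_smul _ := continuous_formalFun_iff.2 fun d =>
    continuous_const.mul (MvPowerSeries.WithPiTopology.continuous_coeff ℂ d)

instance (n p : ℕ) : ContinuousConstSMul ℂ (Form n p) where
  continuous_const_smul c := continuous_form_iff.2 fun v =>
    (continuous_const_smul c).comp (continuous_form_apply v)

/-- The partial derivative `∂_i` on `𝒪`, as a linear map. -/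
abbrev partialD (n : ℕ) (i : Fin n) : FormalFun n →ₗ[ℂ] FormalFun n :=
  (MvPowerSeries.pderiv ℂ i).toLinearMap

theorem continuous_partialD (n : ℕ) (i : Fin n) : Continuous (partialD n i) := by
  refine continuous_formalFun_iff.2 fun d => ?_
  simp only [partialD, Derivation.coeFn_coe, MvPowerSeries.coeff_pderiv]
  exact (MvPowerSeries.WithPiTopology.continuous_coeff ℂ _).mul continuous_const

/-- Componentwise derivative of one vector field along another: `(∇_X Y)_j = ∑_i X_i ∂_i Y_j`. -/
def nabla (n : ℕ) : Vect n →ₗ[ℂ] Vect n →ₗ[ℂ] Vect n :=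
  LinearMap.mk₂ ℂ (fun X Y j => ∑ i, X i * partialD n i (Y j))
    (fun X X' Y => by ext1 j; simp [add_mul, Finset.sum_add_distrib])
    (fun c X Y => by ext1 j; simp [Finset.smul_sum])
    (fun X Y Y' => by ext1 j; simp [mul_add, Finset.sum_add_distrib])
    (fun c X Y => by ext1 j; simp [Finset.smul_sum])

theorem continuous_nabla (n : ℕ) : Continuous fun x : Vect n × Vect n => nabla n x.1 x.2 := by
  refine continuous_pi fun j => ?_
  simp only [nabla, LinearMap.mk₂_apply]
  exact continuous_finsetSum _ fun i _ => ((continuous_apply i).comp continuous_fst).mul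
    ((continuous_partialD n i).comp ((continuous_apply j).comp continuous_snd))

/-- The Lie bracket of formal vector fields,
`[X, Y]_j = ∑_i (X_i ∂_i Y_j - Y_i ∂_i X_j)`. -/
def bracket {n : ℕ} (X Y : Vect n) : Vect n := nabla n X Y - nabla n Y X

/-- The formal de Rham differential: the value of `dω` on `(v_0, …, v_p)` is
`∑_k (-1)^k ∂_{v_k} (ω (v_0, …, v̂_k, …, v_p))`, that is `dω = ∑_j dx_j ∧ ∂_j ω`. -/
def deRham (n p : ℕ) : Form n p →ₗ[ℂ] Form n (p + 1) :=
  AlternatingMap.alternatizeUncurryFinLM ∘ₗ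
    LinearMap.mk₂ ℂ (fun (ω : Form n p) (v : Fin n → ℂ) =>
        ∑ j, v j • (partialD n j).compAlternatingMap ω)
      (fun ω ω' v => by ext1 u; simp [Finset.sum_add_distrib])
      (fun c ω v => by ext1 u; simp [Finset.smul_sum, smul_comm c])
      (fun ω v v' => by simp [add_smul, Finset.sum_add_distrib])
      (fun c ω v => by simp [Finset.smul_sum, mul_smul])

theorem continuous_deRham (n p : ℕ) : Continuous (deRham n p) := by
  refine continuous_form_iff.2 fun v => ?_
  simp only [deRham, LinearMap.comp_apply, AlternatingMap.alternatizeUncurryFinLM_apply,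
    AlternatingMap.alternatizeUncurryFin_apply, LinearMap.mk₂_apply, alt_sum_apply,
    AlternatingMap.smul_apply, LinearMap.compAlternatingMap_apply]
  exact continuous_finsetSum _ fun i _ => (continuous_const_smul _).comp
    (continuous_finsetSum _ fun j _ => (continuous_const_smul _).comp
      ((continuous_partialD n j).comp (continuous_form_apply _)))

/-- The interior product `ι_X ω = ∑_i X_i ω(e_i, -, …, -)`. -/
def interior (n p : ℕ) : Vect n →ₗ[ℂ] Form n (p + 1) →ₗ[ℂ] Form n p :=
  LinearMap.mk₂ ℂ (fun X ω => ∑ i, X i • ω.curryLeft (Pi.single i 1))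
    (fun X X' ω => by simp [add_smul, Finset.sum_add_distrib])
    (fun c X ω => by ext1 v; simp [alt_sum_apply, Finset.smul_sum])
    (fun X ω ω' => by simp [Finset.sum_add_distrib])
    (fun c X ω => by simp [Finset.smul_sum, smul_comm c])

theorem interior_apply (n p : ℕ) (X : Vect n) (ω : Form n (p + 1)) (v : Fin p → Fin n → ℂ) :
    interior n p X ω v = ∑ i, X i * ω (Matrix.vecCons (Pi.single i 1) v) := by
  have h : interior n p X ω = ∑ i, X i • ω.curryLeft (Pi.single i 1) := rfl
  rw [h, alt_sum_apply]
  rfl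

theorem continuous_interior (n p : ℕ) :
    Continuous fun x : Vect n × Form n (p + 1) => interior n p x.1 x.2 := by
  refine continuous_form_iff.2 fun v => ?_
  simp only [interior_apply]
  exact continuous_finsetSum _ fun i _ => ((continuous_apply i).comp continuous_fst).mul
    ((continuous_form_apply _).comp continuous_snd)

/-- The Lie derivative `L_X = d ι_X + ι_X d` on formal forms (with `ι_X = 0` on functions). -/
def lieD (n : ℕ) : (p : ℕ) → Vect n →ₗ[ℂ] Form n p →ₗ[ℂ] Form n p
  | 0 => (interior n 0).compl₂ (deRham n 0)
  | p + 1 => (interior n p).compr₂ (deRham n p) + (interior n (p + 1)).compl₂ (deRham n (p + 1))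

theorem continuous_lieD (n : ℕ) :
    ∀ p, Continuous fun x : Vect n × Form n p => lieD n p x.1 x.2
  | 0 => (continuous_interior n 0).comp
      (continuous_fst.prodMk ((continuous_deRham n 0).comp continuous_snd))
  | p + 1 => ((continuous_deRham n p).comp (continuous_interior n p)).add
      ((continuous_interior n (p + 1)).comp
        (continuous_fst.prodMk ((continuous_deRham n (p + 1)).comp continuous_snd)))

/-- The wedge product of formal forms. -/
def wedge (n p p' : ℕ) : Form n p →ₗ[ℂ] Form n p' →ₗ[ℂ] Form n (p + p') :=
  altMul (LinearMap.mul ℂ (FormalFun n)) p p'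

theorem continuous_wedge (n p p' : ℕ) :
    Continuous fun x : Form n p × Form n p' => wedge n p p' x.1 x.2 :=
  continuous_form_iff.2 fun v => continuous_altMul _ continuous_mul p p'
    (fun x : Form n p × Form n p' => x.1) (fun x => x.2) (fun _ => v)
    (fun _ => (continuous_form_apply _).comp continuous_fst)
    (fun _ => (continuous_form_apply _).comp continuous_snd)

/-- A constant, as a formal `0`-form. -/
def constForm (n : ℕ) : ℂ →ₗ[ℂ] Form n 0 where
  toFun c := AlternatingMap.constOfIsEmpty ℂ _ _ (MvPowerSeries.C c)
  map_add' a b := by ext1 v; simp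
  map_smul' a b := by ext1 v; simp [MvPowerSeries.smul_eq_C_mul]

theorem continuous_constForm (n : ℕ) : Continuous (constForm n) := by
  refine continuous_form_iff.2 fun v => ?_
  simpa [constForm] using MvPowerSeries.WithPiTopology.continuous_C (σ := Fin n) (R := ℂ)

/-- Evaluation of a formal function (a `0`-form) at the origin. -/
def evalZero (n : ℕ) : Form n 0 →ₗ[ℂ] ℂ where
  toFun ω := MvPowerSeries.constantCoeff (ω ![])
  map_add' a b := by simp
  map_smul' a b := by simp

theorem continuous_evalZero (n : ℕ) : Continuous (evalZero n) :=
  (MvPowerSeries.WithPiTopology.continuous_constantCoeff ℂ).comp (continuous_form_apply _)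

/-- The operator `f ↦ ∫_0^1 t^p f(t x) dt` on formal power series: the coefficient of `x^m` is
multiplied by `∫_0^1 t^{|m| + p} dt = 1 / (|m| + p + 1)`. -/
def dilationAverage (n p : ℕ) : FormalFun n →ₗ[ℂ] FormalFun n where
  toFun f := fun m => ((m.degree : ℂ) + p + 1)⁻¹ * MvPowerSeries.coeff m f
  map_add' f g := by
    ext m
    exact mul_add _ _ _
  map_smul' c f := by
    ext m
    exact mul_left_comm _ _ _

theorem continuous_dilationAverage (n p : ℕ) : Continuous (dilationAverage n p) :=
  continuous_formalFun_iff.2 fun d =>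
    continuous_const.mul (MvPowerSeries.WithPiTopology.continuous_coeff ℂ d)

/-- The Euler vector field `E = ∑ x_i ∂_i`. -/
def euler (n : ℕ) : Vect n := fun i => MvPowerSeries.X i

/-- The Poincaré homotopy `K ω = ∫_{[0,1]} h^* ω` for the contraction `h(t, x) = t x`:
for `ω = ∑ ω_I(x) dx^I` of degree `p + 1`, the `dt`-component of `h^* ω = ∑ ω_I(t x) d(t x^I)` is
`dt ∧ t^p ∑ ω_I(t x) ι_E dx^I`, so that `K ω = ι_E (∑ (∫_0^1 t^p ω_I(t x) dt) dx^I)`. -/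
def poincare (n p : ℕ) : Form n (p + 1) →ₗ[ℂ] Form n p where
  toFun ω := interior n p (euler n) ((dilationAverage n p).compAlternatingMap ω)
  map_add' a b := by
    rw [← map_add]
    congr 1
    ext1 v
    simp
  map_smul' c a := by
    rw [RingHom.id_apply, ← map_smul]
    congr 1
    ext1 v
    simp

theorem poincare_apply (n p : ℕ) (ω : Form n (p + 1)) (v : Fin p → Fin n → ℂ) :
    poincare n p ω v = ∑ i, MvPowerSeries.X i *
      dilationAverage n p (ω (Matrix.vecCons (Pi.single i 1) v)) := by
  have h : poincare n p ω =
    interior n p (euler n) ((dilationAverage n p).compAlternatingMap ω) := rfl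
  rw [h, interior_apply]
  rfl

theorem continuous_poincare (n p : ℕ) : Continuous (poincare n p) := by
  refine continuous_form_iff.2 fun v => ?_
  simp only [poincare_apply]
  exact continuous_finsetSum _ fun i _ => continuous_const.mul
    ((continuous_dilationAverage n p).comp (continuous_form_apply _))

/-! ## Continuous cochains of formal vector fields -/

section Cochains

variable {N N' N'' : Type} [AddCommGroup N] [Module ℂ N] [TopologicalSpace N]
  [IsTopologicalAddGroup N] [ContinuousConstSMul ℂ N]
  [AddCommGroup N'] [Module ℂ N'] [TopologicalSpace N']
  [IsTopologicalAddGroup N'] [ContinuousConstSMul ℂ N']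
  [AddCommGroup N''] [Module ℂ N''] [TopologicalSpace N'']
  [IsTopologicalAddGroup N''] [ContinuousConstSMul ℂ N'']

/-- `C^q(vect(n); N)`: continuous alternating `q`-linear maps `vect(n)^q → N`. -/
@[ext]
structure Cochain (n q : ℕ) (N : Type) [AddCommGroup N] [Module ℂ N] [TopologicalSpace N] where
  val : Vect n [⋀^Fin q]→ₗ[ℂ] N
  cont : Continuous val

instance (n q : ℕ) : Zero (Cochain n q N) := ⟨⟨0, continuous_const⟩⟩

instance (n q : ℕ) : Add (Cochain n q N) := ⟨fun a b => ⟨a.val + b.val, a.cont.add b.cont⟩⟩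

instance (n q : ℕ) : Neg (Cochain n q N) := ⟨fun a => ⟨-a.val, a.cont.neg⟩⟩

instance (n q : ℕ) : SMul ℂ (Cochain n q N) := ⟨fun c a => ⟨c • a.val, a.cont.const_smul c⟩⟩

instance (n q : ℕ) : AddCommGroup (Cochain n q N) where
  add_assoc a b c := Cochain.ext (add_assoc a.val b.val c.val)
  zero_add a := Cochain.ext (zero_add a.val)
  add_zero a := Cochain.ext (add_zero a.val)
  add_comm a b := Cochain.ext (add_comm a.val b.val)
  neg_add_cancel a := Cochain.ext (neg_add_cancel a.val)
  nsmul := nsmulRec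
  zsmul := zsmulRec

instance (n q : ℕ) : Module ℂ (Cochain n q N) where
  one_smul a := Cochain.ext (one_smul ℂ a.val)
  mul_smul c d a := Cochain.ext (mul_smul c d a.val)
  smul_zero c := Cochain.ext (smul_zero c)
  smul_add c a b := Cochain.ext (smul_add c a.val b.val)
  add_smul c d a := Cochain.ext (add_smul c d a.val)
  zero_smul a := Cochain.ext (zero_smul ℂ a.val)

@[simp] theorem Cochain.val_add {n q : ℕ} (a b : Cochain n q N) :
    (a + b).val = a.val + b.val := rfl

@[simp] theorem Cochain.val_smul {n q : ℕ} (c : ℂ) (a : Cochain n q N) :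
    (c • a).val = c • a.val := rfl

theorem continuous_alternatize {n q : ℕ} (F : Vect n →ₗ[ℂ] Vect n [⋀^Fin q]→ₗ[ℂ] N)
    (hF : Continuous fun x : Vect n × (Fin q → Vect n) => F x.1 x.2) :
    Continuous (AlternatingMap.alternatizeUncurryFin F) := by
  have h : (AlternatingMap.alternatizeUncurryFin F : (Fin (q + 1) → Vect n) → N) =
      fun v => ∑ i : Fin (q + 1), (-1 : ℤ) ^ (i : ℕ) • F (v i) (i.removeNth v) :=
    funext fun v => AlternatingMap.alternatizeUncurryFin_apply F v
  rw [h]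
  refine continuous_finsetSum _ fun i _ => ?_
  have h2 : Continuous fun v : Fin (q + 1) → Vect n => (v i, i.removeNth v) :=
    (continuous_apply i).prodMk (continuous_pi fun j => continuous_apply _)
  exact (continuous_zsmul ((-1 : ℤ) ^ (i : ℕ))).comp (hF.comp h2)

/-- Composition of a cochain with a continuous linear map of coefficients. -/
def postcomp (n q : ℕ) (T : N →ₗ[ℂ] N') (hT : Continuous T) :
    Cochain n q N →ₗ[ℂ] Cochain n q N' where
  toFun φ := ⟨T.compAlternatingMap φ.val, hT.comp φ.cont⟩
  map_add' a b := by
    apply Cochain.ext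
    ext1 v
    simp
  map_smul' c a := by
    apply Cochain.ext
    ext1 v
    simp

/-- For a continuous bilinear operation `B : vect(n) × N → N'`, the operator
`(B φ)(X_0, …, X_q) = ∑_k (-1)^k B(X_k, φ(X_0, …, X̂_k, …, X_q))` on cochains. -/
def insertion (n q : ℕ) (B : Vect n →ₗ[ℂ] N →ₗ[ℂ] N')
    (hB : Continuous fun x : Vect n × N => B x.1 x.2) :
    Cochain n q N →ₗ[ℂ] Cochain n (q + 1) N' where
  toFun φ := ⟨AlternatingMap.alternatizeUncurryFin
      { toFun := fun X => (B X).compAlternatingMap φ.val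
        map_add' := fun X Y => by ext1 v; simp
        map_smul' := fun c X => by ext1 v; simp },
    continuous_alternatize _ (hB.comp (continuous_fst.prodMk (φ.cont.comp continuous_snd)))⟩
  map_add' a b := by
    apply Cochain.ext
    ext1 v
    simp [AlternatingMap.alternatizeUncurryFin_apply, Finset.sum_add_distrib]
  map_smul' c a := by
    apply Cochain.ext
    ext1 v
    simp [AlternatingMap.alternatizeUncurryFin_apply, Finset.smul_sum, smul_comm c]

theorem insertion_apply {n q : ℕ} (B : Vect n →ₗ[ℂ] N →ₗ[ℂ] N')
    (hB : Continuous fun x : Vect n × N => B x.1 x.2) (φ : Cochain n q N)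
    (X : Fin (q + 1) → Vect n) :
    (insertion n q B hB φ).val X =
      ∑ k : Fin (q + 1), (-1 : ℤ) ^ (k : ℕ) • B (X k) (φ.val (k.removeNth X)) :=
  AlternatingMap.alternatizeUncurryFin_apply _ _

/-- The bilinear map `(X, Y) ↦ φ(∇_X Y, -, …, -)` attached to an alternating map `φ`. -/
def nablaInsert {n r : ℕ} (φ : Vect n [⋀^Fin (r + 1)]→ₗ[ℂ] N) :
    Vect n →ₗ[ℂ] Vect n →ₗ[ℂ] Vect n [⋀^Fin r]→ₗ[ℂ] N :=
  (nabla n).compr₂ φ.curryLeft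

theorem nablaInsert_apply {n r : ℕ} (φ : Vect n [⋀^Fin (r + 1)]→ₗ[ℂ] N) (X Y : Vect n)
    (v : Fin r → Vect n) : nablaInsert φ X Y v = φ (Matrix.vecCons (nabla n X Y) v) := rfl

/-- The Chevalley–Eilenberg differential for trivial coefficients on all alternating maps, see
`dTriv_apply`. Since `[X, Y] = ∇_X Y - ∇_Y X`, antisymmetrizing `φ(∇_X Y, …)` yields the terms
`φ([X, Y], …)`. -/
def dTrivAux {n r : ℕ} :
    (Vect n [⋀^Fin (r + 1)]→ₗ[ℂ] N) →ₗ[ℂ] (Vect n [⋀^Fin (r + 2)]→ₗ[ℂ] N) where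
  toFun φ := -AlternatingMap.alternatizeUncurryFin
    (AlternatingMap.alternatizeUncurryFinLM ∘ₗ nablaInsert φ)
  map_add' a b := by
    have h : nablaInsert (a + b) = nablaInsert a + nablaInsert b := rfl
    rw [h, LinearMap.comp_add, AlternatingMap.alternatizeUncurryFin_add, neg_add]
  map_smul' c a := by
    have h : nablaInsert (c • a) = c • nablaInsert a := rfl
    rw [h, LinearMap.comp_smul, AlternatingMap.alternatizeUncurryFin_smul, ← smul_neg]
    rfl

theorem continuous_dTrivAux {n r : ℕ} (φ : Vect n [⋀^Fin (r + 1)]→ₗ[ℂ] N) (hφ : Continuous φ) :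
    Continuous (dTrivAux φ) := by
  have h : Continuous (AlternatingMap.alternatizeUncurryFin
      (AlternatingMap.alternatizeUncurryFinLM ∘ₗ nablaInsert φ)) := by
    refine continuous_alternatize _ ?_
    simp only [LinearMap.comp_apply, AlternatingMap.alternatizeUncurryFinLM_apply,
      AlternatingMap.alternatizeUncurryFin_apply]
    refine continuous_finsetSum _ fun i _ => ?_
    have h1 : Continuous fun x : Vect n × (Fin (r + 1) → Vect n) => (x.1, x.2 i) :=
      continuous_fst.prodMk ((continuous_apply i).comp continuous_snd)
    have h3 := (continuous_nabla n).comp h1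
    have h4 : Continuous fun x : Vect n × (Fin (r + 1) → Vect n) => i.removeNth x.2 :=
      continuous_pi fun j => (continuous_apply (i.succAbove j)).comp continuous_snd
    have h2 : Continuous fun x : Vect n × (Fin (r + 1) → Vect n) =>
        Matrix.vecCons (nabla n x.1 (x.2 i)) (i.removeNth x.2) := continuous_vecCons h3 h4
    simp only [nablaInsert_apply]
    exact (continuous_zsmul ((-1 : ℤ) ^ (i : ℕ))).comp (hφ.comp h2)
  exact h.neg

/-- The Chevalley–Eilenberg differential for trivial coefficients, see `dTriv_apply`. -/
def dTriv (n : ℕ) : (q : ℕ) → Cochain n q N →ₗ[ℂ] Cochain n (q + 1) N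
  | 0 => 0
  | _ + 1 =>
    { toFun := fun φ => ⟨dTrivAux φ.val, continuous_dTrivAux φ.val φ.cont⟩
      map_add' := fun a b => Cochain.ext (map_add dTrivAux a.val b.val)
      map_smul' := fun c a => Cochain.ext (map_smul dTrivAux c a.val) }

/-- The explicit formula
`(d φ)(X_0, …, X_{r+1}) = ∑_{i<j} (-1)^{i+j} φ([X_i, X_j], X_0, …, X̂_i, …, X̂_j, …, X_{r+1})`.
The pairs `i < j` are written `(i, j + 1)` with `i ≤ j` in `Fin (r + 1)`. -/
theorem dTriv_apply {n r : ℕ} (φ : Cochain n (r + 1) N) (X : Fin (r + 2) → Vect n) :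
    (dTriv n (r + 1) φ).val X = ∑ i : Fin (r + 1), ∑ j ≥ i, (-1 : ℤ) ^ (i + (j + 1) : ℕ) •
      φ.val (Matrix.vecCons (bracket (X i.castSucc) (X j.succ))
        (j.removeNth (i.castSucc.removeNth X))) := by
  have h : (dTriv n (r + 1) φ).val X = -AlternatingMap.alternatizeUncurryFin
      (AlternatingMap.alternatizeUncurryFinLM ∘ₗ nablaInsert φ.val) X := rfl
  rw [h, AlternatingMap.alternatizeUncurryFin_alternatizeUncurryFinLM_comp_apply,
    ← Finset.sum_neg_distrib]
  refine Finset.sum_congr rfl fun i _ => ?_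
  rw [← Finset.sum_neg_distrib]
  refine Finset.sum_congr rfl fun j _ => ?_
  have h2 : ∀ (Y Z : Vect n) (w : Fin r → Vect n),
      φ.val (Matrix.vecCons (Y - Z) w) = φ.val.curryLeft Y w - φ.val.curryLeft Z w := fun Y Z w => by
    rw [← AlternatingMap.sub_apply, ← map_sub]
    rfl
  rw [bracket, h2, ← add_assoc, pow_succ, mul_neg_one, neg_smul]
  rfl

/-- The product of cochains along a continuous bilinear map of coefficients. -/
def cup (n q q' : ℕ) (m : N →ₗ[ℂ] N' →ₗ[ℂ] N'') (hm : Continuous fun x : N × N' => m x.1 x.2) :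
    Cochain n q N →ₗ[ℂ] Cochain n q' N' →ₗ[ℂ] Cochain n (q + q') N'' :=
  LinearMap.mk₂ ℂ
    (fun a b => ⟨altMul m q q' a.val b.val, continuous_altMul m hm q q' (fun _ => a.val)
      (fun _ => b.val) (fun v => v)
      (fun _ => a.cont.comp (continuous_pi fun _ => continuous_apply _))
      (fun _ => b.cont.comp (continuous_pi fun _ => continuous_apply _))⟩)
    (fun a a' b => Cochain.ext (by simp))
    (fun c a b => Cochain.ext (by simp))
    (fun a b b' => Cochain.ext (by simp))
    (fun c a b => Cochain.ext (by simp))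

/-- A coefficient vector as a `0`-cochain. -/
def constCochain (n : ℕ) (x : N) : Cochain n 0 N :=
  ⟨AlternatingMap.constOfIsEmpty ℂ _ _ x, continuous_const⟩

end Cochains

/-- `C^q(vect(n); Ω^p)`. -/
abbrev FormCochain (n q p : ℕ) : Type := Cochain n q (Form n p)

/-- The Chevalley–Eilenberg differential on `C^q(vect(n); Ω^p)`,
`(d_CE φ)(X_0, …, X_q) = ∑_{i<j} (-1)^{i+j} φ([X_i, X_j], X_0, …, X̂_i, …, X̂_j, …, X_q)
  + ∑_i (-1)^i L_{X_i} φ(X_0, …, X̂_i, …, X_q)`. -/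
def dCE (n q p : ℕ) : FormCochain n q p →ₗ[ℂ] FormCochain n (q + 1) p :=
  dTriv n q + insertion n q (lieD n p) (continuous_lieD n p)

/-- The de Rham differential acting on the values of a cochain. -/
def dDR (n q p : ℕ) : FormCochain n q p →ₗ[ℂ] FormCochain n q (p + 1) :=
  postcomp n q (deRham n p) (continuous_deRham n p)

/-- The contraction `C^q(vect(n); Ω^{p+1}) → C^{q+1}(vect(n); Ω^p)`,
`(ι φ)(X_0, …, X_q) = ∑_k (-1)^k ι_{X_k} φ(X_0, …, X̂_k, …, X_q)`. -/
def contraction (n q p : ℕ) : FormCochain n q (p + 1) →ₗ[ℂ] FormCochain n (q + 1) p :=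
  insertion n q (interior n p) (continuous_interior n p)

/-! ## Commutative differential graded algebras -/

/-- The data of a differential graded algebra: a complex vector space with a family of
subspaces `deg k`, a product, a unit and a differential. The axioms are in `IsCDGA`. -/
structure DGData where
  carrier : Type
  [addCommGroup : AddCommGroup carrier]
  [module : Module ℂ carrier]
  deg : ℕ → Submodule ℂ carrier
  mul : carrier →ₗ[ℂ] carrier →ₗ[ℂ] carrier
  one : carrier
  d : carrier →ₗ[ℂ] carrier

attribute [instance] DGData.addCommGroup DGData.module

/-- The axioms of a commutative differential graded algebra (with differential of degree `+1`). -/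
structure DGData.IsCDGA (A : DGData) : Prop where
  internal : DirectSum.IsInternal A.deg
  one_mem : A.one ∈ A.deg 0
  mul_mem : ∀ k l a b, a ∈ A.deg k → b ∈ A.deg l → A.mul a b ∈ A.deg (k + l)
  one_mul : ∀ a, A.mul A.one a = a
  mul_assoc : ∀ a b c, A.mul (A.mul a b) c = A.mul a (A.mul b c)
  mul_comm : ∀ k l a b, a ∈ A.deg k → b ∈ A.deg l → A.mul a b = (-1 : ℂ) ^ (k * l) • A.mul b a
  d_mem : ∀ k, ∀ a ∈ A.deg k, A.d a ∈ A.deg (k + 1)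
  d_d : ∀ a, A.d (A.d a) = 0
  leibniz : ∀ k a b, a ∈ A.deg k →
    A.d (A.mul a b) = A.mul (A.d a) b + (-1 : ℂ) ^ k • A.mul a (A.d b)

/-- The underlying cochain complex of a commutative differential graded algebra. -/
def DGData.IsCDGA.complex {A : DGData} (hA : A.IsCDGA) : CochainComplex (ModuleCat ℂ) ℕ :=
  CochainComplex.of (fun k => ModuleCat.of ℂ (A.deg k))
    (fun k => ModuleCat.ofHom (A.d.restrict (hA.d_mem k)))
    (fun k => by
      ext a
      exact hA.d_d a.1)

/-- Morphisms of differential graded algebras. -/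
structure IsDGAHom (A B : DGData) (f : A.carrier →ₗ[ℂ] B.carrier) : Prop where
  map_mem : ∀ k, ∀ a ∈ A.deg k, f a ∈ B.deg k
  map_one : f A.one = B.one
  map_mul : ∀ a b, f (A.mul a b) = B.mul (f a) (f b)
  map_d : ∀ a, f (A.d a) = B.d (f a)

/-- The chain map underlying a morphism of commutative differential graded algebras. -/
def IsDGAHom.chainMap {A B : DGData} {f : A.carrier →ₗ[ℂ] B.carrier} (hf : IsDGAHom A B f)
    (hA : A.IsCDGA) (hB : B.IsCDGA) : hA.complex ⟶ hB.complex :=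
  CochainComplex.ofHom
    (fun k => ModuleCat.ofHom (f.restrict (hf.map_mem k)))
    (fun k => by
      simp only [DGData.IsCDGA.complex, CochainComplex.of_d]
      ext a
      exact (hf.map_d a.1).symm)

/-! ## The two algebras -/

/-- The underlying space `⨁_{q,p} C^q(vect(n); Ω^p)` of the total complex. -/
abbrev Tot (n : ℕ) : Type := DirectSum (ℕ × ℕ) fun a => FormCochain n a.1 a.2

/-- The inclusion of `C^q(vect(n); Ω^p)` as the summand of bidegree `(q, p)`. -/
abbrev Tot.of (n q p : ℕ) : FormCochain n q p →ₗ[ℂ] Tot n :=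
  DirectSum.lof ℂ (ℕ × ℕ) (fun a => FormCochain n a.1 a.2) (q, p)

/-- The part of total degree `q + p = k`. -/
def totDeg (n k : ℕ) : Submodule ℂ (Tot n) where
  carrier := {a | ∀ x : ℕ × ℕ, x.1 + x.2 ≠ k → a x = 0}
  add_mem' := fun ha hb x hx => by simp [ha x hx, hb x hx]
  zero_mem' := fun x _ => rfl
  smul_mem' := fun c a ha x hx => by simp [DirectSum.smul_apply, ha x hx]

/-- The product of `a ∈ C^q(vect(n); Ω^p)` and `b ∈ C^{q'}(vect(n); Ω^{p'})` is `(-1)^{p q'}` times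
the shuffle product formed with the wedge product of forms. -/
def totMul (n : ℕ) : Tot n →ₗ[ℂ] Tot n →ₗ[ℂ] Tot n :=
  DirectSum.toModule ℂ (ℕ × ℕ) _ fun x => LinearMap.flip
    (DirectSum.toModule ℂ (ℕ × ℕ) _ fun y => LinearMap.flip
      ((-1 : ℂ) ^ (x.2 * y.1) • (cup n x.1 y.1 (wedge n x.2 y.2)
        (continuous_wedge n x.2 y.2)).compr₂ (Tot.of n (x.1 + y.1) (x.2 + y.2))))

/-- The total differential, equal to `D = d_CE + (-1)^q d_dR` on `C^q(vect(n); Ω^p)`. -/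
def totD (n : ℕ) : Tot n →ₗ[ℂ] Tot n :=
  DirectSum.toModule ℂ (ℕ × ℕ) _ fun x =>
    Tot.of n (x.1 + 1) x.2 ∘ₗ dCE n x.1 x.2 +
      (-1 : ℂ) ^ x.1 • (Tot.of n x.1 (x.2 + 1) ∘ₗ dDR n x.1 x.2)

/-- The total complex `Tot C^•(vect(n); Ω^•)` with its product. -/
def totData (n : ℕ) : DGData where
  carrier := Tot n
  deg := totDeg n
  mul := totMul n
  one := Tot.of n 0 0 (constCochain n (constForm n 1))
  d := totD n

/-- The underlying space `⨁_q C^q(vect(n); ℂ)` of the complex with constant coefficients. -/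
abbrev Base (n : ℕ) : Type := DirectSum ℕ fun q => Cochain n q ℂ

/-- The inclusion of `C^q(vect(n); ℂ)` as the summand of degree `q`. -/
abbrev Base.of (n q : ℕ) : Cochain n q ℂ →ₗ[ℂ] Base n :=
  DirectSum.lof ℂ ℕ (fun q => Cochain n q ℂ) q

/-- The part of degree `k`. -/
def baseDeg (n k : ℕ) : Submodule ℂ (Base n) where
  carrier := {a | ∀ q : ℕ, q ≠ k → a q = 0}
  add_mem' := fun ha hb x hx => by simp [ha x hx, hb x hx]
  zero_mem' := fun x _ => rfl
  smul_mem' := fun c a ha x hx => by simp [DirectSum.smul_apply, ha x hx]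

/-- The shuffle product of cochains. -/
def baseMul (n : ℕ) : Base n →ₗ[ℂ] Base n →ₗ[ℂ] Base n :=
  DirectSum.toModule ℂ ℕ _ fun q => LinearMap.flip
    (DirectSum.toModule ℂ ℕ _ fun q' => LinearMap.flip
      ((cup n q q' (LinearMap.mul ℂ ℂ) continuous_mul).compr₂ (Base.of n (q + q'))))

/-- The Chevalley–Eilenberg differential. -/
def baseD (n : ℕ) : Base n →ₗ[ℂ] Base n :=
  DirectSum.toModule ℂ ℕ _ fun q => Base.of n (q + 1) ∘ₗ dTriv n q

/-- The Chevalley–Eilenberg algebra `C^•(vect(n); ℂ)`. -/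
def baseData (n : ℕ) : DGData where
  carrier := Base n
  deg := baseDeg n
  mul := baseMul n
  one := Base.of n 0 (constCochain n 1)
  d := baseD n

/-! ## The maps -/

/-- The operator `ι` on the total complex, of bidegree `(1, -1)`: on `C^q(vect(n); Ω^p)` it is
`(-1)^{q+1}` times the contraction. The sign makes it a derivation of the total complex. -/
def iota (n : ℕ) : Tot n →ₗ[ℂ] Tot n :=
  DirectSum.toModule ℂ (ℕ × ℕ) _ fun x => match x with
    | (_, 0) => 0
    | (q, p + 1) => (-1 : ℂ) ^ (q + 1) • (Tot.of n (q + 1) p ∘ₗ contraction n q p)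

/-- `e^{T} = ∑_{k ≤ n} T^k / k!` for an operator `T` with `T^{n+1} = 0`. -/
def expOp (n : ℕ) (T : Module.End ℂ (Tot n)) : Module.End ℂ (Tot n) :=
  ∑ k ∈ Finset.range (n + 1), ((k.factorial : ℂ))⁻¹ • T ^ k

/-- Evaluation at the origin `α ↦ α|_0`: zero on `C^q(vect(n); Ω^p)` for `p > 0`, and
`α|_0 (X_1, …, X_q) = α(X_1, …, X_q)(0)` for `p = 0`. -/
def restrictZero (n : ℕ) : Tot n →ₗ[ℂ] Base n :=
  DirectSum.toModule ℂ (ℕ × ℕ) _ fun x => match x with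
    | (q, 0) => Base.of n q ∘ₗ postcomp n q (evalZero n) (continuous_evalZero n)
    | (_, _ + 1) => 0

/-- `Φ(α) = (e^ι α)|_0`. -/
def Phi (n : ℕ) : Tot n →ₗ[ℂ] Base n :=
  restrictZero n ∘ₗ expOp n (iota n)

/-- The map `C^•(vect(n); ℂ) → Tot C^•(vect(n); Ω^•)` induced by the inclusion of constants. -/
def incl (n : ℕ) : Base n →ₗ[ℂ] Tot n :=
  DirectSum.toModule ℂ ℕ _ fun q =>
    Tot.of n q 0 ∘ₗ postcomp n q (constForm n) (continuous_constForm n)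

/-- The Poincaré homotopy on the values of cochains, with the sign `-(-1)^q` on
`C^q(vect(n); Ω^p)`. -/
def poincareTot (n : ℕ) : Tot n →ₗ[ℂ] Tot n :=
  DirectSum.toModule ℂ (ℕ × ℕ) _ fun x => match x with
    | (_, 0) => 0
    | (q, p + 1) => (-1 : ℂ) ^ (q + 1) •
        (Tot.of n q p ∘ₗ postcomp n q (poincare n p) (continuous_poincare n p))

/-- The homotopy `Ψ = e^{-ι} ∘ (∫_{[0,1]} h^*) ∘ e^{ι}`. -/
def Psi (n : ℕ) : Tot n →ₗ[ℂ] Tot n :=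
  expOp n (-iota n) ∘ₗ poincareTot n ∘ₗ expOp n (iota n)

end GelfandFuks

end

/-! The exponential of the contraction is a change of variables. Write `j_X` for insertion of `X`
into a cochain minus the signed interior product `ι_X` on its values. Then `e^ι` is the substitution
that replaces every insertion of `X` by `j_X`. Each `j_X` is an odd derivation, so `e^ι` is
multiplicative. Cartan's relations `dι_X + ι_X d = L_X` and `[L_Y, ι_X] = ι_{[Y,X]}` show that in
the anticommutator of `D` with `j_X` the Lie derivatives of the values cancel; only the bracket
action on the arguments is left. Hence `e^ι` conjugates `D` to the differential in which vector
fields act trivially on forms, namely the differential for trivial coefficients plus the signed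
`d_dR`.

For the conjugated differential everything is elementary. Evaluating the function part at the origin
is a morphism of dg algebras, and the Poincaré homotopy on values contracts the complex onto
constants; transporting it back gives `Ψ`. Contractions kill constant functions, so `e^ι` fixes the
image of `i` and `Φ ∘ i = id`. The identities `D² = 0` and the Leibniz rule for `D` are also checked
after conjugation.

To handle signs uniformly, cochains of all degrees are encoded by `evT`, injectively, as functions
on lists of vector fields whose values are functions on lists of vectors. Each operation obeys a
rule for removing the head of a list (`ins X`), and identities are proved by induction on the list.
The main steps are `ev_alternatize` and `sh_ev` (the list operations are the given ones),
`expL_eq_sum`, `expL_sh` and `expL_dTot` (properties of `e^ι`), `lieOp_ixL` (Cartan's commutator)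
and `dRL_poincareL` (the Poincaré lemma). -/

noncomputable section

namespace GelfandFuks

/-! ## Calculus of functions on lists -/

section ListCalculus

variable {M N N' N'' : Type} [AddCommGroup N] [Module ℂ N] [AddCommGroup N'] [Module ℂ N']
  [AddCommGroup N''] [Module ℂ N'']

/-- Insertion of `X` as the first argument. -/
def ins (X : M) : (List M → N) →ₗ[ℂ] (List M → N) where
  toFun φ l := φ (X :: l)
  map_add' _ _ := rfl
  map_smul' _ _ := rfl

/-- Application of a linear map to the values. -/
def post (T : N →ₗ[ℂ] N') : (List M → N) →ₗ[ℂ] (List M → N') where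
  toFun φ l := T (φ l)
  map_add' _ _ := funext fun _ => map_add T _ _
  map_smul' _ _ := funext fun _ => map_smul T _ _

/-- Application of a linear map to the values, with the sign `(-1)^q` in degree `q`. -/
def tw (T : N →ₗ[ℂ] N') : (List M → N) →ₗ[ℂ] (List M → N') where
  toFun φ l := (-1 : ℂ) ^ l.length • T (φ l)
  map_add' _ _ := funext fun _ => by simp
  map_smul' c _ := funext fun _ => by simp [smul_comm c]

theorem ins_apply (X : M) (φ : List M → N) (l : List M) : ins X φ l = φ (X :: l) := rfl

theorem post_apply (T : N →ₗ[ℂ] N') (φ : List M → N) (l : List M) : post T φ l = T (φ l) := rfl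

theorem tw_apply (T : N →ₗ[ℂ] N') (φ : List M → N) (l : List M) :
    tw T φ l = (-1 : ℂ) ^ l.length • T (φ l) := rfl

theorem ins_post (T : N →ₗ[ℂ] N') (X : M) (φ : List M → N) :
    ins X (post T φ) = post T (ins X φ) := rfl

theorem ins_tw (T : N →ₗ[ℂ] N') (X : M) (φ : List M → N) :
    ins X (tw T φ) = -tw T (ins X φ) := by
  funext l
  simp [ins_apply, tw_apply, pow_succ]

theorem tw_tw (S : N' →ₗ[ℂ] N'') (T : N →ₗ[ℂ] N') (φ : List M → N) :
    tw S (tw T φ) = post (S ∘ₗ T) φ := by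
  funext l
  simp [tw_apply, post_apply, smul_smul, ← mul_pow]

theorem tw_post (S : N' →ₗ[ℂ] N'') (T : N →ₗ[ℂ] N') (φ : List M → N) :
    tw S (post T φ) = tw (S ∘ₗ T) φ := rfl

theorem post_tw (S : N' →ₗ[ℂ] N'') (T : N →ₗ[ℂ] N') (φ : List M → N) :
    post S (tw T φ) = tw (S ∘ₗ T) φ := by
  funext l
  simp [tw_apply, post_apply]

theorem post_post (S : N' →ₗ[ℂ] N'') (T : N →ₗ[ℂ] N') (φ : List M → N) :
    post S (post T φ) = post (S ∘ₗ T) φ := rfl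

theorem post_add_op (S T : N →ₗ[ℂ] N') (φ : List M → N) :
    post (S + T) φ = post S φ + post T φ := rfl

/-! ### Antisymmetrization -/

/-- The recursion behind `altL`. -/
def altAux : List M → (M → List M → N) → N
  | [], _ => 0
  | X :: l, G => G X l - altAux l (fun Y => ins X (G Y))

/-- Antisymmetrization in the first argument:
`altL G (X_0, …, X_q) = ∑ (-1)^k G(X_k)(X_0, …, X̂_k, …, X_q)`. -/
def altL (G : M → List M → N) : List M → N := fun l => altAux l G

theorem altL_nil (G : M → List M → N) : altL G [] = 0 := rfl

theorem ins_altL (X : M) (G : M → List M → N) :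
    ins X (altL G) = G X - altL (fun Y => ins X (G Y)) := rfl

theorem altL_cons (X : M) (G : M → List M → N) (l : List M) :
    altL G (X :: l) = G X l - altL (fun Y => ins X (G Y)) l := rfl

theorem altL_add (G H : M → List M → N) :
    altL (fun Y => G Y + H Y) = altL G + altL H := by
  funext l
  induction l generalizing G H with
  | nil => simp [altL_nil]
  | cons X l ih =>
    simp only [altL_cons, map_add, ih, Pi.add_apply]
    abel

theorem altL_post (T : N →ₗ[ℂ] N') (G : M → List M → N) :
    altL (fun Y => post T (G Y)) = post T (altL G) := by
  funext l
  induction l generalizing G with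
  | nil => simp [altL_nil, post_apply]
  | cons X l ih =>
    simp only [altL_cons, ins_post, ih, post_apply, map_sub]

theorem altL_smul (c : ℂ) (G : M → List M → N) :
    altL (fun Y => c • G Y) = c • altL G := by
  have h : ∀ φ : List M → N, c • φ = post (c • (LinearMap.id : N →ₗ[ℂ] N)) φ := fun _ => rfl
  simp only [h, altL_post]

theorem altL_neg (G : M → List M → N) : altL (fun Y => -G Y) = -altL G :=
  altL_post (-LinearMap.id) G

theorem altL_sub (G H : M → List M → N) :
    altL (fun Y => G Y - H Y) = altL G - altL H := by
  simp only [sub_eq_add_neg, altL_add, altL_neg]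

theorem altL_zero : altL (fun _ : M => (0 : List M → N)) = 0 := by
  simpa using altL_smul (N := N) 0 (fun _ : M => (0 : List M → N))

theorem altL_sum {κ : Type} (s : Finset κ) (G : κ → M → List M → N) :
    altL (fun Y => ∑ k ∈ s, G k Y) = ∑ k ∈ s, altL (G k) := by
  classical
  induction s using Finset.induction_on with
  | empty => simpa using altL_zero
  | insert a s ha ih => simp only [Finset.sum_insert ha, altL_add, ih]

/-- Antisymmetrization evaluates `G Y` on lists shorter by one, so the degree sign in `tw` changes
once. -/
theorem altL_tw (T : N →ₗ[ℂ] N') (G : M → List M → N) :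
    altL (fun Y => tw T (G Y)) = -tw T (altL G) := by
  funext l
  induction l generalizing G with
  | nil => simp [altL_nil, tw_apply]
  | cons X l ih =>
    simp only [altL_cons, ins_tw, altL_neg, Pi.neg_apply, ih, tw_apply, map_sub, smul_sub,
      List.length_cons, pow_succ, mul_neg_one, neg_smul]
    abel

/-! ### The shuffle product -/

/-- The recursion behind `sh`. -/
def shAux (m : N →ₗ[ℂ] N' →ₗ[ℂ] N'') (γ : N →ₗ[ℂ] N) :
    List M → (List M → N) → (List M → N') → N''
  | [], a, b => m (a []) (b [])
  -- The head goes either to the first factor or past it to the second. Passing costs `(-1)^q` for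
  -- the arguments of `a`, built into `tw`, and the parity `γ` of its values.
  | X :: l, a, b => shAux m γ l (ins X a) b + shAux m γ l (tw γ a) (ins X b)

theorem shAux_add_left (m : N →ₗ[ℂ] N' →ₗ[ℂ] N'') (γ : N →ₗ[ℂ] N) (l : List M) :
    ∀ a a' b, shAux m γ l (a + a') b = shAux m γ l a b + shAux m γ l a' b := by
  induction l with
  | nil => intros; simp [shAux]
  | cons X l ih => intros; simp only [shAux, map_add, ih]; abel

theorem shAux_add_right (m : N →ₗ[ℂ] N' →ₗ[ℂ] N'') (γ : N →ₗ[ℂ] N) (l : List M) :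
    ∀ a b b', shAux m γ l a (b + b') = shAux m γ l a b + shAux m γ l a b' := by
  induction l with
  | nil => intros; simp [shAux]
  | cons X l ih => intros; simp only [shAux, map_add, ih]; abel

theorem shAux_smul_left (m : N →ₗ[ℂ] N' →ₗ[ℂ] N'') (γ : N →ₗ[ℂ] N) (l : List M) :
    ∀ (c : ℂ) a b, shAux m γ l (c • a) b = c • shAux m γ l a b := by
  induction l with
  | nil => intros; simp [shAux]
  | cons X l ih => intros; simp only [shAux, map_smul, ih, smul_add]

theorem shAux_smul_right (m : N →ₗ[ℂ] N' →ₗ[ℂ] N'') (γ : N →ₗ[ℂ] N) (l : List M) :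
    ∀ (c : ℂ) a b, shAux m γ l a (c • b) = c • shAux m γ l a b := by
  induction l with
  | nil => intros; simp [shAux]
  | cons X l ih => intros; simp only [shAux, map_smul, ih, smul_add]

/-- The shuffle product along `m`, where `γ` is the grading involution of the coefficients. -/
def sh (m : N →ₗ[ℂ] N' →ₗ[ℂ] N'') (γ : N →ₗ[ℂ] N) :
    (List M → N) →ₗ[ℂ] (List M → N') →ₗ[ℂ] (List M → N'') :=
  LinearMap.mk₂ ℂ (fun a b l => shAux m γ l a b)
    (fun _ _ _ => funext fun l => shAux_add_left m γ l _ _ _)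
    (fun _ _ _ => funext fun l => shAux_smul_left m γ l _ _ _)
    (fun _ _ _ => funext fun l => shAux_add_right m γ l _ _ _)
    (fun _ _ _ => funext fun l => shAux_smul_right m γ l _ _ _)

theorem sh_nil (m : N →ₗ[ℂ] N' →ₗ[ℂ] N'') (γ : N →ₗ[ℂ] N) (a : List M → N) (b : List M → N') :
    sh m γ a b [] = m (a []) (b []) := rfl

theorem ins_sh (m : N →ₗ[ℂ] N' →ₗ[ℂ] N'') (γ : N →ₗ[ℂ] N) (X : M) (a : List M → N)
    (b : List M → N') :
    ins X (sh m γ a b) = sh m γ (ins X a) b + sh m γ (tw γ a) (ins X b) := rfl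

theorem sh_cons (m : N →ₗ[ℂ] N' →ₗ[ℂ] N'') (γ : N →ₗ[ℂ] N) (X : M) (a : List M → N)
    (b : List M → N') (l : List M) :
    sh m γ a b (X :: l) = sh m γ (ins X a) b l + sh m γ (tw γ a) (ins X b) l := rfl

/-- Naturality in the coefficients. It serves to replace forms by functions on lists, to embed
constants and evaluate at the origin, and to move a scalar function into either factor. -/
theorem sh_map {P P' P'' : Type} [AddCommGroup P] [Module ℂ P] [AddCommGroup P'] [Module ℂ P']
    [AddCommGroup P''] [Module ℂ P''] (m : N →ₗ[ℂ] N' →ₗ[ℂ] N'') (γ : N →ₗ[ℂ] N)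
    (m' : P →ₗ[ℂ] P' →ₗ[ℂ] P'') (γ' : P →ₗ[ℂ] P) (T : N →ₗ[ℂ] P) (T' : N' →ₗ[ℂ] P')
    (T'' : N'' →ₗ[ℂ] P'') (hm : ∀ x y, T'' (m x y) = m' (T x) (T' y))
    (hγ : ∀ x, T (γ x) = γ' (T x)) (a : List M → N) (b : List M → N') :
    post T'' (sh m γ a b) = sh m' γ' (post T a) (post T' b) := by
  funext l
  induction l generalizing a b with
  | nil => exact hm _ _
  | cons X l ih =>
    have h : tw γ' (post T a) = post T (tw γ a) := by
      funext l
      simp [tw_apply, post_apply, hγ]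
    have ih' := fun a b => ih a b
    simp only [post_apply] at ih'
    simp only [post_apply, sh_cons, map_add, ih', ins_post, h]

/-- Compatibility of a product with the grading involution. -/
structure GradedMul (m : N →ₗ[ℂ] N →ₗ[ℂ] N) (γ : N →ₗ[ℂ] N) : Prop where
  assoc : ∀ x y z, m (m x y) z = m x (m y z)
  map_mul : ∀ x y, γ (m x y) = m (γ x) (γ y)
  invol : ∀ x, γ (γ x) = x

variable {m : N →ₗ[ℂ] N →ₗ[ℂ] N} {γ : N →ₗ[ℂ] N}

theorem tw_sh (hm : GradedMul m γ) (a b : List M → N) :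
    tw γ (sh m γ a b) = sh m γ (tw γ a) (tw γ b) := by
  funext l
  induction l generalizing a b with
  | nil => simp [tw_apply, sh_nil, hm.map_mul]
  | cons X l ih =>
    rw [← ins_apply X (tw γ (sh m γ a b)), ← ins_apply X (sh m γ _ _), ins_tw, ins_sh, ins_sh, map_add, ins_tw, ins_tw]
    simp [ih]
    abel

theorem tw_invol (hm : GradedMul m γ) (a : List M → N) : tw γ (tw γ a) = a := by
  funext l
  simp [tw_tw, post_apply, hm.invol]

theorem sh_assoc (hm : GradedMul m γ) (a b c : List M → N) :
    sh m γ (sh m γ a b) c = sh m γ a (sh m γ b c) := by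
  funext l
  induction l generalizing a b c with
  | nil => simp [sh_nil, hm.assoc]
  | cons X l ih =>
    simp only [sh_cons, ins_sh, map_add, LinearMap.add_apply, Pi.add_apply, ih, tw_sh hm]
    abel

/-- This permits iteration: once over vectors, giving forms, and once over vector fields, giving
cochains with values in forms. -/
theorem gradedMul_sh (hm : GradedMul m γ) : GradedMul (sh (M := M) m γ) (tw γ) :=
  ⟨sh_assoc hm, tw_sh hm, tw_invol hm⟩

/-- The function supported on the empty list, with value `x`. -/
def pt : N →ₗ[ℂ] (List M → N) where
  toFun x l := if l = [] then x else 0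
  map_add' x y := by funext l; by_cases h : l = [] <;> simp [h]
  map_smul' c x := by funext l; by_cases h : l = [] <;> simp [h]

theorem pt_nil (x : N) : pt (M := M) x [] = x := by simp [pt]

theorem ins_pt (X : M) (x : N) : ins X (pt x) = 0 := by
  funext l
  simp [pt, ins_apply]

theorem post_pt (T : N →ₗ[ℂ] N') (x : N) : post T (pt (M := M) x) = pt (T x) := by
  funext l
  by_cases h : l = [] <;> simp [pt, post_apply, h]

theorem tw_pt (T : N →ₗ[ℂ] N') (x : N) : tw T (pt (M := M) x) = pt (T x) := by
  funext l
  by_cases h : l = [] <;> simp [pt, tw_apply, h]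

theorem sh_pt (m : N →ₗ[ℂ] N' →ₗ[ℂ] N'') {γ : N →ₗ[ℂ] N} (x : N) (hx : γ x = x)
    (b : List M → N') : sh m γ (pt x) b = post (m x) b := by
  funext l
  induction l generalizing b with
  | nil => simp [sh_nil, pt_nil, post_apply]
  | cons X l ih => simp [sh_cons, ins_pt, tw_pt, hx, ih, post_apply, ins_apply]

/-- The Koszul rule for arguments and values together. For bidegrees `(q, p)` and `(q', p')` one
takes `s = (-1)^p`, `t = (-1)^{p'}`, `c = (-1)^{pp'}`, and the constant becomes
`(-1)^{(q+p)(q'+p')}`. -/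
theorem sh_comm_of_support {m : N →ₗ[ℂ] N →ₗ[ℂ] N} {γ : N →ₗ[ℂ] N} (s t c : ℂ)
    (ht : t * t = 1) (q q' : ℕ) (a b : List M → N)
    (ha : ∀ l, l.length ≠ q → a l = 0) (hb : ∀ l, l.length ≠ q' → b l = 0)
    (hγa : ∀ l, γ (a l) = s • a l) (hγb : ∀ l, γ (b l) = t • b l)
    (hc : ∀ l l', m (a l) (b l') = c • m (b l') (a l)) :
    sh m γ a b = (c * s ^ q' * t ^ q * (-1) ^ (q * q')) • sh m γ b a := by
  have key : ∀ (u : ℂ) (r : ℕ) (f : List M → N), (∀ l, l.length ≠ r → f l = 0) →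
      (∀ l, γ (f l) = u • f l) → tw γ f = (u * (-1) ^ r) • f := by
    intro u r f h1 h2
    funext l
    by_cases h : l.length = r
    · simp [tw_apply, h2, h, smul_smul, mul_comm]
    · simp [tw_apply, h1 l h]
  have zero : ∀ (f : List M → N) (X : M), (∀ l, l.length ≠ 0 → f l = 0) → ins X f = 0 :=
    fun f X h => funext fun l => h _ (by simp)
  have hpow : ∀ k : ℕ, ((-1 : ℂ) ^ k) * (-1) ^ k = 1 := fun k => by simp [← mul_pow]
  funext l
  induction l generalizing a b q q' with
  | nil =>
    by_cases h0 : q = 0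
    · by_cases h1 : q' = 0
      · subst h0 h1
        simp [sh_nil, hc]
      · simp [sh_nil, hb [] (Ne.symm h1)]
    · simp [sh_nil, ha [] (Ne.symm h0)]
  | cons X l ih =>
    -- When the head goes to `a`, on the other side it has to pass `b`; the factor `t * (-1) ^ q'`
    -- is what `tw γ b` contributes. In the induction step it cancels because its square is `1`.
    have e1 : sh m γ (ins X a) b l =
        (c * s ^ q' * t ^ q * (-1) ^ (q * q')) • (t * (-1) ^ q') • sh m γ b (ins X a) l := by
      rcases q with _ | q
      · simp [zero a X ha]
      · rw [ih q q' (ins X a) b (fun l h => ha _ (by simpa using h)) hb (fun l => hγa _) hγb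
          (fun _ _ => hc _ _), Pi.smul_apply, smul_smul]
        congr 1
        have e : (-1 : ℂ) ^ ((q + 1) * q') = (-1) ^ (q * q') * (-1) ^ q' := by ring
        rw [e, pow_succ]
        linear_combination (-(c * s ^ q' * t ^ q * (-1) ^ (q * q')) * (-1) ^ q' * (-1) ^ q') * ht
          + (-(c * s ^ q' * t ^ q * (-1) ^ (q * q'))) * (hpow q')
    have e2 : (s * (-1) ^ q) • sh m γ a (ins X b) l =
        (c * s ^ q' * t ^ q * (-1) ^ (q * q')) • sh m γ (ins X b) a l := by
      rcases q' with _ | q'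
      · simp [zero b X hb]
      · rw [ih q q' a (ins X b) ha (fun l h => hb _ (by simpa using h)) hγa (fun l => hγb _)
          (fun _ _ => hc _ _), Pi.smul_apply, smul_smul]
        congr 1
        ring
    simp only [sh_cons, Pi.smul_apply, key s q a ha hγa, key t q' b hb hγb, map_smul,
      LinearMap.smul_apply, smul_add]
    rw [e1, e2, add_comm]

/-! ### Derivations -/

/-- `T` is an even derivation. -/
def EvenDer (m : N →ₗ[ℂ] N →ₗ[ℂ] N) (T : N →ₗ[ℂ] N) : Prop :=
  ∀ x y, T (m x y) = m (T x) y + m x (T y)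

/-- `T` is an odd derivation. -/
structure OddDer (m : N →ₗ[ℂ] N →ₗ[ℂ] N) (γ T : N →ₗ[ℂ] N) : Prop where
  anti : ∀ x, T (γ x) = -γ (T x)
  leib : ∀ x y, T (m x y) = m (T x) y + m (γ x) (T y)

/-- The recursion defining the shuffle product is precisely the Leibniz rule for insertion. -/
theorem oddDer_ins (X : M) : OddDer (sh m γ) (tw γ) (ins X) :=
  ⟨fun φ => ins_tw γ X φ, fun a b => ins_sh m γ X a b⟩

/-- The sign `(-1)^q` is the one needed for an odd derivation of the values to pass the arguments.
-/
theorem oddDer_tw {T : N →ₗ[ℂ] N} (hT : OddDer m γ T) : OddDer (sh (M := M) m γ) (tw γ) (tw T) := by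
  have h : ∀ a : List M → N, tw T (tw γ a) = -tw γ (tw T a) := by
    intro a
    funext l
    simp [tw_tw, post_apply, hT.anti]
  refine ⟨h, fun a b => ?_⟩
  funext l
  induction l generalizing a b with
  | nil => simp [tw_apply, sh_nil, hT.leib]
  | cons X l ih =>
    rw [← ins_apply X (tw T (sh m γ a b)), ← ins_apply X (_ + _), ins_tw, map_add, ins_sh, ins_sh, ins_sh, map_add, ins_tw,
      ins_tw, ins_tw]
    simp [ih, h]
    abel

theorem evenDer_post {T : N →ₗ[ℂ] N} (hT : EvenDer m T) (hγ : ∀ x, T (γ x) = γ (T x)) :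
    EvenDer (sh (M := M) m γ) (post T) := by
  intro a b
  funext l
  induction l generalizing a b with
  | nil => simp [post_apply, sh_nil, hT _ _]
  | cons X l ih =>
    have h : tw γ (post T a) = post T (tw γ a) := by
      funext l
      simp [tw_apply, post_apply, hγ]
    rw [← ins_apply X (post T (sh m γ a b)), ← ins_apply X (_ + _), ins_post, map_add, ins_sh, ins_sh, ins_sh, map_add]
    simp [ih, h, ins_post]
    abel

/-- The alternated argument can be pulled out of a factor. From the second factor it has to pass the
first one, hence the twist in `sh_altL_right`. -/
theorem sh_altL_left (G : M → List M → N) (b : List M → N) :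
    sh m γ (altL G) b = altL (fun Y => sh m γ (G Y) b) := by
  funext l
  induction l generalizing G b with
  | nil => simp [sh_nil, altL_nil]
  | cons X l ih =>
    simp only [sh_cons, altL_cons, ins_altL, ins_sh, altL_add, map_sub, LinearMap.sub_apply,
      Pi.sub_apply, Pi.add_apply, ih]
    have h : tw γ (altL G) = altL (fun Y => -tw γ (G Y)) := by rw [altL_neg, altL_tw, neg_neg]
    rw [h, ih]
    simp only [map_neg, LinearMap.neg_apply, altL_neg, Pi.neg_apply]
    abel

theorem sh_altL_right (a : List M → N) (G : M → List M → N) :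
    sh m γ a (altL G) = altL (fun Y => sh m γ (tw γ a) (G Y)) := by
  funext l
  induction l generalizing G a with
  | nil => simp [sh_nil, altL_nil]
  | cons X l ih =>
    simp only [sh_cons, altL_cons, ins_altL, ins_sh, altL_add, map_sub,
      Pi.sub_apply, Pi.add_apply, ih, ins_tw, map_neg, LinearMap.neg_apply, altL_neg, Pi.neg_apply]
    abel

/-- Alternation over one more argument reverses parity. This lemma and `evenDer_altL` yield the
Leibniz rules for `dRL` and `dL` from those of directional derivatives and insertions. -/
theorem oddDer_altL (hm : GradedMul m γ) {T : M → (List M → N) →ₗ[ℂ] (List M → N)}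
    (hT : ∀ X, EvenDer (sh m γ) (T X)) (a b : List M → N) :
    altL (fun X => T X (sh m γ a b)) =
      sh m γ (altL fun X => T X a) b + sh m γ (tw γ a) (altL fun X => T X b) := by
  simp only [hT _ _ _, altL_add, sh_altL_left, sh_altL_right, tw_invol hm]

theorem evenDer_altL {T : M → (List M → N) →ₗ[ℂ] (List M → N)}
    (hT : ∀ X, OddDer (sh m γ) (tw γ) (T X)) (a b : List M → N) :
    altL (fun X => T X (sh m γ a b)) =
      sh m γ (altL fun X => T X a) b + sh m γ a (altL fun X => T X b) := by
  simp only [(hT _).leib, altL_add, sh_altL_left, sh_altL_right]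

end ListCalculus

/-! ## Alternating functions on lists and their differential -/

section AltSub

variable {M N N' : Type} [AddCommGroup M] [Module ℂ M] [AddCommGroup N] [Module ℂ N]
  [AddCommGroup N'] [Module ℂ N']

/-- Alternating multilinear functions on lists. -/
def altSub (M N : Type) [AddCommGroup M] [Module ℂ M] [AddCommGroup N] [Module ℂ N] :
    Submodule ℂ (List M → N) where
  carrier := {φ | (∀ u X Y w, φ (u ++ X :: Y :: w) = -φ (u ++ Y :: X :: w)) ∧
    -- Linearity in the first slot suffices, since transpositions carry it to the others.
    (∀ X Y w, φ ((X + Y) :: w) = φ (X :: w) + φ (Y :: w)) ∧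
    ∀ (c : ℂ) X w, φ ((c • X) :: w) = c • φ (X :: w)}
  add_mem' := fun ha hb => ⟨fun u X Y w => by
      simp only [Pi.add_apply, ha.1 u X Y w, hb.1 u X Y w]; abel,
    fun X Y w => by simp only [Pi.add_apply, ha.2.1, hb.2.1]; abel,
    fun c X w => by simp only [Pi.add_apply, ha.2.2, hb.2.2, smul_add]⟩
  zero_mem' := by simp
  smul_mem' := fun c a ha => ⟨fun u X Y w => by
      simp only [Pi.smul_apply, ha.1 u X Y w, smul_neg],
    fun X Y w => by simp only [Pi.smul_apply, ha.2.1, smul_add],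
    fun d X w => by simp only [Pi.smul_apply, ha.2.2, smul_comm c]⟩

variable {φ : List M → N}

theorem altSub_ins (hφ : φ ∈ altSub M N) (X : M) : ins X φ ∈ altSub M N := by
  refine ⟨fun u Y Z w => hφ.1 (X :: u) Y Z w, fun Y Z w => ?_, fun c Y w => ?_⟩
  · have h := fun A => hφ.1 [] X A w
    simp only [List.nil_append] at h
    simp only [ins_apply, h, hφ.2.1, neg_add]
  · have h := fun A => hφ.1 [] X A w
    simp only [List.nil_append] at h
    simp only [ins_apply, h, hφ.2.2, smul_neg]

theorem ins_ins (hφ : φ ∈ altSub M N) (X Y : M) : ins X (ins Y φ) = -ins Y (ins X φ) :=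
  funext fun w => hφ.1 [] Y X w

theorem ins_add (hφ : φ ∈ altSub M N) (X Y : M) : ins (X + Y) φ = ins X φ + ins Y φ :=
  funext fun w => hφ.2.1 X Y w

theorem ins_smul (hφ : φ ∈ altSub M N) (c : ℂ) (X : M) : ins (c • X) φ = c • ins X φ :=
  funext fun w => hφ.2.2 c X w

/-- For alternating `φ`, the linear map `X ↦ ι_X φ`. -/
def insLM (hφ : φ ∈ altSub M N) : M →ₗ[ℂ] (List M → N) where
  toFun X := ins X φ
  map_add' := ins_add hφ
  map_smul' := ins_smul hφ

theorem ins_sub (hφ : φ ∈ altSub M N) (X Y : M) : ins (X - Y) φ = ins X φ - ins Y φ :=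
  map_sub (insLM hφ) X Y

theorem ins_sum (hφ : φ ∈ altSub M N) {κ : Type} (s : Finset κ) (X : κ → M) :
    ins (∑ k ∈ s, X k) φ = ∑ k ∈ s, ins (X k) φ :=
  map_sum (insLM hφ) X s

theorem altSub_post (T : N →ₗ[ℂ] N') (hφ : φ ∈ altSub M N) : post T φ ∈ altSub M N' := by
  refine ⟨fun u Y Z w => ?_, fun Y Z w => ?_, fun c Y w => ?_⟩
  · simp only [post_apply, hφ.1 u Y Z w, map_neg]
  · simp only [post_apply, hφ.2.1, map_add]
  · simp only [post_apply, hφ.2.2, map_smul]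

theorem altSub_tw (T : N →ₗ[ℂ] N') (hφ : φ ∈ altSub M N) : tw T φ ∈ altSub M N' := by
  refine ⟨fun u Y Z w => ?_, fun Y Z w => ?_, fun c Y w => ?_⟩
  · simp [tw_apply, hφ.1 u Y Z w]
  · simp [tw_apply, hφ.2.1]
  · simp [tw_apply, hφ.2.2, smul_comm c]

theorem altSub_altL {G : M → List M → N} (hG : ∀ X, G X ∈ altSub M N)
    (hadd : ∀ X Y, G (X + Y) = G X + G Y) (hsmul : ∀ (c : ℂ) X, G (c • X) = c • G X) :
    altL G ∈ altSub M N := by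
  refine ⟨fun u X Y w => ?_, fun X Y w => ?_, fun c X w => ?_⟩
  · induction u generalizing G with
    | nil =>
      simp only [List.nil_append, altL_cons, ins_apply]
      have h : (fun Z => ins Y (ins X (G Z))) = fun Z => -ins X (ins Y (G Z)) :=
        funext fun Z => ins_ins (hG Z) Y X
      rw [h, altL_neg, Pi.neg_apply]
      abel
    | cons Z u ih =>
      simp only [List.cons_append, altL_cons, (hG Z).1 u X Y w]
      rw [ih (fun A => altSub_ins (hG A) Z) (fun A B => by rw [hadd, map_add])
        (fun c A => by rw [hsmul, map_smul])]
      abel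
  · simp only [altL_cons, hadd, ins_add (hG _), altL_add, Pi.add_apply]
    abel
  · simp only [altL_cons, hsmul, ins_smul (hG _), altL_smul, Pi.smul_apply, smul_sub]

/-- The operator `φ ↦ ∑ (-1)^k (T_{X_k} φ)(X_0, …, X̂_k, …, X_q)`. -/
def altOp (T : M → (List M → N) →ₗ[ℂ] (List M → N')) : (List M → N) →ₗ[ℂ] (List M → N') where
  toFun φ := altL fun X => T X φ
  map_add' φ ψ := by simp only [map_add, altL_add]
  map_smul' c φ := by simp only [map_smul, altL_smul, RingHom.id_apply]

theorem altOp_apply (T : M → (List M → N) →ₗ[ℂ] (List M → N')) (φ : List M → N) :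
    altOp T φ = altL fun X => T X φ := rfl

/-- The action of an endomorphism `B` of `M` on functions on lists. -/
def lieT (B : M →ₗ[ℂ] M) : (List M → N) →ₗ[ℂ] (List M → N) := -altOp fun Y => ins (B Y)

theorem lieT_apply (B : M →ₗ[ℂ] M) (φ : List M → N) :
    lieT B φ = -altL fun Y => ins (B Y) φ := rfl

/-- The relation `[L_B, ι_W] = ι_{B W}`; the overall sign in `lieT` makes it come out in this form.
-/
theorem ins_lieT (hφ : φ ∈ altSub M N) (B : M →ₗ[ℂ] M) (W : M) :
    ins W (lieT B φ) = lieT B (ins W φ) - ins (B W) φ := by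
  simp only [lieT_apply, map_neg, ins_altL, ins_ins hφ W, altL_neg]
  abel

theorem altSub_lieT (hφ : φ ∈ altSub M N) (B : M →ₗ[ℂ] M) : lieT B φ ∈ altSub M N :=
  neg_mem (altSub_altL (fun _ => altSub_ins hφ _) (fun X Y => by simp only [map_add, ins_add hφ])
    (fun c X => by simp only [map_smul, ins_smul hφ]))

/-- After insertion of `W`, two applications of `ins_lieT` reduce the claim to the same one for `ins
W φ`, plus insertions of `B (C W)` and `C (B W)`, which form the commutator. -/
theorem lieT_lieT (hφ : φ ∈ altSub M N) (B C : M →ₗ[ℂ] M) :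
    lieT B (lieT C φ) - lieT C (lieT B φ) = lieT (B ∘ₗ C - C ∘ₗ B) φ := by
  funext l
  induction l generalizing φ with
  | nil => simp [lieT_apply, altL_nil]
  | cons W l ih =>
    have h := ih (altSub_ins hφ W)
    simp only [← ins_apply W, map_sub, ins_lieT hφ, ins_lieT (altSub_lieT hφ _)]
    simp only [Pi.sub_apply] at h
    simp only [Pi.sub_apply, ← h, LinearMap.sub_apply, LinearMap.comp_apply, ins_sub hφ]
    abel

/-! ### Cartan calculus for the differential with trivial coefficients -/

variable (nab : M →ₗ[ℂ] M →ₗ[ℂ] M)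

/-- The commutator bracket of a bilinear operation. -/
def adL : M →ₗ[ℂ] M →ₗ[ℂ] M := nab - nab.flip

theorem adL_apply (X Y : M) : adL nab X Y = nab X Y - nab Y X := rfl

/-- The Chevalley–Eilenberg differential with trivial coefficients on functions on lists. -/
def dL : (List M → N) →ₗ[ℂ] (List M → N) := -altOp fun X => altOp fun Y => ins (nab X Y)

theorem dL_apply (φ : List M → N) :
    dL nab φ = -altL fun X => altL fun Y => ins (nab X Y) φ := rfl

/-- Cartan's formula `ι_Z d + d ι_Z = L_Z`: alternating `∇_X Y` over positions in which one of `X`,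
`Y` is the head produces the commutator bracket with `Z`. It drives the inductions for `dL`. -/
theorem ins_dL (hφ : φ ∈ altSub M N) (Z : M) :
    ins Z (dL nab φ) = lieT (adL nab Z) φ - dL nab (ins Z φ) := by
  have h : ∀ X Y, ins Z (ins (nab X Y) φ) = -ins (nab X Y) (ins Z φ) :=
    fun X Y => ins_ins hφ Z _
  simp only [dL_apply, lieT_apply, map_neg, ins_altL, h, adL_apply, ins_sub hφ, altL_sub, altL_neg]
  abel

theorem altSub_dL (hφ : φ ∈ altSub M N) : dL nab φ ∈ altSub M N := by
  refine neg_mem (altSub_altL (fun X => altSub_altL (fun Y => altSub_ins hφ _)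
    (fun Y Z => by simp only [map_add, ins_add hφ])
    (fun c Y => by simp only [map_smul, ins_smul hφ]))
    (fun X Y => ?_) (fun c X => ?_))
  · simp only [altOp_apply, map_add, LinearMap.add_apply, ins_add hφ, altL_add]
  · simp only [altOp_apply, map_smul, LinearMap.smul_apply, ins_smul hφ, altL_smul]

theorem dL_post (T : N →ₗ[ℂ] N') (φ : List M → N) : dL nab (post T φ) = post T (dL nab φ) := by
  simp only [dL_apply, ins_post, altL_post, map_neg]

theorem dL_tw (T : N →ₗ[ℂ] N') (φ : List M → N) : dL nab (tw T φ) = -tw T (dL nab φ) := by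
  simp only [dL_apply, ins_tw, altL_tw, altL_neg, map_neg, neg_neg]

variable {nab}

/-- By Cartan's formula and `lieT_lieT` the claim passes from `ins W φ` to `φ`. The Jacobi identity
enters through `hJ`, which says that `ad` is a representation. -/
theorem lieT_dL (hJ : ∀ X Y, adL nab X ∘ₗ adL nab Y - adL nab Y ∘ₗ adL nab X =
    adL nab (adL nab X Y)) (hφ : φ ∈ altSub M N) (Z : M) :
    lieT (adL nab Z) (dL nab φ) = dL nab (lieT (adL nab Z) φ) := by
  funext l
  induction l generalizing φ with
  | nil => simp [lieT_apply, dL_apply, altL_nil]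
  | cons W l ih =>
    have h := ih (altSub_ins hφ W)
    have h2 := lieT_lieT hφ (adL nab Z) (adL nab W)
    rw [hJ] at h2
    simp only [← ins_apply W, ins_lieT (altSub_dL nab hφ), ins_dL nab hφ,
      ins_dL nab (altSub_lieT hφ _), ins_lieT hφ, map_sub, ← h2]
    simp only [Pi.sub_apply, h]
    abel

/-- Cartan's formula gives `ι_W d d = L_W d - d L_W + d d ι_W`, and `L_W` commutes with `d`. -/
theorem dL_dL (hJ : ∀ X Y, adL nab X ∘ₗ adL nab Y - adL nab Y ∘ₗ adL nab X =
    adL nab (adL nab X Y)) (hφ : φ ∈ altSub M N) : dL nab (dL nab φ) = 0 := by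
  funext l
  induction l generalizing φ with
  | nil => simp [dL_apply, altL_nil]
  | cons W l ih =>
    simp only [← ins_apply W, ins_dL nab (altSub_dL nab hφ), ins_dL nab hφ, map_sub,
      lieT_dL hJ hφ, sub_sub_cancel, ih (altSub_ins hφ W)]
    rfl

/-- `dL` is a double alternation of insertions, so parity goes odd, even, odd. -/
theorem oddDer_dL {m : N →ₗ[ℂ] N →ₗ[ℂ] N} {γ : N →ₗ[ℂ] N} (hm : GradedMul m γ) :
    OddDer (sh (M := M) m γ) (tw γ) (dL nab) := by
  refine ⟨dL_tw nab γ, fun a b => ?_⟩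
  simp only [dL_apply, map_neg, LinearMap.neg_apply]
  have h : ∀ X, EvenDer (sh m γ) (altOp fun Y : M => ins (N := N) (nab X Y)) :=
    fun X a b => evenDer_altL (fun Y => oddDer_ins _) a b
  have := oddDer_altL hm h a b
  simp only [altOp_apply] at this
  rw [this, neg_add]

end AltSub

/-! ## The exponential of the contraction -/

section Exponential

variable {M N N' : Type} [AddCommGroup M] [Module ℂ M] [AddCommGroup N] [Module ℂ N]
  [AddCommGroup N'] [Module ℂ N']

/-- The recursion behind `expL`. -/
def expAux (τ : M → N →ₗ[ℂ] N) : List M → (List M → N) →ₗ[ℂ] N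
  | [] => LinearMap.proj []
  | X :: l => expAux τ l ∘ₗ (ins X - tw (τ X))

/-- The substitution `X ↦ X - τ_X`. -/
def expL (τ : M → N →ₗ[ℂ] N) : (List M → N) →ₗ[ℂ] (List M → N) :=
  LinearMap.pi (expAux τ)

variable {τ : M → N →ₗ[ℂ] N}

theorem expL_nil (φ : List M → N) : expL τ φ [] = φ [] := rfl

theorem ins_expL (X : M) (φ : List M → N) :
    ins X (expL τ φ) = expL τ (ins X φ - tw (τ X) φ) := rfl

theorem expL_cons (X : M) (l : List M) (φ : List M → N) :
    expL τ φ (X :: l) = expL τ (ins X φ - tw (τ X) φ) l := rfl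

/-- Since `tw` anticommutes with alternation, `ins X - tw (τ X)` satisfies the same recursion
against `altL` as `ins X` does. -/
theorem expL_altL (G : M → List M → N) : altL (fun Y => expL τ (G Y)) = expL τ (altL G) := by
  funext l
  induction l generalizing G with
  | nil => simp [altL_nil, expL_nil]
  | cons X l ih =>
    have h : tw (τ X) (altL G) = -altL fun Y => tw (τ X) (G Y) := by rw [altL_tw, neg_neg]
    simp only [altL_cons, ins_expL, expL_cons, ih, ins_altL, h, map_sub, altL_sub, map_neg,
      Pi.sub_apply, Pi.neg_apply]
    abel

theorem expL_tw {m : N →ₗ[ℂ] N →ₗ[ℂ] N} {γ : N →ₗ[ℂ] N} (hτ : ∀ X, OddDer m γ (τ X))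
    (a : List M → N) : expL τ (tw γ a) = tw γ (expL τ a) := by
  funext l
  induction l generalizing a with
  | nil => simp [expL_nil, tw_apply]
  | cons X l ih =>
    rw [← ins_apply X (tw γ _), ins_tw, ins_expL, expL_cons, ins_tw, (oddDer_tw (hτ X)).anti,
      ← neg_sub', map_neg, ← map_sub, Pi.neg_apply, Pi.neg_apply, ih]

/-- The substituted operators `ins X - tw (τ X)` are odd derivations, like the insertions that
define the product. -/
theorem expL_sh {m : N →ₗ[ℂ] N →ₗ[ℂ] N} {γ : N →ₗ[ℂ] N} (hτ : ∀ X, OddDer m γ (τ X))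
    (a b : List M → N) : expL τ (sh m γ a b) = sh m γ (expL τ a) (expL τ b) := by
  funext l
  induction l generalizing a b with
  | nil => rfl
  | cons X l ih =>
    rw [expL_cons, sh_cons, ins_expL, ins_expL, ins_sh, (oddDer_tw (hτ X)).leib,
      ← expL_tw hτ]
    rw [← ih, ← ih, ← Pi.add_apply, ← map_add]
    simp only [map_sub, map_add, LinearMap.sub_apply, Pi.sub_apply, Pi.add_apply]
    abel

/-- Functions with values in a submodule. -/
def valSub (M : Type) {N : Type} [AddCommGroup N] [Module ℂ N] (S : Submodule ℂ N) :
    Submodule ℂ (List M → N) where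
  carrier := {φ | ∀ l, φ l ∈ S}
  add_mem' ha hb l := S.add_mem (ha l) (hb l)
  zero_mem' _ := S.zero_mem
  smul_mem' c _ ha l := S.smul_mem c (ha l)

variable {S : Submodule ℂ N} {φ : List M → N}

theorem valSub_ins (hφ : φ ∈ valSub M S) (X : M) : ins X φ ∈ valSub M S := fun _ => hφ _

theorem valSub_tw {S' : Submodule ℂ N'} {T : N →ₗ[ℂ] N'} (hT : ∀ x ∈ S, T x ∈ S')
    (hφ : φ ∈ valSub M S) : tw T φ ∈ valSub M S' :=
  fun l => S'.smul_mem _ (hT _ (hφ l))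

theorem valSub_altL {G : M → List M → N} (hG : ∀ X, G X ∈ valSub M S) :
    altL G ∈ valSub M S := by
  intro l
  induction l generalizing G with
  | nil => exact S.zero_mem
  | cons X l ih => exact S.sub_mem (hG X l) (ih fun Y => valSub_ins (hG Y) X)

/-- The operators `ins X - tw (τ X)` anticommute. For the contractions this holds only on
alternating forms, which is why values are confined to `S`. -/
theorem altSub_expL (hτS : ∀ X, ∀ x ∈ S, τ X x ∈ S)
    (hτ : ∀ X Y, ∀ x ∈ S, τ X (τ Y x) = -τ Y (τ X x)) (hadd : ∀ X Y, τ (X + Y) = τ X + τ Y)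
    (hsmul : ∀ (c : ℂ) X, τ (c • X) = c • τ X) (hφ : φ ∈ altSub M N) (hφS : φ ∈ valSub M S) :
    expL τ φ ∈ altSub M N := by
  refine ⟨fun u X Y w => ?_, fun X Y w => ?_, fun c X w => ?_⟩
  · induction u generalizing φ with
    | nil =>
      have h : tw (τ Y) (tw (τ X) φ) = -tw (τ X) (tw (τ Y) φ) := by
        funext l
        simp [tw_tw, post_apply, hτ Y X _ (hφS l)]
      simp only [List.nil_append, expL_cons, map_sub, ins_tw, h, ins_ins hφ Y X, Pi.sub_apply,
        Pi.neg_apply, map_neg]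
      abel
    | cons Z u ih =>
      exact ih (sub_mem (altSub_ins hφ Z) (altSub_tw _ hφ))
        (sub_mem (valSub_ins hφS Z) (valSub_tw (hτS Z) hφS))
  · have h : tw (τ (X + Y)) φ = tw (τ X) φ + tw (τ Y) φ := by
      funext l
      simp [tw_apply, hadd]
    simp only [expL_cons, ins_add hφ, h, map_sub, map_add, Pi.sub_apply, Pi.add_apply]
    abel
  · have h : tw (τ (c • X)) φ = c • tw (τ X) φ := by
      funext l
      simp [tw_apply, hsmul, smul_comm c]
    simp only [expL_cons, ins_smul hφ, h, map_sub, map_smul, Pi.sub_apply, Pi.smul_apply, smul_sub]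

/-- The contraction operator on functions on lists. -/
def iotaL (τ : M → N →ₗ[ℂ] N) : Module.End ℂ (List M → N) := -altOp fun X => tw (τ X)

theorem iotaL_apply (τ : M → N →ₗ[ℂ] N) (φ : List M → N) :
    iotaL τ φ = -altL fun X => tw (τ X) φ := rfl

theorem ins_iotaL (Y : M) (φ : List M → N) :
    ins Y (iotaL τ φ) = iotaL τ (ins Y φ) - tw (τ Y) φ := by
  simp only [iotaL_apply, map_neg, ins_altL, ins_tw, altL_neg]
  abel

theorem tw_iotaL (hτ : ∀ X Y, ∀ x ∈ S, τ X (τ Y x) = -τ Y (τ X x)) (hφS : φ ∈ valSub M S)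
    (Y : M) : tw (τ Y) (iotaL τ φ) = iotaL τ (tw (τ Y) φ) := by
  have h : ∀ X, tw (τ Y) (tw (τ X) φ) = -tw (τ X) (tw (τ Y) φ) := by
    intro X
    funext l
    simp [tw_tw, post_apply, hτ Y X _ (hφS l)]
  rw [iotaL_apply, iotaL_apply, map_neg, ← altL_tw]
  simp only [h, altL_neg]

/-- The commutator of `ins Y` with `iotaL τ` is `-tw (τ Y)`, which itself commutes with `iotaL τ`;
the power therefore differentiates like a monomial. -/
theorem ins_iotaL_pow (hτS : ∀ X, ∀ x ∈ S, τ X x ∈ S)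
    (hτ : ∀ X Y, ∀ x ∈ S, τ X (τ Y x) = -τ Y (τ X x)) (Y : M) (k : ℕ) :
    ∀ φ ∈ valSub M S, ins Y ((iotaL τ ^ (k + 1)) φ) =
      (iotaL τ ^ (k + 1)) (ins Y φ) - ((k : ℂ) + 1) • (iotaL τ ^ k) (tw (τ Y) φ) := by
  induction k with
  | zero => simp [ins_iotaL]
  | succ k ih =>
    intro φ hφ
    have h1 : iotaL τ φ ∈ valSub M S := neg_mem (valSub_altL fun X => valSub_tw (hτS X) hφ)
    rw [pow_succ, Module.End.mul_apply, ih _ h1, ins_iotaL, tw_iotaL hτ hφ, map_sub,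
      ← Module.End.mul_apply, ← pow_succ, ← Module.End.mul_apply (iotaL τ ^ k), ← pow_succ]
    push_cast
    module

/-- Each contraction lowers the filtration of the values by one step. -/
theorem iotaL_pow_eq_zero (F : ℕ → Submodule ℂ N) (h0 : F 0 = ⊥)
    (hτF : ∀ k X, ∀ x ∈ F (k + 1), τ X x ∈ F k) (k : ℕ) :
    ∀ ψ ∈ valSub M (F k), (iotaL τ ^ k) ψ = 0 := by
  induction k with
  | zero =>
    intro ψ hψ
    funext l
    simpa [h0] using hψ l
  | succ k ih =>
    intro ψ hψ
    rw [pow_succ, Module.End.mul_apply]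
    exact ih _ (neg_mem (valSub_altL fun X => valSub_tw (hτF k X) hψ))

/-- The truncated exponential series of the contraction computes the substitution `expL`. -/
theorem expL_eq_sum (F : ℕ → Submodule ℂ N) (h0 : F 0 = ⊥) (hF : Monotone F)
    (hτF : ∀ k X, ∀ x ∈ F (k + 1), τ X x ∈ F k)
    (hτ : ∀ k X Y, ∀ x ∈ F k, τ X (τ Y x) = -τ Y (τ X x)) (K : ℕ) (hφ : φ ∈ valSub M (F (K + 1))) :
    ∑ k ∈ Finset.range (K + 1), ((k.factorial : ℂ))⁻¹ • (iotaL τ ^ k) φ = expL τ φ := by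
  have nil := fun k (ψ : List M → N) (hψ : ψ ∈ valSub M (F k)) =>
    iotaL_pow_eq_zero F h0 hτF k ψ hψ
  funext l
  induction l generalizing φ with
  | nil =>
    -- A positive power of `iotaL τ` has at least one argument, so at the empty list only the term
    -- `k = 0` remains.
    have h : ∀ k, (iotaL τ ^ (k + 1)) φ [] = 0 := by
      intro k
      rw [pow_succ', Module.End.mul_apply, iotaL_apply]
      simp [altL_nil]
    rw [Finset.sum_range_succ', Pi.add_apply, Finset.sum_apply]
    simp [h, expL_nil]
  | cons Y l ih =>
    have hS : ∀ X, ∀ x ∈ F (K + 1), τ X x ∈ F (K + 1) :=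
      fun X x hx => hF (Nat.le_succ K) (hτF K X x hx)
    have hY : tw (τ Y) φ ∈ valSub M (F K) := valSub_tw (hτF K Y) hφ
    have hY' : tw (τ Y) φ ∈ valSub M (F (K + 1)) := valSub_tw (hS Y) hφ
    rw [expL_cons, map_sub, Pi.sub_apply, ← ih (valSub_ins hφ Y), ← ih hY', ← Pi.sub_apply]
    change ins Y (∑ k ∈ Finset.range (K + 1), ((k.factorial : ℂ))⁻¹ • (iotaL τ ^ k) φ) l = _
    -- The series for `φ` and `ins Y φ` lose their term `k = 0`, the series for `tw (τ Y) φ` its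
    -- last term, which vanishes by nilpotency. What is left matches termwise because `(k + 1) / (k
    -- + 1)! = 1 / k!`.
    rw [map_sum, Finset.sum_range_succ', Finset.sum_range_succ' _ K,
      Finset.sum_range_succ _ K, nil K _ hY, smul_zero, add_zero, add_sub_right_comm,
      ← Finset.sum_sub_distrib]
    refine congrFun (congrArg₂ (· + ·) (Finset.sum_congr rfl fun k _ => ?_) rfl) l
    rw [map_smul, ins_iotaL_pow hS (hτ (K + 1)) Y k φ hφ, smul_sub, smul_smul]
    congr 2
    rw [Nat.factorial_succ]
    have h1 : (k.factorial : ℂ) ≠ 0 := Nat.cast_ne_zero.2 k.factorial_ne_zero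
    have h2 : (k : ℂ) + 1 ≠ 0 := Nat.cast_add_one_ne_zero k
    push_cast
    field_simp

/-! ### Conjugation of the total differential -/

variable (nab : M →ₗ[ℂ] M →ₗ[ℂ] M) (δ : N →ₗ[ℂ] N)

/-- The Lie derivative attached to a contraction and a differential. -/
def lieOp (τ : M → N →ₗ[ℂ] N) (X : M) : N →ₗ[ℂ] N := τ X ∘ₗ δ + δ ∘ₗ τ X

/-- The total differential without the action on the coefficients. -/
def dTot₀ : (List M → N) →ₗ[ℂ] (List M → N) := dL nab + tw δ

/-- The total differential. -/
def dTot (τ : M → N →ₗ[ℂ] N) : (List M → N) →ₗ[ℂ] (List M → N) :=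
  dL nab + altOp (fun X => post (lieOp δ τ X)) + tw δ

variable {nab δ}

/-- In the anticommutator of `dTot` with `ins X - tw (τ X)`, the term `L_X` on values arises once
from `ins X` and once, with the opposite sign, from `τ X` and `δ`. The hypothesis `hc` supplies the
contractions by `[X, Y]` that complete the insertions of `[X, Y]`. -/
theorem ins_sub_tw_dTot (hc : ∀ X Y, ∀ x ∈ S, lieOp δ τ Y (τ X x) - τ X (lieOp δ τ Y x) =
      τ (adL nab Y X) x) (hneg : ∀ X, τ (-X) = -τ X)
    (hφ : φ ∈ altSub M N) (hφS : φ ∈ valSub M S) (X : M) :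
    ins X (dTot nab δ τ φ) - tw (τ X) (dTot nab δ τ φ) =
      -dTot nab δ τ (ins X φ - tw (τ X) φ) -
        altL (fun Y => ins (adL nab X Y) φ - tw (τ (adL nab X Y)) φ) := by
  have h1 : tw (τ X) (altL fun Y => post (lieOp δ τ Y) φ) =
      -altL (fun Y => tw (τ X ∘ₗ lieOp δ τ Y) φ) := by
    simp only [← tw_post, altL_tw, neg_neg]
  have h2 : ∀ Y, post (lieOp δ τ Y) (tw (τ X) φ) =
      tw (τ X ∘ₗ lieOp δ τ Y) φ - tw (τ (adL nab X Y)) φ := by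
    intro Y
    funext l
    have h := hc X Y _ (hφS l)
    have h3 : adL nab Y X = -adL nab X Y := by simp [adL_apply]
    rw [h3, hneg, sub_eq_iff_eq_add, LinearMap.neg_apply] at h
    simp only [post_tw, tw_apply, LinearMap.comp_apply, h, Pi.sub_apply]
    module
  have h3 : post (lieOp δ τ X) φ = tw (τ X) (tw δ φ) + tw δ (tw (τ X) φ) := by
    rw [tw_tw, tw_tw, ← post_add_op]
    rfl
  simp only [dTot, LinearMap.add_apply, altOp_apply, map_add, map_sub, ins_dL nab hφ, ins_altL,
    ins_tw, ins_post, h1, h2, h3, dL_tw, altL_sub, lieT_apply]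
  abel

/-- The exponential of the contraction removes the action on the coefficients from the
total differential. -/
theorem expL_dTot (hτS : ∀ X, ∀ x ∈ S, τ X x ∈ S)
    (hτ : ∀ X Y, ∀ x ∈ S, τ X (τ Y x) = -τ Y (τ X x)) (hadd : ∀ X Y, τ (X + Y) = τ X + τ Y)
    (hsmul : ∀ (c : ℂ) X, τ (c • X) = c • τ X)
    (hc : ∀ X Y, ∀ x ∈ S, lieOp δ τ Y (τ X x) - τ X (lieOp δ τ Y x) = τ (adL nab Y X) x)
    (hφ : φ ∈ altSub M N) (hφS : φ ∈ valSub M S) :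
    expL τ (dTot nab δ τ φ) = dTot₀ nab δ (expL τ φ) := by
  have hneg : ∀ X, τ (-X) = -τ X := fun X => by simpa using hsmul (-1) X
  funext l
  induction l generalizing φ with
  | nil => simp [expL_nil, dTot, dTot₀, dL_apply, altL_nil, altOp_apply, tw_apply]
  | cons X l ih =>
    have hE := altSub_expL hτS hτ hadd hsmul hφ hφS
    -- Cartan's formula for the alternating function `expL τ φ`. Its Lie term acts on arguments only
    -- and turns into the correction of `ins_sub_tw_dTot` under `expL_altL`.
    have e : ins X (dTot₀ nab δ (expL τ φ)) =
        -dTot₀ nab δ (expL τ (ins X φ - tw (τ X) φ)) -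
          expL τ (altL fun Y => ins (adL nab X Y) φ - tw (τ (adL nab X Y)) φ) := by
      simp only [dTot₀, LinearMap.add_apply, map_add, ins_dL nab hE, ins_tw, lieT_apply,
        ← expL_altL, ← ins_expL]
      abel
    rw [expL_cons, ← ins_apply X (dTot₀ nab δ _), e, ins_sub_tw_dTot hc hneg hφ hφS, map_sub, map_neg,
      Pi.sub_apply, Pi.sub_apply, Pi.neg_apply, Pi.neg_apply,
      ih (sub_mem (altSub_ins hφ X) (altSub_tw _ hφ))
        (sub_mem (valSub_ins hφS X) (valSub_tw (hτS X) hφS))]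

end Exponential

/-! ## Alternating maps as functions on lists -/

section Bridge

variable {M N N' N'' : Type} [AddCommGroup M] [Module ℂ M] [AddCommGroup N] [Module ℂ N]
  [AddCommGroup N'] [Module ℂ N'] [AddCommGroup N''] [Module ℂ N'']

/-- An alternating map as a function on lists, supported in length `q`. -/
def ev (q : ℕ) : (M [⋀^Fin q]→ₗ[ℂ] N) →ₗ[ℂ] (List M → N) where
  toFun φ l := if h : l.length = q then φ (fun i => l.get (i.cast h.symm)) else 0
  map_add' φ ψ := by
    funext l
    by_cases h : l.length = q <;> simp [h]
  map_smul' c φ := by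
    funext l
    by_cases h : l.length = q <;> simp [h]

theorem ev_ofFn {q : ℕ} (φ : M [⋀^Fin q]→ₗ[ℂ] N) (v : Fin q → M) :
    ev q φ (List.ofFn v) = φ v := by
  simp [ev]

theorem ev_of_length_ne {q : ℕ} (φ : M [⋀^Fin q]→ₗ[ℂ] N) {l : List M} (h : l.length ≠ q) :
    ev q φ l = 0 := by
  simp [ev, h]

theorem exists_ofFn {q : ℕ} {l : List M} (h : l.length = q) : ∃ v : Fin q → M, l = List.ofFn v := by
  subst h
  exact ⟨l.get, (List.ofFn_get l).symm⟩

theorem ev_injective (q : ℕ) : Function.Injective (ev (M := M) (N := N) q) := by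
  intro φ ψ h
  ext v
  rw [← ev_ofFn, h, ev_ofFn]

theorem ins_ev_succ {q : ℕ} (φ : M [⋀^Fin (q + 1)]→ₗ[ℂ] N) (X : M) :
    ins X (ev (q + 1) φ) = ev q (φ.curryLeft X) := by
  funext l
  by_cases h : l.length = q
  · obtain ⟨v, rfl⟩ := exists_ofFn h
    have h2 : X :: List.ofFn v = List.ofFn (Matrix.vecCons X v) := by simp
    rw [ins_apply, h2, ev_ofFn, ev_ofFn, AlternatingMap.curryLeft_apply_apply]
  · rw [ev_of_length_ne _ h, ins_apply, ev_of_length_ne _ (by simpa using h)]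

theorem ins_ev_zero (φ : M [⋀^Fin 0]→ₗ[ℂ] N) (X : M) : ins X (ev 0 φ) = 0 :=
  funext fun l => ev_of_length_ne φ (l := X :: l) (by simp)

theorem post_ev {q : ℕ} (T : N →ₗ[ℂ] N') (φ : M [⋀^Fin q]→ₗ[ℂ] N) :
    post T (ev q φ) = ev q (T.compAlternatingMap φ) := by
  funext l
  by_cases h : l.length = q <;> simp [post_apply, ev, h]

theorem tw_ev {q : ℕ} (T : N →ₗ[ℂ] N') (φ : M [⋀^Fin q]→ₗ[ℂ] N) :
    tw T (ev q φ) = (-1 : ℂ) ^ q • post T (ev q φ) := by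
  funext l
  by_cases h : l.length = q <;> simp [tw_apply, post_apply, ev, h]

theorem ev_constOfIsEmpty (x : N) :
    ev 0 (AlternatingMap.constOfIsEmpty ℂ M (Fin 0) x) = pt x := by
  funext l
  by_cases h : l = [] <;> simp [ev, pt, h]

theorem ev_mem_altSub {q : ℕ} (φ : M [⋀^Fin q]→ₗ[ℂ] N) : ev q φ ∈ altSub M N := by
  refine ⟨fun u X Y w => ?_, fun X Y w => ?_, fun c X w => ?_⟩
  · induction u generalizing q with
    | nil =>
      simp only [List.nil_append]
      change ins Y (ins X (ev q φ)) w = -ins X (ins Y (ev q φ)) w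
      rcases q with _ | _ | q
      · simp [ins_ev_zero]
      · simp [ins_ev_succ, ins_ev_zero]
      · rw [ins_ev_succ, ins_ev_succ, ins_ev_succ, ins_ev_succ]
        -- Polarization: vanishing on the repeated argument `X + Y` gives antisymmetry in `X` and
        -- `Y`.
        have h := φ.curryLeft_same (X + Y)
        simp only [map_add, AlternatingMap.curryLeft_add, LinearMap.add_apply,
          AlternatingMap.curryLeft_same] at h
        rw [zero_add, add_zero] at h
        rw [eq_neg_of_add_eq_zero_left h, map_neg, Pi.neg_apply, neg_neg]
    | cons Z u ih =>
      simp only [List.cons_append, ← ins_apply Z]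
      rcases q with _ | q
      · simp [ins_ev_zero]
      · rw [ins_ev_succ]
        exact ih _
  · rcases q with _ | q
    · simp [ev]
    · simp only [← ins_apply _ (ev _ φ), ins_ev_succ, map_add, Pi.add_apply]
  · rcases q with _ | q
    · simp [ev]
    · simp only [← ins_apply _ (ev _ φ), ins_ev_succ, map_smul, Pi.smul_apply]

theorem curryLeft_alternatize_zero (F : M →ₗ[ℂ] M [⋀^Fin 0]→ₗ[ℂ] N) (X : M) :
    (AlternatingMap.alternatizeUncurryFin F).curryLeft X = F X := by
  ext v
  rw [AlternatingMap.curryLeft_apply_apply, AlternatingMap.alternatizeUncurryFin_apply]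
  simp

/-- This is the recursion that defines `altL`, read on alternating maps. -/
theorem curryLeft_alternatize_succ {q : ℕ} (F : M →ₗ[ℂ] M [⋀^Fin (q + 1)]→ₗ[ℂ] N) (X : M) :
    (AlternatingMap.alternatizeUncurryFin F).curryLeft X =
      F X - AlternatingMap.alternatizeUncurryFin
        ((AlternatingMap.curryLeftLinearMap.flip X) ∘ₗ F) := by
  ext v
  rw [AlternatingMap.curryLeft_apply_apply, AlternatingMap.sub_apply,
    AlternatingMap.alternatizeUncurryFin_apply, AlternatingMap.alternatizeUncurryFin_apply,
    Fin.sum_univ_succ, sub_eq_add_neg, ← Finset.sum_neg_distrib]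
  congr 1
  · simp [Fin.removeNth_zero]
  · refine Finset.sum_congr rfl fun i _ => ?_
    have h : i.succ.removeNth (Matrix.vecCons X v) = Matrix.vecCons X (i.removeNth v) := by
      funext j
      refine Fin.cases ?_ (fun j => ?_) j <;> simp [Fin.removeNth_apply]
    rw [h]
    simp [pow_succ]

theorem ev_alternatize {q : ℕ} (F : M →ₗ[ℂ] M [⋀^Fin q]→ₗ[ℂ] N) :
    ev (q + 1) (AlternatingMap.alternatizeUncurryFin F) = altL fun X => ev q (F X) := by
  funext l
  induction l generalizing q with
  | nil => exact ev_of_length_ne _ (by simp)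
  | cons X l ih =>
    rw [altL_cons, ← ins_apply X (ev _ _), ins_ev_succ]
    rcases q with _ | q
    · simp only [curryLeft_alternatize_zero, ins_ev_zero, altL_zero]
      simp
    · simp only [curryLeft_alternatize_succ, map_sub, Pi.sub_apply, ih, ins_ev_succ]
      rfl

/-! ### The shuffle product as a sum over permutations -/

theorem ofFn_insertNth {α : Type} {N : ℕ} (p : Fin (N + 1)) (X : α) (u : Fin N → α) :
    List.ofFn (p.insertNth X u) =
      (List.ofFn u).take p ++ X :: (List.ofFn u).drop p := by
  induction N with
  | zero =>
    obtain rfl : p = 0 := Fin.eq_zero p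
    simp
  | succ N ih =>
    refine Fin.cases ?_ (fun p => ?_) p
    · simp
    · have h : (p.succ.insertNth X u : Fin (N + 2) → α) =
          Matrix.vecCons (u 0) (p.insertNth X (fun j => u j.succ)) := by
        rw [Matrix.vecCons, ← Fin.insertNth_succ_cons]
        congr 1
        exact (Fin.cons_self_tail u).symm
      rw [h, List.ofFn_succ (f := u), Matrix.vecCons, List.ofFn_cons, ih]
      simp

/-- The signed sum over all permutations of the arguments. -/
def permSum (n : ℕ) (f : List M → N) (v : Fin n → M) : N :=
  ∑ σ : Equiv.Perm (Fin n), ((Equiv.Perm.sign σ : ℤ) : ℂ) • f (List.ofFn (v ∘ σ))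

/-- Permutations are sorted by the position `p` in which `X` ends up; carrying it there costs
`(-1)^p`. -/
theorem permSum_succ (n : ℕ) (f : List M → N) (X : M) (w : Fin n → M) :
    permSum (n + 1) f (Matrix.vecCons X w) = ∑ p : Fin (n + 1), (-1 : ℂ) ^ (p : ℕ) •
      permSum n (fun l => f (l.take p ++ X :: l.drop p)) w := by
  -- `decomposeFin.symm (0, σ)` fixes `0` and permutes the rest by `σ`, while `cycleRange p` sends
  -- `p` to `0`. Thus position `p` receives the head.
  let e : Fin (n + 1) × Equiv.Perm (Fin n) → Equiv.Perm (Fin (n + 1)) :=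
    fun x => Equiv.Perm.decomposeFin.symm (0, x.2) * x.1.cycleRange
  have he : Function.Bijective e := by
    rw [Fintype.bijective_iff_injective_and_card]
    refine ⟨fun x y h => ?_, ?_⟩
    · have h0 : ∀ z : Fin (n + 1) × Equiv.Perm (Fin n), e z z.1 = 0 := fun z => by
        simp [e, Fin.cycleRange_self]
      have h1 : x.1 = y.1 := (e x).injective (by rw [h0, h, h0])
      have h2 : x.2 = y.2 := by
        simp only [e, h1] at h
        simpa using mul_right_cancel h
      exact Prod.ext h1 h2
    · simp [Fintype.card_perm, Nat.factorial_succ]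
  simp only [permSum, Finset.smul_sum]
  rw [← Fintype.sum_prod_type', ← he.sum_comp]
  refine Finset.sum_congr rfl fun x _ => ?_
  have h1 : Matrix.vecCons X w ∘ (e x) = x.1.insertNth X (w ∘ x.2) := by
    rw [← Fin.cons_comp_cycleRange]
    funext i
    simp only [e, Function.comp_apply, Equiv.Perm.mul_apply]
    refine Fin.cases ?_ (fun j => ?_) (x.1.cycleRange i)
    · simp
    · simp [Equiv.Perm.decomposeFin_symm_apply_succ]
  have h2 : ((Equiv.Perm.sign (e x) : ℤ) : ℂ) =
      (-1 : ℂ) ^ (x.1 : ℕ) * ((Equiv.Perm.sign x.2 : ℤ) : ℂ) := by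
    simp [e, Fin.sign_cycleRange, mul_comm]
  rw [h1, h2, mul_smul, ofFn_insertNth]

end Bridge

/-! ### The recursive shuffle product and the product of alternating maps -/

section Shuffle

variable {M N N' N'' : Type} [AddCommGroup M] [Module ℂ M] [AddCommGroup N] [Module ℂ N]
  [AddCommGroup N'] [Module ℂ N'] [AddCommGroup N''] [Module ℂ N'']

theorem permSum_congr {n : ℕ} {f g : List M → N} (h : ∀ l, l.length = n → f l = g l)
    (v : Fin n → M) : permSum n f v = permSum n g v :=
  Finset.sum_congr rfl fun σ _ => by rw [h _ (by simp)]

theorem permSum_smul (n : ℕ) (c : ℂ) (f : List M → N) (v : Fin n → M) :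
    permSum n (fun l => c • f l) v = c • permSum n f v := by
  simp only [permSum, Finset.smul_sum, smul_comm c]

theorem altSub_move {φ : List M → N} (hφ : φ ∈ altSub M N) (u : List M) (X : M) (w : List M) :
    φ (u ++ X :: w) = (-1 : ℂ) ^ u.length • φ (X :: (u ++ w)) := by
  induction u generalizing φ with
  | nil => simp
  | cons Y u ih =>
    have h1 := ih (altSub_ins hφ Y)
    have h2 := hφ.1 [] Y X (u ++ w)
    simp only [List.nil_append, ins_apply] at h1 h2
    simp only [List.cons_append, List.length_cons, h1, h2, pow_succ]
    simp

/-- Every shuffle is counted `k! l!` times among the permutations. The factor `s ^ l` appears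
because each of the `l` arguments given to `B` passes the values of `A` once. -/
theorem sh_eq_permSum (m : N →ₗ[ℂ] N' →ₗ[ℂ] N'') (s : ℂ) (n : ℕ) :
    ∀ (k l : ℕ), k + l = n → ∀ (A : List M → N) (B : List M → N'), A ∈ altSub M N →
      B ∈ altSub M N' → (∀ L, L.length ≠ k → A L = 0) → (∀ L, L.length ≠ l → B L = 0) →
      ∀ v : Fin n → M, ((k.factorial : ℂ) * l.factorial) •
        sh m (s • LinearMap.id) A B (List.ofFn v) =
          s ^ l • permSum n (fun L => m (A (L.take k)) (B (L.drop k))) v := by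
  induction n with
  | zero =>
    intro k l hkl A B _ _ _ _ v
    obtain rfl : k = 0 := by omega
    obtain rfl : l = 0 := by omega
    simp [permSum, sh_nil]
  | succ n ih =>
    intro k l hkl A B hA hB hAk hBl v
    obtain ⟨X, w, rfl⟩ : ∃ X w, v = Matrix.vecCons X w := ⟨v 0, Fin.tail v, (Fin.cons_self_tail v).symm⟩
    set C₁ := permSum n (fun L => m (ins X A (L.take (k - 1))) (B (L.drop (k - 1)))) w with hC₁
    set C₂ := permSum n (fun L => m (A (L.take k)) (ins X B (L.drop k))) w with hC₂
    have hsum : permSum (n + 1) (fun L => m (A (L.take k)) (B (L.drop k))) (Matrix.vecCons X w) =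
        (k : ℂ) • C₁ + (l : ℂ) • (-1 : ℂ) ^ k • C₂ := by
      rw [permSum_succ]
      -- The first `k` positions put `X` into `A`, the other `l` put it into `B`. Moving it to the
      -- front of that factor cancels the sign, up to `(-1) ^ k` in the second case, so the summand
      -- depends only on the case.
      have hp : ∀ p : Fin (n + 1), (-1 : ℂ) ^ (p : ℕ) • permSum n (fun L =>
          m (A ((L.take p ++ X :: L.drop p).take k)) (B ((L.take p ++ X :: L.drop p).drop k))) w =
          if (p : ℕ) < k then C₁ else (-1 : ℂ) ^ k • C₂ := by
        intro p
        obtain ⟨p, hp⟩ := p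
        have hpow : ∀ j : ℕ, (-1 : ℂ) ^ j * (-1) ^ j = 1 := fun j => by simp [← mul_pow]
        split_ifs with h
        · rw [hC₁, ← permSum_smul]
          refine permSum_congr (fun L hL => ?_) w
          obtain ⟨j, rfl⟩ := Nat.exists_eq_add_of_lt h
          have e1 : ((L.take p ++ X :: L.drop p).take (p + j + 1)) =
              L.take p ++ X :: (L.drop p).take j := by
            rw [List.take_append, List.take_take, List.length_take, hL]
            have : p + j + 1 - min p n = j + 1 := by omega
            rw [this, List.take_succ_cons, min_eq_right (by omega)]
          have e2 : ((L.take p ++ X :: L.drop p).drop (p + j + 1)) = L.drop (p + j) := by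
            rw [List.drop_append, List.length_take, hL]
            have : p + j + 1 - min p n = j + 1 := by omega
            rw [this, List.drop_succ_cons, List.drop_drop,
              List.drop_of_length_le (by simp; omega), List.nil_append]
          simp only at e1 e2 ⊢
          rw [e1, e2, altSub_move hA, ← List.take_add, List.length_take, hL,
            min_eq_left (by omega), map_smul, LinearMap.smul_apply, smul_smul, hpow, one_smul]
          rfl
        · rw [hC₂, ← permSum_smul, ← permSum_smul]
          refine permSum_congr (fun L hL => ?_) w
          obtain ⟨j, rfl⟩ := Nat.exists_eq_add_of_le (not_lt.1 h)
          have e1 : ((L.take (k + j) ++ X :: L.drop (k + j)).take k) = L.take k := by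
            rw [List.take_append, List.take_take, List.length_take, hL]
            have : k - min (k + j) n = 0 := by omega
            rw [this, List.take_zero, List.append_nil, min_eq_left (by omega)]
          have e2 : ((L.take (k + j) ++ X :: L.drop (k + j)).drop k) =
              (L.drop k).take j ++ X :: (L.drop k).drop j := by
            rw [List.drop_append, List.length_take, hL]
            have : k - min (k + j) n = 0 := by omega
            rw [this, List.drop_zero, List.drop_take, List.drop_drop, Nat.add_sub_cancel_left]
          simp only at e1 e2 ⊢
          rw [e1, e2, altSub_move hB, List.take_append_drop, List.length_take, List.length_drop, hL,
            min_eq_left (by omega), map_smul, smul_smul, pow_add, mul_assoc, hpow, mul_one]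
          rfl
      rw [Finset.sum_congr rfl fun p _ => hp p,
        Fin.sum_univ_eq_sum_range (fun p => if p < k then C₁ else (-1 : ℂ) ^ k • C₂) (n + 1), ← hkl,
        Finset.sum_range_add, Finset.sum_congr rfl fun p hp => if_pos (Finset.mem_range.1 hp)]
      simp [Nat.cast_smul_eq_nsmul]
    have htw : tw (s • LinearMap.id) A = (s * (-1) ^ k) • A := by
      funext L
      by_cases h : L.length = k
      · simp [tw_apply, h, smul_smul, mul_comm]
      · simp [tw_apply, hAk L h]
    have h1 : ((k.factorial : ℂ) * l.factorial) •
        sh m (s • LinearMap.id) (ins X A) B (List.ofFn w) = s ^ l • (k : ℂ) • C₁ := by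
      rcases k with _ | k
      · have : ins X A = 0 := funext fun L => hAk _ (by simp)
        simp [this]
      · have := ih k l (by omega) (ins X A) B (altSub_ins hA X) hB
          (fun L hL => hAk _ (by simpa using hL)) hBl w
        rw [smul_comm, hC₁, Nat.add_sub_cancel, ← this, smul_smul, Nat.factorial_succ]
        push_cast
        ring_nf
    have h2 : ((k.factorial : ℂ) * l.factorial) • s •
        sh m (s • LinearMap.id) A (ins X B) (List.ofFn w) = s ^ l • (l : ℂ) • C₂ := by
      rcases l with _ | l
      · have : ins X B = 0 := funext fun L => hBl _ (by simp)
        simp [this]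
      · have := ih k l (by omega) A (ins X B) hA (altSub_ins hB X) hAk
          (fun L hL => hBl _ (by simpa using hL)) w
        rw [smul_comm (s ^ _), hC₂, pow_succ, mul_comm (s ^ l), mul_smul s, ← this, smul_smul,
          smul_smul, smul_smul, Nat.factorial_succ]
        push_cast
        ring_nf
    have h3 : List.ofFn (Matrix.vecCons X w) = X :: List.ofFn w := by simp
    rw [h3, sh_cons, hsum, htw, smul_add, smul_add, h1, map_smul, LinearMap.smul_apply,
      Pi.smul_apply]
    congr 1
    calc _ = (-1 : ℂ) ^ k • ((k.factorial : ℂ) * l.factorial) • s •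
          sh m (s • LinearMap.id) A (ins X B) (List.ofFn w) := by
          simp only [smul_smul]
          ring_nf
      _ = _ := by
          rw [h2]
          simp only [smul_smul]
          ring_nf

/-- The product of alternating maps sums over classes modulo permutations within the two blocks;
multiplication by `k! l!` turns this into the alternatization over all permutations. -/
theorem altMul_eq_permSum (m : N →ₗ[ℂ] N' →ₗ[ℂ] N'') (k l : ℕ) (a : M [⋀^Fin k]→ₗ[ℂ] N)
    (b : M [⋀^Fin l]→ₗ[ℂ] N') (v : Fin (k + l) → M) :
    ((k.factorial : ℂ) * l.factorial) • altMul m k l a b v =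
      permSum (k + l) (fun L => m (ev k a (L.take k)) (ev l b (L.drop k))) v := by
  have h1 := congrArg (fun f : M [⋀^Fin k ⊕ Fin l]→ₗ[ℂ] _ => TensorProduct.lift m
    (f (v ∘ finSumFinEquiv))) (MultilinearMap.domCoprod_alternization_eq a b)
  simp only [AlternatingMap.smul_apply, map_nsmul, Fintype.card_fin] at h1
  have h2 : altMul m k l a b v = TensorProduct.lift m ((a.domCoprod b) (v ∘ finSumFinEquiv)) := rfl
  have h3 : ((k.factorial : ℂ) * l.factorial) • altMul m k l a b v =
      (k.factorial * l.factorial) • altMul m k l a b v := by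
    rw [← Nat.cast_smul_eq_nsmul ℂ]
    push_cast
    rfl
  rw [h3, h2, ← h1, MultilinearMap.alternatization_apply, map_sum, permSum,
    ← (Equiv.permCongr finSumFinEquiv).sum_comp]
  refine Finset.sum_congr rfl fun σ _ => ?_
  have e1 : (List.ofFn (v ∘ Equiv.permCongr finSumFinEquiv σ)).take k =
      List.ofFn fun i => v (finSumFinEquiv (σ (Sum.inl i))) := by
    rw [List.ofFn_add, List.take_left' (by simp)]
    congr 1
    funext i
    rw [Function.comp_apply, Equiv.permCongr_apply]
    exact congrArg (fun j => v (finSumFinEquiv (σ j))) (finSumFinEquiv_symm_apply_castAdd i)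
  have e2 : (List.ofFn (v ∘ Equiv.permCongr finSumFinEquiv σ)).drop k =
      List.ofFn fun i => v (finSumFinEquiv (σ (Sum.inr i))) := by
    rw [List.ofFn_add, List.drop_left' (by simp)]
    simp [Equiv.permCongr_apply]
  rw [e1, e2, ev_ofFn, ev_ofFn, Equiv.Perm.sign_permCongr]
  rcases Int.units_eq_one_or (Equiv.Perm.sign σ) with h | h <;>
    simp [h, Function.comp_def]

/-- Both sides agree after multiplication by `k! l!`, which is invertible over `ℂ`. -/
theorem sh_ev (m : N →ₗ[ℂ] N' →ₗ[ℂ] N'') (s : ℂ) (k l : ℕ) (a : M [⋀^Fin k]→ₗ[ℂ] N)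
    (b : M [⋀^Fin l]→ₗ[ℂ] N') :
    sh m (s • LinearMap.id) (ev k a) (ev l b) = s ^ l • ev (k + l) (altMul m k l a b) := by
  -- Covers lists of the wrong length, on which the permutation formula says nothing.
  have supp : ∀ (L : List M) (k l : ℕ) (A : List M → N) (B : List M → N'),
      (∀ L, L.length ≠ k → A L = 0) → (∀ L, L.length ≠ l → B L = 0) → L.length ≠ k + l →
      sh m (s • LinearMap.id) A B L = 0 := by
    intro L
    induction L with
    | nil =>
      intro k l A B hA hB h
      rw [sh_nil]
      by_cases hk : k = 0
      · rw [hB [] (by simp at h ⊢; omega), map_zero]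
      · rw [hA [] (by simp; omega), map_zero, LinearMap.zero_apply]
    | cons X L ih =>
      intro k l A B hA hB h
      rw [sh_cons]
      have h1 : sh m (s • LinearMap.id) (ins X A) B L = 0 := by
        rcases k with _ | k
        · have : ins X A = 0 := funext fun L => hA _ (by simp)
          simp [this]
        · exact ih k l _ _ (fun L hL => hA _ (by simpa using hL)) hB (by simp at h; omega)
      have h2 : sh m (s • LinearMap.id) (tw (s • LinearMap.id) A) (ins X B) L = 0 := by
        rcases l with _ | l
        · have : ins X B = 0 := funext fun L => hB _ (by simp)
          simp [this]
        · exact ih k l _ _ (fun L hL => by simp [tw_apply, hA L hL])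
            (fun L hL => hB _ (by simpa using hL)) (by simp at h; omega)
      rw [h1, h2, add_zero]
  funext L
  by_cases h : L.length = k + l
  · obtain ⟨v, rfl⟩ := exists_ofFn h
    have h1 := sh_eq_permSum m s (k + l) k l rfl (ev k a) (ev l b) (ev_mem_altSub a)
      (ev_mem_altSub b) (fun _ => ev_of_length_ne a) (fun _ => ev_of_length_ne b) v
    rw [← altMul_eq_permSum, smul_comm] at h1
    have h2 : (k.factorial : ℂ) * l.factorial ≠ 0 :=
      mul_ne_zero (Nat.cast_ne_zero.2 k.factorial_ne_zero) (Nat.cast_ne_zero.2 l.factorial_ne_zero)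
    rw [Pi.smul_apply, ev_ofFn]
    exact smul_right_injective _ h2 h1
  · rw [supp L k l _ _ (fun _ => ev_of_length_ne a) (fun _ => ev_of_length_ne b) h, Pi.smul_apply,
      ev_of_length_ne _ h, smul_zero]

end Shuffle

/-! ## Formal forms as functions on lists -/

section Forms

variable (n : ℕ)

/-- Functions on lists of vectors with values in `𝒪`. -/
abbrev FormL (n : ℕ) : Type := List (Fin n → ℂ) → FormalFun n

/-- Multiplication of formal functions, as a bilinear map. -/
abbrev mulO : FormalFun n →ₗ[ℂ] FormalFun n →ₗ[ℂ] FormalFun n := LinearMap.mul ℂ (FormalFun n)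

/-- The directional derivative on formal functions. -/
def dirD (v : Fin n → ℂ) : FormalFun n →ₗ[ℂ] FormalFun n := ∑ j, v j • partialD n j

/-- The de Rham differential on functions on lists. -/
def dRL : FormL n →ₗ[ℂ] FormL n := altOp fun v => post (dirD n v)

/-- The interior product on functions on lists. -/
def ixL (X : Vect n) : FormL n →ₗ[ℂ] FormL n :=
  ∑ i, post (mulO n (X i)) ∘ₗ ins (Pi.single i 1)

variable {n}

theorem dirD_apply (v : Fin n → ℂ) (f : FormalFun n) :
    dirD n v f = ∑ j, v j • partialD n j f := by
  simp [dirD]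

theorem dirD_single (i : Fin n) : dirD n (Pi.single i 1) = partialD n i := by
  ext1 f
  rw [dirD_apply, Finset.sum_eq_single i (fun j _ h => by simp [h]) (by simp)]
  simp

theorem dirD_mul (v : Fin n → ℂ) (f g : FormalFun n) :
    dirD n v (f * g) = dirD n v f * g + f * dirD n v g := by
  simp only [dirD_apply, Finset.sum_mul, Finset.mul_sum, ← Finset.sum_add_distrib]
  refine Finset.sum_congr rfl fun i _ => ?_
  simp only [partialD, Derivation.coeFn_coe, Derivation.leibniz, smul_eq_mul, smul_add,
    smul_mul_assoc, mul_smul_comm]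
  ring_nf

theorem partialD_comm (i j : Fin n) (f : FormalFun n) :
    partialD n i (partialD n j f) = partialD n j (partialD n i f) := by
  ext d
  simp only [partialD, Derivation.coeFn_coe, MvPowerSeries.coeff_pderiv]
  rw [add_right_comm d]
  by_cases h : i = j
  · subst h
    rfl
  · simp [h, Ne.symm h]
    ring

theorem dirD_comm (v w : Fin n → ℂ) (f : FormalFun n) :
    dirD n v (dirD n w f) = dirD n w (dirD n v f) := by
  simp only [dirD_apply, map_sum, map_smul, Finset.smul_sum]
  rw [Finset.sum_comm]
  refine Finset.sum_congr rfl fun i _ => Finset.sum_congr rfl fun j _ => ?_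
  rw [smul_comm, partialD_comm]

theorem dRL_apply (ω : FormL n) : dRL n ω = altL fun v => post (dirD n v) ω := rfl

theorem ixL_apply (X : Vect n) (ω : FormL n) (m : List (Fin n → ℂ)) :
    ixL n X ω m = ∑ i, X i * ω (Pi.single i 1 :: m) := by
  simp [ixL, post_apply, ins_apply]

theorem ixL_eq (X : Vect n) (ω : FormL n) :
    ixL n X ω = ∑ i, post (mulO n (X i)) (ins (Pi.single i 1) ω) := by
  simp [ixL]

theorem ins_dRL (v : Fin n → ℂ) (ω : FormL n) :
    ins v (dRL n ω) = post (dirD n v) ω - dRL n (ins v ω) := by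
  simp only [dRL_apply, ins_altL, ins_post]

/-- Directional derivatives commute, hence commute with `dRL`; the two first-order terms in the
Cartan recursion then cancel. -/
theorem dRL_dRL (ω : FormL n) : dRL n (dRL n ω) = 0 := by
  have hpost : ∀ (w : Fin n → ℂ) (ω : FormL n),
      dRL n (post (dirD n w) ω) = post (dirD n w) (dRL n ω) := by
    intro w ω
    rw [dRL_apply, dRL_apply, ← altL_post]
    congr 1
    funext v l
    exact dirD_comm _ _ _
  funext l
  induction l generalizing ω with
  | nil => rfl
  | cons w l ih =>
    rw [← ins_apply w (dRL n _), ins_dRL, ins_dRL, map_sub, hpost, sub_sub_cancel, ih]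
    rfl

/-! ### Comparison with alternating maps -/

theorem ev_deRham {p : ℕ} (ω : Form n p) : ev (p + 1) (deRham n p ω) = dRL n (ev p ω) := by
  -- The bilinear map repeats the one inside `deRham`, so that `ev_alternatize` applies
  -- definitionally.
  have h : ∀ v, ev p ((LinearMap.mk₂ ℂ (fun (ω : Form n p) (v : Fin n → ℂ) =>
        ∑ j, v j • (partialD n j).compAlternatingMap ω)
      (fun ω ω' v => by ext1 u; simp [Finset.sum_add_distrib])
      (fun c ω v => by ext1 u; simp [Finset.smul_sum, smul_comm c])
      (fun ω v v' => by simp [add_smul, Finset.sum_add_distrib])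
      (fun c ω v => by simp [Finset.smul_sum, mul_smul])) ω v) = post (dirD n v) (ev p ω) := by
    intro v
    rw [LinearMap.mk₂_apply, map_sum]
    funext l
    simp only [map_smul, ← post_ev, Finset.sum_apply, Pi.smul_apply, post_apply, dirD_apply]
  rw [dRL_apply]
  simp only [← h]
  exact ev_alternatize _

theorem ev_interior {p : ℕ} (X : Vect n) (ω : Form n (p + 1)) :
    ev p (interior n p X ω) = ixL n X (ev (p + 1) ω) := by
  funext l
  rw [ixL_apply]
  by_cases h : l.length = p
  · obtain ⟨v, rfl⟩ := exists_ofFn h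
    rw [ev_ofFn, interior_apply]
    refine Finset.sum_congr rfl fun i _ => ?_
    rw [← ev_ofFn ω]
    simp
  · rw [ev_of_length_ne _ h]
    refine (Finset.sum_eq_zero fun i _ => ?_).symm
    rw [ev_of_length_ne _ (by simpa using h), mul_zero]

theorem ixL_ev_zero (X : Vect n) (ω : Form n 0) : ixL n X (ev 0 ω) = 0 := by
  simp [ixL_eq, ins_ev_zero]

theorem ev_lieD (X : Vect n) : ∀ {p : ℕ} (ω : Form n p),
    ev p (lieD n p X ω) = lieOp (dRL n) (ixL n) X (ev p ω)
  | 0, ω => by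
    have h : lieD n 0 X ω = interior n 0 X (deRham n 0 ω) := rfl
    simp [h, lieOp, ixL_ev_zero, ev_interior, ev_deRham]
  | p + 1, ω => by
    have h : lieD n (p + 1) X ω = deRham n p (interior n p X ω) +
      interior n (p + 1) X (deRham n (p + 1) ω) := rfl
    simp [h, lieOp, ev_interior, ev_deRham, add_comm]

theorem ev_wedge {p p' : ℕ} (ω : Form n p) (η : Form n p') :
    ev (p + p') (wedge n p p' ω η) = sh (mulO n) LinearMap.id (ev p ω) (ev p' η) := by
  have h := sh_ev (mulO n) 1 p p' ω η
  rw [one_smul, one_pow, one_smul] at h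
  exact h.symm

/-! ### Derivations and alternation -/

theorem gradedMul_mulO : GradedMul (mulO n) LinearMap.id :=
  ⟨fun x y z => mul_assoc x y z, fun _ _ => rfl, fun _ => rfl⟩

theorem oddDer_dRL : OddDer (sh (mulO n) LinearMap.id) (tw LinearMap.id) (dRL n) := by
  refine ⟨fun ω => ?_, fun a b => ?_⟩
  · simp only [dRL_apply, post_tw, ← altL_tw, tw_post, LinearMap.id_comp, LinearMap.comp_id]
  · exact oddDer_altL gradedMul_mulO (T := fun v => post (dirD n v))
      (fun v => evenDer_post (fun x y => dirD_mul v x y) fun _ => rfl) a b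

/-- A contraction is a combination of insertions of basis vectors with coefficients in `𝒪`, and the
product is bilinear over `𝒪`. -/
theorem oddDer_ixL (X : Vect n) : OddDer (sh (mulO n) LinearMap.id) (tw LinearMap.id) (ixL n X) := by
  refine ⟨fun ω => ?_, fun a b => ?_⟩
  · simp only [ixL_eq, ins_tw, map_neg, map_sum, Finset.sum_neg_distrib, post_tw, tw_post,
      LinearMap.id_comp, LinearMap.comp_id]
  · have h1 : ∀ (f : FormalFun n) (a b : FormL n), post (mulO n f) (sh (mulO n) LinearMap.id a b) =
        sh (mulO n) LinearMap.id (post (mulO n f) a) b := fun f a b =>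
      sh_map (mulO n) LinearMap.id (mulO n) LinearMap.id (mulO n f) LinearMap.id (mulO n f)
        (fun x y => (mul_assoc f x y).symm) (fun _ => rfl) a b
    have h2 : ∀ (f : FormalFun n) (a b : FormL n), post (mulO n f) (sh (mulO n) LinearMap.id a b) =
        sh (mulO n) LinearMap.id a (post (mulO n f) b) := fun f a b =>
      sh_map (mulO n) LinearMap.id (mulO n) LinearMap.id LinearMap.id (mulO n f) (mulO n f)
        (fun x y => mul_left_comm f x y) (fun _ => rfl) a b
    simp only [ixL_eq, ins_sh, map_add, Finset.sum_add_distrib, map_sum, LinearMap.sum_apply]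
    congr 1
    · exact Finset.sum_congr rfl fun i _ => h1 _ _ _
    · exact Finset.sum_congr rfl fun i _ => h2 _ _ _

variable {ω : FormL n}

theorem altSub_ixL (X : Vect n) (hω : ω ∈ altSub (Fin n → ℂ) (FormalFun n)) :
    ixL n X ω ∈ altSub (Fin n → ℂ) (FormalFun n) := by
  rw [ixL_eq]
  exact sum_mem fun i _ => altSub_post _ (altSub_ins hω _)

theorem ixL_ixL (hω : ω ∈ altSub (Fin n → ℂ) (FormalFun n)) (X Y : Vect n) :
    ixL n X (ixL n Y ω) = -ixL n Y (ixL n X ω) := by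
  funext m
  simp only [ixL_apply, Pi.neg_apply, Finset.mul_sum, ← Finset.sum_neg_distrib]
  rw [Finset.sum_comm]
  refine Finset.sum_congr rfl fun i _ => Finset.sum_congr rfl fun j _ => ?_
  have h := hω.1 [] (Pi.single i 1) (Pi.single j 1) m
  simp only [List.nil_append] at h
  rw [h]
  ring

theorem ixL_add (X Y : Vect n) : ixL n (X + Y) = ixL n X + ixL n Y := by
  ext ω m : 2
  simp [ixL_apply, add_mul, Finset.sum_add_distrib]

theorem ixL_smul (c : ℂ) (X : Vect n) : ixL n (c • X) = c • ixL n X := by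
  ext ω m : 2
  simp [ixL_apply, Finset.smul_sum]

/-- Alternating functions vanishing in degrees at least `k`. -/
def formFilt (n k : ℕ) : Submodule ℂ (FormL n) where
  carrier := {ω | ω ∈ altSub (Fin n → ℂ) (FormalFun n) ∧ ∀ m, k ≤ m.length → ω m = 0}
  add_mem' ha hb := ⟨add_mem ha.1 hb.1, fun m h => by simp [ha.2 m h, hb.2 m h]⟩
  zero_mem' := ⟨zero_mem _, fun _ _ => rfl⟩
  smul_mem' c _ ha := ⟨Submodule.smul_mem _ c ha.1, fun m h => by simp [ha.2 m h]⟩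

theorem formFilt_zero : formFilt n 0 = ⊥ :=
  eq_bot_iff.2 fun _ h => funext fun m => h.2 m (Nat.zero_le _)

theorem formFilt_mono : Monotone (formFilt n) :=
  fun _ _ h _ hω => ⟨hω.1, fun m hm => hω.2 m (h.trans hm)⟩

theorem formFilt_ixL (k : ℕ) (X : Vect n) (ω : FormL n) (hω : ω ∈ formFilt n (k + 1)) :
    ixL n X ω ∈ formFilt n k :=
  ⟨altSub_ixL X hω.1, fun m hm => by
    rw [ixL_apply]
    exact Finset.sum_eq_zero fun i _ => by rw [hω.2 _ (by simpa using hm), mul_zero]⟩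

theorem ev_mem_formFilt {p : ℕ} (ω : Form n p) : ev p ω ∈ formFilt n (n + 1) := by
  refine ⟨ev_mem_altSub ω, fun m hm => ?_⟩
  by_cases h : m.length = p
  · obtain ⟨v, rfl⟩ := exists_ofFn h
    rw [ev_ofFn]
    -- More than `n` vectors in `ℂ^n` are dependent. This bound is why `e^ι` stops at `k = n`.
    refine ω.map_linearDependent v fun hv => ?_
    have := hv.fintype_card_le_finrank
    simp at this hm
    omega
  · exact ev_of_length_ne _ h

/-! ### The Lie derivative -/

theorem dRL_post_mul (f : FormalFun n) (ω : FormL n) :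
    dRL n (post (mulO n f) ω) =
      altL (fun v => post (mulO n (dirD n v f)) ω) + post (mulO n f) (dRL n ω) := by
  rw [dRL_apply, dRL_apply, ← altL_post, ← altL_add]
  congr 1
  funext v m
  exact dirD_mul v f (ω m)

/-- The coordinate form `L_X = ∑ (X_i ∂_i + dX_i ∧ ι_{∂_i})`; the two terms `X_i d ι_{∂_i}` cancel.
-/
theorem lieOp_eq (X : Vect n) (ω : FormL n) :
    lieOp (dRL n) (ixL n) X ω = ∑ i, (post (mulO n (X i)) (post (partialD n i) ω) +
      altL fun v => post (mulO n (dirD n v (X i))) (ins (Pi.single i 1) ω)) := by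
  simp only [lieOp, LinearMap.add_apply, LinearMap.comp_apply, ixL_eq, ins_dRL, dirD_single,
    map_sub, map_sum, dRL_post_mul, Finset.sum_add_distrib, Finset.sum_sub_distrib]
  abel

theorem ins_lieOp (hω : ω ∈ altSub (Fin n → ℂ) (FormalFun n)) (X : Vect n) (k : Fin n) :
    ins (Pi.single k 1) (lieOp (dRL n) (ixL n) X ω) =
      lieOp (dRL n) (ixL n) X (ins (Pi.single k 1) ω) +
        ∑ i, post (mulO n (partialD n k (X i))) (ins (Pi.single i 1) ω) := by
  rw [lieOp_eq, lieOp_eq, map_sum, ← Finset.sum_add_distrib]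
  refine Finset.sum_congr rfl fun i _ => ?_
  simp only [map_add, ins_altL, ins_post, dirD_single, ins_ins hω (Pi.single k 1), map_neg, altL_neg]
  abel

theorem lieOp_post_mul (X : Vect n) (f : FormalFun n) (ω : FormL n) :
    lieOp (dRL n) (ixL n) X (post (mulO n f) ω) =
      post (mulO n f) (lieOp (dRL n) (ixL n) X ω) +
        post (mulO n (∑ i, X i * partialD n i f)) ω := by
  rw [lieOp_eq, lieOp_eq, map_sum]
  have h : post (mulO n (∑ i, X i * partialD n i f)) ω =
      ∑ i, post (mulO n (X i * partialD n i f)) ω := by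
    funext m
    simp [post_apply]
  rw [h, ← Finset.sum_add_distrib]
  refine Finset.sum_congr rfl fun i _ => ?_
  rw [map_add, ← altL_post]
  have h2 : (fun v => post (mulO n (dirD n v (X i)))
      (ins (Pi.single i 1) (post (mulO n f) ω))) =
      fun v => post (mulO n f) (post (mulO n (dirD n v (X i))) (ins (Pi.single i 1) ω)) := by
    funext v m
    exact mul_left_comm _ _ _
  rw [h2, add_right_comm]
  congr 1
  funext m
  have h3 := dirD_mul (Pi.single i 1) f (ω m)
  rw [dirD_single] at h3
  simp only [post_apply, Pi.add_apply, LinearMap.mul_apply', h3]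
  ring

/-- Expand `ι_X = ∑ X_k ι_{∂_k}`. The Leibniz rule `lieOp_post_mul` contributes `Y(X_k)` and
`ins_lieOp` contributes `-X(Y_k)`: the components of `[Y, X]`. -/
theorem lieOp_ixL (hω : ω ∈ altSub (Fin n → ℂ) (FormalFun n)) (X Y : Vect n) :
    lieOp (dRL n) (ixL n) Y (ixL n X ω) - ixL n X (lieOp (dRL n) (ixL n) Y ω) =
      ixL n (adL (nabla n) Y X) ω := by
  have h1 : ∀ k, post (mulO n (X k)) (ins (Pi.single k 1) (lieOp (dRL n) (ixL n) Y ω)) =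
      post (mulO n (X k)) (lieOp (dRL n) (ixL n) Y (ins (Pi.single k 1) ω)) +
      ∑ i, post (mulO n (X k * partialD n k (Y i))) (ins (Pi.single i 1) ω) := by
    intro k
    rw [ins_lieOp hω, map_add, map_sum]
    congr 1
    refine Finset.sum_congr rfl fun i _ => ?_
    funext m
    exact (mul_assoc _ _ _).symm
  rw [ixL_eq, ixL_eq, ixL_eq, map_sum]
  simp only [lieOp_post_mul, h1, Finset.sum_add_distrib, add_sub_add_left_eq_sub]
  rw [Finset.sum_comm (f := fun k i => post _ _), ← Finset.sum_sub_distrib]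
  refine Finset.sum_congr rfl fun i _ => ?_
  funext m
  simp [post_apply, adL_apply, nabla]

/-- The componentwise connection is flat and the bracket is its commutator; the Jacobi identity is
the sum of three cyclic flatness relations. -/
theorem adL_nabla_jacobi (X Y : Vect n) :
    adL (nabla n) X ∘ₗ adL (nabla n) Y - adL (nabla n) Y ∘ₗ adL (nabla n) X =
      adL (nabla n) (adL (nabla n) X Y) := by
  have flat : ∀ X Y Z : Vect n, nabla n X (nabla n Y Z) - nabla n Y (nabla n X Z) =
      nabla n (nabla n X Y - nabla n Y X) Z := by
    -- The second-order part is symmetric in `X` and `Y` because partial derivatives commute, so it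
    -- drops out of the commutator.
    have h : ∀ (X Y Z : Vect n) (j : Fin n), nabla n X (nabla n Y Z) j =
        nabla n (nabla n X Y) Z j +
          ∑ i, ∑ k, X i * Y k * partialD n i (partialD n k (Z j)) := by
      intro X Y Z j
      simp only [nabla, LinearMap.mk₂_apply, map_sum, Finset.mul_sum, Finset.sum_mul]
      rw [Finset.sum_comm (f := fun k i => X i * partialD n i (Y k) * _),
        ← Finset.sum_add_distrib]
      refine Finset.sum_congr rfl fun i _ => ?_
      rw [← Finset.sum_add_distrib]
      refine Finset.sum_congr rfl fun k _ => ?_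
      have h3 := dirD_mul (Pi.single i 1) (Y k) (partialD n k (Z j))
      rw [dirD_single] at h3
      rw [h3]
      ring
    intro X Y Z
    funext j
    have h2 : ∑ i, ∑ k, X i * Y k * partialD n i (partialD n k (Z j)) =
        ∑ i, ∑ k, Y i * X k * partialD n i (partialD n k (Z j)) := by
      rw [Finset.sum_comm]
      refine Finset.sum_congr rfl fun i _ => Finset.sum_congr rfl fun k _ => ?_
      rw [partialD_comm, mul_comm (X k)]
    rw [Pi.sub_apply, h, h, h2, map_sub, LinearMap.sub_apply, Pi.sub_apply]
    abel
  refine LinearMap.ext fun Z => ?_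
  have e1 := flat X Y Z
  have e2 := flat Y Z X
  have e3 := flat Z X Y
  simp only [LinearMap.sub_apply, LinearMap.comp_apply, adL_apply, map_sub] at e1 e2 e3 ⊢
  linear_combination (exp := 1) e1 + e2 + e3

end Forms

/-! ## The formal Poincaré lemma -/

section Poincare

variable {n : ℕ}

/-- Multiplication of the coefficient of `x^a` by `1 / (|a| + k)`. -/
def wt (n k : ℕ) : FormalFun n →ₗ[ℂ] FormalFun n where
  toFun f := fun a => ((a.degree : ℂ) + k)⁻¹ * MvPowerSeries.coeff a f
  map_add' f g := by
    ext a
    exact mul_add _ _ _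
  map_smul' c f := by
    ext a
    exact mul_left_comm _ _ _

theorem coeff_wt (k : ℕ) (f : FormalFun n) (a : Fin n →₀ ℕ) :
    MvPowerSeries.coeff a (wt n k f) = ((a.degree : ℂ) + k)⁻¹ * MvPowerSeries.coeff a f := rfl

theorem dilationAverage_eq (p : ℕ) : dilationAverage n p = wt n (p + 1) := by
  refine LinearMap.ext fun f => ?_
  ext a
  have h : MvPowerSeries.coeff a (dilationAverage n p f) =
    ((a.degree : ℂ) + p + 1)⁻¹ * MvPowerSeries.coeff a f := rfl
  rw [h, coeff_wt]
  push_cast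
  rw [add_assoc]

/-- Differentiation lowers the polynomial degree by one, which the shift of the weight compensates.
-/
theorem dirD_wt (v : Fin n → ℂ) (k : ℕ) (f : FormalFun n) :
    dirD n v (wt n k f) = wt n (k + 1) (dirD n v f) := by
  simp only [dirD_apply, map_sum, map_smul]
  refine Finset.sum_congr rfl fun i _ => ?_
  congr 1
  ext a
  simp only [partialD, Derivation.coeFn_coe, MvPowerSeries.coeff_pderiv, coeff_wt, map_add,
    Finsupp.degree_single]
  push_cast
  ring

/-- The operator `wt (k + m)` in degree `m`. -/
def avgL (n k : ℕ) : FormL n →ₗ[ℂ] FormL n where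
  toFun ω m := wt n (k + m.length) (ω m)
  map_add' _ _ := funext fun _ => map_add _ _ _
  map_smul' c _ := funext fun _ => map_smul (wt n _) c _

theorem avgL_apply (k : ℕ) (ω : FormL n) (m : List (Fin n → ℂ)) :
    avgL n k ω m = wt n (k + m.length) (ω m) := rfl

theorem ins_avgL (k : ℕ) (v : Fin n → ℂ) (ω : FormL n) :
    ins v (avgL n k ω) = avgL n (k + 1) (ins v ω) := by
  funext m
  simp only [ins_apply, avgL_apply, List.length_cons]
  rw [add_right_comm, add_assoc k]

/-- The de Rham differential preserves polynomial degree plus form degree, the weight by which `avgL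
n 0` divides. -/
theorem dRL_avgL (k : ℕ) (ω : FormL n) : dRL n (avgL n k ω) = avgL n k (dRL n ω) := by
  funext m
  induction m generalizing k ω with
  | nil => simp [dRL_apply, altL_nil, avgL_apply]
  | cons v m ih =>
    rw [← ins_apply v (dRL n _), ← ins_apply v (avgL n k _), ins_avgL, ins_dRL, ins_dRL, ins_avgL,
      map_sub, Pi.sub_apply, Pi.sub_apply, ih]
    congr 1
    simp only [post_apply, avgL_apply, dirD_wt]
    rw [add_right_comm]

theorem altSub_avgL {ω : FormL n} (hω : ω ∈ altSub (Fin n → ℂ) (FormalFun n)) (k : ℕ) :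
    avgL n k ω ∈ altSub (Fin n → ℂ) (FormalFun n) := by
  refine ⟨fun u X Y w => ?_, fun X Y w => ?_, fun c X w => ?_⟩
  · simp [avgL_apply, hω.1 u X Y w]
  · simp [avgL_apply, hω.2.1]
  · simp [avgL_apply, hω.2.2]

/-- The Poincaré homotopy on functions on lists. -/
def poincareL (n : ℕ) : FormL n →ₗ[ℂ] FormL n := ixL n (euler n) ∘ₗ avgL n 0

theorem ev_poincare {p : ℕ} (ω : Form n (p + 1)) :
    ev p (poincare n p ω) = poincareL n (ev (p + 1) ω) := by
  have h : poincare n p ω =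
    interior n p (euler n) ((dilationAverage n p).compAlternatingMap ω) := rfl
  rw [h, ev_interior, ← post_ev, dilationAverage_eq]
  have h2 : post (wt n (p + 1)) (ev (p + 1) ω) = avgL n 0 (ev (p + 1) ω) := by
    funext m
    by_cases hm : m.length = p + 1
    · rw [post_apply, avgL_apply, hm, zero_add]
    · rw [post_apply, avgL_apply, ev_of_length_ne _ hm, map_zero, map_zero]
  rw [h2]
  rfl

theorem poincareL_ev_zero (ω : Form n 0) : poincareL n (ev 0 ω) = 0 := by
  funext m
  have h : ∀ v, avgL n 0 (ev 0 ω) (v :: m) = 0 := fun v => by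
    rw [avgL_apply, ev_of_length_ne _ (by simp), map_zero]
  simp [poincareL, ixL_apply, h]

/-- Each argument, moved to the front with its sign, reproduces the value once. -/
theorem altL_ins {M N : Type} [AddCommGroup M] [Module ℂ M] [AddCommGroup N] [Module ℂ N]
    {φ : List M → N} (hφ : φ ∈ altSub M N) (l : List M) :
    altL (fun X => ins X φ) l = (l.length : ℂ) • φ l := by
  induction l generalizing φ with
  | nil => simp [altL_nil]
  | cons X l ih =>
    have h : (fun Y => ins X (ins Y φ)) = fun Y => -ins Y (ins X φ) :=
      funext fun Y => ins_ins hφ X Y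
    rw [altL_cons, h, altL_neg, Pi.neg_apply, ih (altSub_ins hφ X), ins_apply, List.length_cons]
    push_cast
    module

theorem coeff_euler (f : FormalFun n) (a : Fin n →₀ ℕ) :
    MvPowerSeries.coeff a (∑ i, MvPowerSeries.X i * partialD n i f) =
      (a.degree : ℂ) * MvPowerSeries.coeff a f := by
  rw [map_sum, Finsupp.degree_eq_sum, Nat.cast_sum, Finset.sum_mul]
  refine Finset.sum_congr rfl fun i _ => ?_
  by_cases h : Finsupp.single i 1 ≤ a
  · obtain ⟨b, rfl⟩ := exists_add_of_le h
    rw [MvPowerSeries.X, MvPowerSeries.coeff_add_monomial_mul, add_comm]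
    simp only [partialD, Derivation.coeFn_coe, MvPowerSeries.coeff_pderiv]
    simp
    ring
  · have h0 : a i = 0 := by
      by_contra h0
      exact h (Finsupp.single_le_iff.2 (Nat.one_le_iff_ne_zero.2 h0))
    rw [MvPowerSeries.X, MvPowerSeries.coeff_monomial_mul, if_neg h, h0]
    simp

/-- As `d x_i` is constant, `∑ dx_i ∧ ι_{∂_i}` counts the form degree; with `coeff_euler`, the
operator `L_E` multiplies by the total weight. -/
theorem lieOp_euler {ω : FormL n} (hω : ω ∈ altSub (Fin n → ℂ) (FormalFun n))
    (m : List (Fin n → ℂ)) :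
    lieOp (dRL n) (ixL n) (euler n) ω m =
      ∑ i, MvPowerSeries.X i * partialD n i (ω m) + (m.length : ℂ) • ω m := by
  have h : ∀ (v : Fin n → ℂ) (i : Fin n),
      dirD n v (euler n i) = MvPowerSeries.C (v i) := by
    intro v i
    rw [dirD_apply, Finset.sum_eq_single i]
    · simp [partialD, euler, MvPowerSeries.smul_eq_C_mul]
    · intro j _ hj
      simp [partialD, euler, MvPowerSeries.pderiv_X_of_ne hj.symm]
    · simp
  have h2 : (fun v => ∑ i, post (mulO n (dirD n v (euler n i))) (ins (Pi.single i 1) ω)) =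
      fun v => ins v ω := by
    funext v
    have hv : v = ∑ i, v i • (Pi.single i 1 : Fin n → ℂ) := by
      funext j
      simp [Finset.sum_apply, Pi.single_apply]
    conv_rhs => rw [hv]
    rw [ins_sum hω]
    refine Finset.sum_congr rfl fun i _ => ?_
    rw [ins_smul hω, h]
    funext m
    simp [post_apply, MvPowerSeries.smul_eq_C_mul]
  rw [lieOp_eq, Finset.sum_add_distrib, ← altL_sum, h2, Pi.add_apply, altL_ins hω,
    Finset.sum_apply]
  rfl

/-- The formal Poincaré lemma. -/
theorem dRL_poincareL {ω : FormL n} (hω : ω ∈ altSub (Fin n → ℂ) (FormalFun n)) :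
    dRL n (poincareL n ω) + poincareL n (dRL n ω) =
      ω - pt (MvPowerSeries.C (MvPowerSeries.constantCoeff (ω []))) := by
  have h : dRL n (poincareL n ω) + poincareL n (dRL n ω) =
      lieOp (dRL n) (ixL n) (euler n) (avgL n 0 ω) := by
    simp only [poincareL, lieOp, LinearMap.comp_apply, LinearMap.add_apply, dRL_avgL]
    abel
  rw [h]
  funext m
  rw [lieOp_euler (altSub_avgL hω 0)]
  ext a
  rw [map_add, coeff_euler, map_smul, smul_eq_mul, ← add_mul, avgL_apply, coeff_wt, zero_add,
    Pi.sub_apply, map_sub]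
  -- Weight zero occurs only for the constant term of a function. There `0⁻¹ = 0` makes the left
  -- side vanish, matching the subtracted constant; in all other weights `L_E` and the average are
  -- inverse.
  by_cases h0 : (a.degree : ℂ) + m.length = 0
  · have h1 : a.degree + m.length = 0 := by exact_mod_cast h0
    obtain ⟨h2, h3⟩ := Nat.add_eq_zero_iff.1 h1
    obtain rfl := (Finsupp.degree_eq_zero_iff a).1 h2
    obtain rfl := List.length_eq_zero_iff.1 h3
    simp [pt_nil]
  · rw [mul_inv_cancel_left₀ h0]
    have : MvPowerSeries.coeff a (pt (M := Fin n → ℂ) (MvPowerSeries.C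
        (MvPowerSeries.constantCoeff (ω [])) : FormalFun n) m) = 0 := by
      rcases m with _ | ⟨v, m⟩
      · rw [pt_nil, MvPowerSeries.coeff_C, if_neg]
        rintro rfl
        simp at h0
      · simp [pt]
    rw [this, sub_zero]

end Poincare

/-! ## The total complex as functions on lists -/

section Comparison

variable {N N' N'' : Type} [AddCommGroup N] [Module ℂ N] [TopologicalSpace N]
  [IsTopologicalAddGroup N] [ContinuousConstSMul ℂ N]
  [AddCommGroup N'] [Module ℂ N'] [TopologicalSpace N']
  [IsTopologicalAddGroup N'] [ContinuousConstSMul ℂ N']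
  [AddCommGroup N''] [Module ℂ N''] [TopologicalSpace N'']
  [IsTopologicalAddGroup N''] [ContinuousConstSMul ℂ N'']

/-- A cochain as a function on lists. -/
def evC (n q : ℕ) : Cochain n q N →ₗ[ℂ] (List (Vect n) → N) where
  toFun φ := ev q φ.val
  map_add' a b := by rw [Cochain.val_add, map_add]
  map_smul' c a := by rw [Cochain.val_smul, map_smul]; rfl

variable {n : ℕ}

theorem evC_apply {q : ℕ} (φ : Cochain n q N) : evC n q φ = ev q φ.val := rfl

theorem evC_injective (q : ℕ) : Function.Injective (evC (N := N) n q) :=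
  fun _ _ h => Cochain.ext (ev_injective q h)

theorem evC_mem_altSub {q : ℕ} (φ : Cochain n q N) : evC n q φ ∈ altSub (Vect n) N :=
  ev_mem_altSub φ.val

theorem evC_postcomp {q : ℕ} (T : N →ₗ[ℂ] N') (hT : Continuous T) (φ : Cochain n q N) :
    evC n q (postcomp n q T hT φ) = post T (evC n q φ) :=
  (post_ev T φ.val).symm

theorem evC_insertion {q : ℕ} (B : Vect n →ₗ[ℂ] N →ₗ[ℂ] N')
    (hB : Continuous fun x : Vect n × N => B x.1 x.2) (φ : Cochain n q N) :
    evC n (q + 1) (insertion n q B hB φ) = altL fun X => post (B X) (evC n q φ) := by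
  simp only [evC_apply, post_ev]
  exact ev_alternatize _

theorem evC_dTriv : ∀ {q : ℕ} (φ : Cochain n q N),
    evC n (q + 1) (dTriv n q φ) = dL (nabla n) (evC n q φ)
  | 0, φ => by
    have h : dTriv n 0 φ = 0 := rfl
    rw [h, map_zero, dL_apply, evC_apply]
    simp only [ins_ev_zero, altL_zero, neg_zero]
  | r + 1, φ => by
    have h : (dTriv n (r + 1) φ).val = -AlternatingMap.alternatizeUncurryFin
      (AlternatingMap.alternatizeUncurryFinLM ∘ₗ nablaInsert φ.val) := rfl
    rw [evC_apply, h, map_neg, ev_alternatize, dL_apply, evC_apply]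
    congr 2
    funext X
    rw [LinearMap.comp_apply, AlternatingMap.alternatizeUncurryFinLM_apply, ev_alternatize]
    congr 1
    funext Y
    rw [ins_ev_succ]
    rfl

/-- With `s = (-1)^p`, the factor `s ^ q'` is the sign `(-1)^{pq'}` of the product on the total
complex. -/
theorem evC_cup (q q' : ℕ) (m : N →ₗ[ℂ] N' →ₗ[ℂ] N'')
    (hm : Continuous fun x : N × N' => m x.1 x.2) (s : ℂ) (a : Cochain n q N)
    (b : Cochain n q' N') :
    s ^ q' • evC n (q + q') (cup n q q' m hm a b) =
      sh m (s • LinearMap.id) (evC n q a) (evC n q' b) :=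
  (sh_ev m s q q' a.val b.val).symm

variable (n)

/-- An element of the total complex as a function on pairs of lists. -/
def evT : Tot n →ₗ[ℂ] (List (Vect n) → FormL n) :=
  DirectSum.toModule ℂ (ℕ × ℕ) _ fun x => post (ev x.2) ∘ₗ evC n x.1

/-- An element of the complex with constant coefficients as a function on lists. -/
def evB : Base n →ₗ[ℂ] (List (Vect n) → ℂ) :=
  DirectSum.toModule ℂ ℕ _ fun q => evC n q

variable {n}

theorem evT_of {q p : ℕ} (φ : FormCochain n q p) :
    evT n (Tot.of n q p φ) = post (ev p) (evC n q φ) := by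
  simp [evT, Tot.of]

theorem evB_of {q : ℕ} (φ : Cochain n q ℂ) : evB n (Base.of n q φ) = evC n q φ := by
  simp [evB, Base.of]

theorem tot_ext {P : Type} [AddCommGroup P] [Module ℂ P] {f g : Tot n →ₗ[ℂ] P}
    (h : ∀ q p (φ : FormCochain n q p), f (Tot.of n q p φ) = g (Tot.of n q p φ)) (a : Tot n) :
    f a = g a :=
  LinearMap.congr_fun (DirectSum.linearMap_ext ℂ fun x => LinearMap.ext fun φ => h x.1 x.2 φ) a

theorem base_ext {P : Type} [AddCommGroup P] [Module ℂ P] {f g : Base n →ₗ[ℂ] P}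
    (h : ∀ q (φ : Cochain n q ℂ), f (Base.of n q φ) = g (Base.of n q φ)) (a : Base n) :
    f a = g a :=
  LinearMap.congr_fun (DirectSum.linearMap_ext ℂ fun q => LinearMap.ext fun φ => h q φ) a

theorem evB_component (a : Base n) (l : List (Vect n)) :
    evB n a l = evC n l.length (a l.length) l := by
  refine base_ext (f := LinearMap.proj l ∘ₗ evB n) (g := LinearMap.proj l ∘ₗ
    evC n l.length ∘ₗ DirectSum.component ℂ ℕ (fun q => Cochain n q ℂ) l.length)
    (fun q φ => ?_) a
  simp only [LinearMap.comp_apply, LinearMap.proj_apply, evB_of]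
  by_cases h : q = l.length
  · subst h
    rw [DirectSum.component.lof_self]
  · have h2 : DirectSum.component ℂ ℕ (fun q => Cochain n q ℂ) l.length (Base.of n q φ) = 0 := by
      change DirectSum.of (fun q => Cochain n q ℂ) q φ l.length = 0
      exact DirectSum.of_eq_of_ne (β := fun q => Cochain n q ℂ) q l.length φ (Ne.symm h)
    rw [h2, map_zero, evC_apply, ev_of_length_ne _ (Ne.symm h)]
    rfl

theorem evB_injective : Function.Injective (evB n) := by
  refine (injective_iff_map_eq_zero _).2 fun a ha => DFinsupp.ext fun q => ?_
  refine evC_injective q (funext fun l => ?_)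
  by_cases h : l.length = q
  · subst h
    have h2 := evB_component a l
    rw [ha] at h2
    rw [← h2]
    simp
  · rw [evC_apply, evC_apply, ev_of_length_ne _ h, ev_of_length_ne _ h]

theorem evT_component (a : Tot n) (l : List (Vect n)) (m : List (Fin n → ℂ)) :
    evT n a l m = ev m.length (evC n l.length (a (l.length, m.length)) l) m := by
  refine tot_ext (f := LinearMap.proj m ∘ₗ LinearMap.proj l ∘ₗ evT n) (g := LinearMap.proj m ∘ₗ
    ev m.length ∘ₗ LinearMap.proj l ∘ₗ evC n l.length ∘ₗ
    DirectSum.component ℂ (ℕ × ℕ) (fun x => FormCochain n x.1 x.2) (l.length, m.length))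
    (fun q p φ => ?_) a
  simp only [LinearMap.comp_apply, LinearMap.proj_apply, evT_of, post_apply]
  by_cases h : (q, p) = (l.length, m.length)
  · obtain ⟨rfl, rfl⟩ := Prod.mk.inj h
    rw [DirectSum.component.lof_self]
  · have h2 : DirectSum.component ℂ (ℕ × ℕ) (fun x => FormCochain n x.1 x.2)
        (l.length, m.length) (Tot.of n q p φ) = 0 := by
      change DirectSum.of (fun x : ℕ × ℕ => FormCochain n x.1 x.2) (q, p) φ
        (l.length, m.length) = 0
      exact DirectSum.of_eq_of_ne (β := fun x : ℕ × ℕ => FormCochain n x.1 x.2) (q, p) (l.length, m.length) φ (Ne.symm h)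
    rw [h2, map_zero, Pi.zero_apply, map_zero, Pi.zero_apply]
    by_cases hq : l.length = q
    · rw [ev_of_length_ne _ fun hp => h (by rw [hq, hp])]
    · rw [evC_apply, ev_of_length_ne _ hq, map_zero, Pi.zero_apply]

/-- The bidegree is recorded by the two list lengths, so no component is lost; identities in the
total complex may be verified on lists. -/
theorem evT_injective : Function.Injective (evT n) := by
  refine (injective_iff_map_eq_zero _).2 fun a ha => DFinsupp.ext fun x => ?_
  obtain ⟨q, p⟩ := x
  refine evC_injective q (funext fun l => ?_)
  by_cases h : l.length = q
  · subst h
    refine ev_injective p (funext fun m => ?_)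
    by_cases h : m.length = p
    · subst h
      have h2 := evT_component a l m
      rw [ha] at h2
      rw [← h2]
      simp
    · rw [ev_of_length_ne _ h, ev_of_length_ne _ h]
  · rw [evC_apply, evC_apply, ev_of_length_ne _ h, ev_of_length_ne _ h]

theorem evT_mem_altSub (a : Tot n) : evT n a ∈ altSub (Vect n) (FormL n) := by
  induction a using DirectSum.induction_on with
  | zero => rw [map_zero]; exact zero_mem _
  | add a b iha ihb => rw [map_add]; exact add_mem iha ihb
  | of x φ => exact (evT_of φ).symm ▸ altSub_post _ (evC_mem_altSub φ)

theorem evT_mem_valSub (a : Tot n) : evT n a ∈ valSub (Vect n) (formFilt n (n + 1)) := by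
  induction a using DirectSum.induction_on with
  | zero => rw [map_zero]; exact zero_mem _
  | add a b iha ihb => rw [map_add]; exact add_mem iha ihb
  | of x φ => exact (evT_of φ).symm ▸ fun l => ev_mem_formFilt _

theorem evB_mem_altSub (a : Base n) : evB n a ∈ altSub (Vect n) ℂ := by
  induction a using DirectSum.induction_on with
  | zero => rw [map_zero]; exact zero_mem _
  | add a b iha ihb => rw [map_add]; exact add_mem iha ihb
  | of q φ => exact (evB_of φ).symm ▸ evC_mem_altSub φ

/-! ### Comparison of the operations -/

/-- The wedge product on functions on lists. -/
abbrev wedgeL (n : ℕ) : FormL n →ₗ[ℂ] FormL n →ₗ[ℂ] FormL n := sh (mulO n) LinearMap.id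

/-- The grading involution on functions on lists. -/
abbrev parL (n : ℕ) : FormL n →ₗ[ℂ] FormL n := tw LinearMap.id

theorem gradedMul_wedgeL : GradedMul (wedgeL n) (parL n) := gradedMul_sh gradedMul_mulO

theorem tw_evC {q : ℕ} (T : N →ₗ[ℂ] N') (φ : Cochain n q N) :
    tw T (evC n q φ) = (-1 : ℂ) ^ q • post T (evC n q φ) :=
  tw_ev T φ.val

theorem evT_totD (a : Tot n) :
    evT n (totD n a) = dTot (nabla n) (dRL n) (ixL n) (evT n a) := by
  refine tot_ext (f := evT n ∘ₗ totD n) (g := dTot (nabla n) (dRL n) (ixL n) ∘ₗ evT n)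
    (fun q p φ => ?_) a
  have h : totD n (Tot.of n q p φ) = Tot.of n (q + 1) p (dTriv n q φ) +
      Tot.of n (q + 1) p (insertion n q (lieD n p) (continuous_lieD n p) φ) +
      (-1 : ℂ) ^ q • Tot.of n q (p + 1) (dDR n q p φ) := by
    simp [totD, Tot.of, dCE]
  have h1 : ∀ X, ev p ∘ₗ lieD n p X = lieOp (dRL n) (ixL n) X ∘ₗ ev p :=
    fun X => LinearMap.ext fun ω => ev_lieD X ω
  have h2 : ev (p + 1) ∘ₗ deRham n p = dRL n ∘ₗ ev p := LinearMap.ext fun ω => ev_deRham ω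
  rw [LinearMap.comp_apply, LinearMap.comp_apply, h]
  simp only [map_add, map_smul, evT_of, dDR, evC_postcomp, evC_insertion, evC_dTriv, dTot,
    LinearMap.add_apply, altOp_apply, dL_post, tw_post, tw_evC, ← altL_post, post_post, h1, h2]

theorem evT_iota (a : Tot n) : evT n (iota n a) = iotaL (ixL n) (evT n a) := by
  refine tot_ext (f := evT n ∘ₗ iota n) (g := iotaL (ixL n) ∘ₗ evT n) (fun q p φ => ?_) a
  rw [LinearMap.comp_apply, LinearMap.comp_apply, evT_of, iotaL_apply]
  simp only [tw_post]
  rcases p with _ | p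
  · have h : iota n (Tot.of n q 0 φ) = 0 := by simp [iota, Tot.of]
    have h1 : ∀ X, ixL n X ∘ₗ ev 0 = 0 := fun X => LinearMap.ext fun ω => ixL_ev_zero X ω
    simp only [h, h1, map_zero, tw_evC]
    have h2 : post (M := Vect n) (0 : Form n 0 →ₗ[ℂ] FormL n) (evC n q φ) = 0 := rfl
    simp only [h2, smul_zero, altL_zero, neg_zero]
  · have h : iota n (Tot.of n q (p + 1) φ) =
        (-1 : ℂ) ^ (q + 1) • Tot.of n (q + 1) p (contraction n q p φ) := by
      simp [iota, Tot.of]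
    have h1 : ∀ X, ixL n X ∘ₗ ev (p + 1) = ev p ∘ₗ interior n p X :=
      fun X => LinearMap.ext fun ω => (ev_interior X ω).symm
    rw [h, map_smul, evT_of, contraction, evC_insertion]
    simp only [h1, tw_evC, altL_smul, ← altL_post, post_post, pow_succ, mul_neg_one, neg_smul]

theorem evT_poincareTot (a : Tot n) : evT n (poincareTot n a) = -tw (poincareL n) (evT n a) := by
  refine tot_ext (f := evT n ∘ₗ poincareTot n) (g := (-tw (poincareL n)) ∘ₗ evT n)
    (fun q p φ => ?_) a
  rw [LinearMap.comp_apply, LinearMap.comp_apply, evT_of, LinearMap.neg_apply, tw_post, tw_evC]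
  rcases p with _ | p
  · have h : poincareTot n (Tot.of n q 0 φ) = 0 := by simp [poincareTot, Tot.of]
    have h1 : poincareL n ∘ₗ ev 0 = 0 := LinearMap.ext fun ω => poincareL_ev_zero ω
    have h2 : post (M := Vect n) (0 : Form n 0 →ₗ[ℂ] FormL n) (evC n q φ) = 0 := rfl
    rw [h, h1, h2, map_zero, smul_zero, neg_zero]
  · have h : poincareTot n (Tot.of n q (p + 1) φ) = (-1 : ℂ) ^ (q + 1) • Tot.of n q p
        (postcomp n q (poincare n p) (continuous_poincare n p) φ) := by
      simp [poincareTot, Tot.of]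
    have h1 : poincareL n ∘ₗ ev (p + 1) = ev p ∘ₗ poincare n p :=
      LinearMap.ext fun ω => (ev_poincare ω).symm
    rw [h, h1, map_smul, evT_of, evC_postcomp, post_post, pow_succ, mul_neg_one, neg_smul]

/-- The involution `parL n` is `(-1)^p` on `p`-forms, so the recursion generates the sign of
`totMul` by itself. -/
theorem evT_totMul (a b : Tot n) :
    evT n (totMul n a b) = sh (wedgeL n) (parL n) (evT n a) (evT n b) := by
  refine tot_ext (f := evT n ∘ₗ (totMul n).flip b)
    (g := (sh (wedgeL n) (parL n)).flip (evT n b) ∘ₗ evT n) (fun q p φ => ?_) a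
  refine tot_ext (f := evT n ∘ₗ totMul n (Tot.of n q p φ))
    (g := sh (wedgeL n) (parL n) (evT n (Tot.of n q p φ)) ∘ₗ evT n) (fun q' p' ψ => ?_) b
  have h : totMul n (Tot.of n q p φ) (Tot.of n q' p' ψ) = (-1 : ℂ) ^ (p * q') •
      Tot.of n (q + q') (p + p') (cup n q q' (wedge n p p') (continuous_wedge n p p') φ ψ) := by
    simp [totMul, Tot.of]
  rw [LinearMap.comp_apply, LinearMap.comp_apply, h, evT_of, evT_of, map_smul, evT_of, ← map_smul,
    pow_mul, evC_cup]
  exact sh_map _ _ _ _ _ _ _ (fun ω η => ev_wedge ω η) (fun ω => by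
    rw [tw_ev, LinearMap.smul_apply, map_smul]
    rfl) _ _

theorem evB_baseMul (a b : Base n) :
    evB n (baseMul n a b) = sh (LinearMap.mul ℂ ℂ) LinearMap.id (evB n a) (evB n b) := by
  refine base_ext (f := evB n ∘ₗ (baseMul n).flip b)
    (g := (sh (LinearMap.mul ℂ ℂ) LinearMap.id).flip (evB n b) ∘ₗ evB n) (fun q φ => ?_) a
  refine base_ext (f := evB n ∘ₗ baseMul n (Base.of n q φ))
    (g := sh (LinearMap.mul ℂ ℂ) LinearMap.id (evB n (Base.of n q φ)) ∘ₗ evB n)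
    (fun q' ψ => ?_) b
  have h : baseMul n (Base.of n q φ) (Base.of n q' ψ) =
      Base.of n (q + q') (cup n q q' (LinearMap.mul ℂ ℂ) continuous_mul φ ψ) := by
    simp [baseMul, Base.of]
  have h2 := evC_cup q q' (LinearMap.mul ℂ ℂ) continuous_mul 1 φ ψ
  rw [one_pow, one_smul, one_smul] at h2
  rw [LinearMap.comp_apply, LinearMap.comp_apply, h, evB_of, evB_of, evB_of, h2]

theorem evB_baseD (a : Base n) : evB n (baseD n a) = dL (nabla n) (evB n a) := by
  refine base_ext (f := evB n ∘ₗ baseD n) (g := dL (nabla n) ∘ₗ evB n) (fun q φ => ?_) a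
  have h : baseD n (Base.of n q φ) = Base.of n (q + 1) (dTriv n q φ) := by
    simp [baseD, Base.of]
  rw [LinearMap.comp_apply, LinearMap.comp_apply, h, evB_of, evB_of, evC_dTriv]

/-- Evaluation at the origin on functions on lists. -/
def evalL (n : ℕ) : FormL n →ₗ[ℂ] ℂ :=
  (MvPowerSeries.coeff 0) ∘ₗ (LinearMap.proj [] : FormL n →ₗ[ℂ] FormalFun n)

theorem evalL_apply (ω : FormL n) : evalL n ω = MvPowerSeries.constantCoeff (ω []) := by
  simp [evalL]

/-- The inclusion of constants into functions on lists. -/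
def constL (n : ℕ) : ℂ →ₗ[ℂ] FormL n :=
  pt ∘ₗ (Algebra.linearMap ℂ (FormalFun n))

theorem constL_apply (c : ℂ) : constL n c = pt (MvPowerSeries.C c) := rfl

theorem evB_restrictZero (a : Tot n) :
    evB n (restrictZero n a) = post (evalL n) (evT n a) := by
  refine tot_ext (f := evB n ∘ₗ restrictZero n) (g := post (evalL n) ∘ₗ evT n)
    (fun q p φ => ?_) a
  rw [LinearMap.comp_apply, LinearMap.comp_apply, evT_of, post_post]
  rcases p with _ | p
  · have h : restrictZero n (Tot.of n q 0 φ) =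
        Base.of n q (postcomp n q (evalZero n) (continuous_evalZero n) φ) := by
      simp [restrictZero, Tot.of]
    have h1 : evalL n ∘ₗ ev 0 = evalZero n := by
      refine LinearMap.ext fun ω => ?_
      have h2 := ev_ofFn ω ![]
      rw [List.ofFn_zero] at h2
      rw [LinearMap.comp_apply, evalL_apply, h2]
      rfl
    rw [h, h1, evB_of, evC_postcomp]
  · have h : restrictZero n (Tot.of n q (p + 1) φ) = 0 := by
      simp [restrictZero, Tot.of]
    have h1 : evalL n ∘ₗ ev (p + 1) = 0 := by
      refine LinearMap.ext fun ω => ?_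
      rw [LinearMap.comp_apply, evalL_apply, ev_of_length_ne _ (by simp)]
      simp
    rw [h, h1, map_zero]
    rfl

theorem evT_incl (b : Base n) : evT n (incl n b) = post (constL n) (evB n b) := by
  refine base_ext (f := evT n ∘ₗ incl n) (g := post (constL n) ∘ₗ evB n) (fun q φ => ?_) b
  have h : incl n (Base.of n q φ) =
      Tot.of n q 0 (postcomp n q (constForm n) (continuous_constForm n) φ) := by
    simp [incl, Tot.of, Base.of]
  have h1 : ev 0 ∘ₗ constForm n = constL n :=
    LinearMap.ext fun c => ev_constOfIsEmpty _
  rw [LinearMap.comp_apply, LinearMap.comp_apply, h, evT_of, evB_of, evC_postcomp, post_post, h1]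

theorem evB_one : evB n (Base.of n 0 (constCochain n 1)) = pt 1 := by
  rw [evB_of]
  exact ev_constOfIsEmpty _

theorem evT_one : evT n (Tot.of n 0 0 (constCochain n (constForm n 1))) = pt (constL n 1) := by
  rw [evT_of, evC_apply]
  have h : ev 0 (constCochain n (constForm n 1)).val = pt (constForm n 1) := ev_constOfIsEmpty _
  have h2 : ev 0 (constForm n 1) = constL n 1 := ev_constOfIsEmpty _
  rw [h, post_pt, h2]

theorem evT_expOp (T : Module.End ℂ (Tot n)) (T' : Module.End ℂ (List (Vect n) → FormL n))
    (h : ∀ a, evT n (T a) = T' (evT n a)) (a : Tot n) :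
    evT n (expOp n T a) =
      ∑ k ∈ Finset.range (n + 1), ((k.factorial : ℂ))⁻¹ • (T' ^ k) (evT n a) := by
  have hk : ∀ (k : ℕ) (a : Tot n), evT n ((T ^ k) a) = (T' ^ k) (evT n a) := by
    intro k
    induction k with
    | zero => intro a; rfl
    | succ k ih => intro a; rw [pow_succ, pow_succ, Module.End.mul_apply, ih, h]; rfl
  simp [expOp, LinearMap.sum_apply, hk]

theorem evT_exp_iota (a : Tot n) : evT n (expOp n (iota n) a) = expL (ixL n) (evT n a) := by
  rw [evT_expOp _ _ evT_iota]
  exact expL_eq_sum (formFilt n) formFilt_zero formFilt_mono formFilt_ixL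
    (fun k X Y ω hω => ixL_ixL hω.1 X Y) n (evT_mem_valSub a)

theorem iota_pow : iota n ^ (n + 1) = 0 := by
  refine LinearMap.ext fun a => evT_injective ?_
  have hk : ∀ (k : ℕ) (a : Tot n), evT n ((iota n ^ k) a) = (iotaL (ixL n) ^ k) (evT n a) := by
    intro k
    induction k with
    | zero => intro a; rfl
    | succ k ih => intro a; rw [pow_succ, pow_succ, Module.End.mul_apply, ih, evT_iota]; rfl
  rw [hk, LinearMap.zero_apply, map_zero]
  exact iotaL_pow_eq_zero (formFilt n) formFilt_zero formFilt_ixL (n + 1) _ (evT_mem_valSub a)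

theorem expOp_iota_inverse : expOp n (-iota n) * expOp n (iota n) = 1 ∧
    expOp n (iota n) * expOp n (-iota n) = 1 := by
  -- The nilpotent exponential uses rational scalars. Pulling them back from `ℂ` makes them agree
  -- definitionally with those in `expOp`.
  let _ : Module ℚ (Module.End ℂ (Tot n)) := Module.compHom _ (algebraMap ℚ ℂ)
  have h : ∀ T : Module.End ℂ (Tot n), T ^ (n + 1) = 0 → expOp n T = IsNilpotent.exp T := by
    intro T hT
    rw [IsNilpotent.exp_eq_sum hT, expOp]
    refine Finset.sum_congr rfl fun k _ => ?_
    have h2 : ∀ (c : ℚ) (S : Module.End ℂ (Tot n)), c • S = (c : ℂ) • S := fun _ _ => rfl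
    rw [h2]
    push_cast
    rfl
  have h3 := neg_pow (iota n) (n + 1)
  rw [iota_pow, mul_zero] at h3
  rw [h _ iota_pow, h _ h3]
  exact ⟨IsNilpotent.exp_neg_mul_exp_self ⟨n + 1, iota_pow⟩,
    IsNilpotent.exp_mul_exp_neg_self ⟨n + 1, iota_pow⟩⟩

end Comparison

/-! ## Gradings of direct sums -/

section Grading

open DirectSum

variable {I : Type} [DecidableEq I] {M : I → Type} [∀ i, AddCommGroup (M i)] [∀ i, Module ℂ (M i)]
  {d : I → ℕ} {S : ℕ → Submodule ℂ (⨁ i, M i)}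

theorem lof_mem_deg (hS : ∀ k a, a ∈ S k ↔ ∀ i, d i ≠ k → a i = 0) (i : I) (x : M i) :
    lof ℂ I M i x ∈ S (d i) := by
  refine (hS _ _).2 fun j hj => ?_
  exact DirectSum.of_eq_of_ne (β := M) i j x (by rintro rfl; exact hj rfl)

theorem map_mem_of_deg (hS : ∀ k a, a ∈ S k ↔ ∀ i, d i ≠ k → a i = 0) {P : Type}
    [AddCommGroup P] [Module ℂ P] (T : (⨁ i, M i) →ₗ[ℂ] P) (Q : Submodule ℂ P) {k : ℕ}
    (hT : ∀ i, d i = k → ∀ x, T (lof ℂ I M i x) ∈ Q) {a : ⨁ i, M i} (ha : a ∈ S k) : T a ∈ Q := by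
  classical
  rw [← DirectSum.sum_support_of a, map_sum]
  refine sum_mem fun i hi => hT i ?_ _
  by_contra h
  exact (DFinsupp.mem_support_iff.1 hi) ((hS _ _).1 ha i h)

/-- The component at `i` of a sum of homogeneous elements comes only from the part of degree `d i`.
-/
theorem isInternal_deg (hS : ∀ k a, a ∈ S k ↔ ∀ i, d i ≠ k → a i = 0) :
    DirectSum.IsInternal S := by
  have key : ∀ (f : ⨁ k, S k) (i : I),
      DirectSum.coeAddMonoidHom S f i = (f (d i) : ⨁ i, M i) i := by
    intro f i
    induction f using DirectSum.induction_on with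
    | zero => simp
    | add f g hf hg => simp [hf, hg]
    | of k x =>
      rw [DirectSum.coeAddMonoidHom_of]
      by_cases h : d i = k
      · subst h
        rw [DirectSum.of_eq_same]
      · rw [DirectSum.of_eq_of_ne (β := fun k => S k) k (d i) x h, (hS _ _).1 x.2 i h]
        simp
  refine ⟨(injective_iff_map_eq_zero _).2 fun f hf => ?_, fun a => ?_⟩
  · refine DFinsupp.ext fun k => Subtype.ext (DFinsupp.ext fun i => ?_)
    by_cases h : d i = k
    · subst h
      have := key f i
      rw [hf] at this
      exact this.symm
    · exact (hS _ _).1 (f k).2 i h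
  · induction a using DirectSum.induction_on with
    | zero => exact ⟨0, map_zero _⟩
    | add a b ha hb =>
      obtain ⟨f, rfl⟩ := ha
      obtain ⟨g, rfl⟩ := hb
      exact ⟨f + g, map_add _ _ _⟩
    | of i x =>
      exact ⟨DirectSum.of (fun k => S k) (d i) ⟨_, lof_mem_deg hS i x⟩,
        DirectSum.coeAddMonoidHom_of S _ _⟩

variable {n : ℕ}

theorem mem_totDeg (k : ℕ) (a : Tot n) :
    a ∈ totDeg n k ↔ ∀ x : ℕ × ℕ, x.1 + x.2 ≠ k → a x = 0 := Iff.rfl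

theorem mem_baseDeg (k : ℕ) (a : Base n) : a ∈ baseDeg n k ↔ ∀ q : ℕ, q ≠ k → a q = 0 := Iff.rfl

theorem totOf_mem {q p k : ℕ} (h : q + p = k) (φ : FormCochain n q p) :
    Tot.of n q p φ ∈ totDeg n k :=
  h ▸ lof_mem_deg mem_totDeg (q, p) φ

theorem baseOf_mem {q : ℕ} (φ : Cochain n q ℂ) : Base.of n q φ ∈ baseDeg n q :=
  lof_mem_deg (d := fun q => q) mem_baseDeg q φ

theorem totDeg_map {P : Type} [AddCommGroup P] [Module ℂ P] (T : Tot n →ₗ[ℂ] P)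
    (Q : Submodule ℂ P) {k : ℕ} (hT : ∀ q p, q + p = k → ∀ φ, T (Tot.of n q p φ) ∈ Q)
    {a : Tot n} (ha : a ∈ totDeg n k) : T a ∈ Q :=
  map_mem_of_deg mem_totDeg T Q (fun x hx φ => hT x.1 x.2 hx φ) ha

theorem baseDeg_map {P : Type} [AddCommGroup P] [Module ℂ P] (T : Base n →ₗ[ℂ] P)
    (Q : Submodule ℂ P) {k : ℕ} (hT : ∀ φ, T (Base.of n k φ) ∈ Q)
    {a : Base n} (ha : a ∈ baseDeg n k) : T a ∈ Q :=
  map_mem_of_deg (d := fun q => q) mem_baseDeg T Q (fun q hq φ => by subst hq; exact hT φ) ha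

end Grading

/-! ## The commutative differential graded algebras -/

section Algebras

variable {n : ℕ}

theorem tw_evT {k : ℕ} {a : Tot n} (ha : a ∈ totDeg n k) :
    tw (parL n) (evT n a) = (-1 : ℂ) ^ k • evT n a := by
  funext l m
  rw [Pi.smul_apply, Pi.smul_apply, tw_apply, Pi.smul_apply, tw_apply, LinearMap.id_apply]
  by_cases h : l.length + m.length = k
  · rw [smul_smul, ← pow_add, h]
  · have h0 : evT n a l m = 0 := by
      have h2 : a (l.length, m.length) = 0 := ha (l.length, m.length) h
      rw [evT_component, h2, map_zero, Pi.zero_apply, map_zero, Pi.zero_apply]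
    rw [h0, smul_zero, smul_zero, smul_zero]

theorem tw_evB {k : ℕ} {a : Base n} (ha : a ∈ baseDeg n k) :
    tw LinearMap.id (evB n a) = (-1 : ℂ) ^ k • evB n a := by
  funext l
  rw [Pi.smul_apply, tw_apply, LinearMap.id_apply]
  by_cases h : l.length = k
  · rw [h]
  · have h0 : evB n a l = 0 := by
      have h2 : a l.length = 0 := ha l.length h
      rw [evB_component, h2, map_zero, Pi.zero_apply]
    rw [h0, smul_zero, smul_zero]

theorem gradedMul_complex : GradedMul (LinearMap.mul ℂ ℂ) LinearMap.id :=
  ⟨fun x y z => mul_assoc x y z, fun _ _ => rfl, fun _ => rfl⟩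

theorem baseMul_of {q q' : ℕ} (φ : Cochain n q ℂ) (ψ : Cochain n q' ℂ) :
    baseMul n (Base.of n q φ) (Base.of n q' ψ) =
      Base.of n (q + q') (cup n q q' (LinearMap.mul ℂ ℂ) continuous_mul φ ψ) := by
  simp [baseMul, Base.of]

theorem baseMul_mem {k l : ℕ} {a b : Base n} (ha : a ∈ baseDeg n k) (hb : b ∈ baseDeg n l) :
    baseMul n a b ∈ baseDeg n (k + l) := by
  refine baseDeg_map ((baseMul n).flip b) _ (fun φ => ?_) ha
  refine baseDeg_map (baseMul n (Base.of n k φ)) _ (fun ψ => ?_) hb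
  rw [baseMul_of]
  exact baseOf_mem _

theorem base_one_mul (a : Base n) : baseMul n (Base.of n 0 (constCochain n 1)) a = a := by
  refine evB_injective ((evB_baseMul _ _).trans ?_)
  rw [evB_one, sh_pt _ _ rfl]
  funext l
  exact one_mul _

theorem baseMul_assoc (a b c : Base n) :
    baseMul n (baseMul n a b) c = baseMul n a (baseMul n b c) := by
  refine evB_injective ?_
  simp only [evB_baseMul]
  exact sh_assoc gradedMul_complex _ _ _

theorem baseMul_comm {k l : ℕ} {a b : Base n} (ha : a ∈ baseDeg n k) (hb : b ∈ baseDeg n l) :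
    baseMul n a b = (-1 : ℂ) ^ (k * l) • baseMul n b a := by
  -- Stating the identity as membership in `⊥` lets `baseDeg_map` reduce each argument to a single
  -- summand.
  refine sub_eq_zero.1 ((Submodule.mem_bot ℂ).1 ?_)
  refine baseDeg_map ((baseMul n).flip b - (-1 : ℂ) ^ (k * l) • baseMul n b) ⊥ (fun φ => ?_) ha
  refine baseDeg_map (baseMul n (Base.of n k φ) -
    (-1 : ℂ) ^ (k * l) • (baseMul n).flip (Base.of n k φ)) ⊥ (fun ψ => ?_) hb
  refine (Submodule.mem_bot ℂ).2 (sub_eq_zero.2 (evB_injective ?_))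
  rw [LinearMap.smul_apply, LinearMap.flip_apply, map_smul, evB_baseMul, evB_baseMul, evB_of,
    evB_of]
  refine (sh_comm_of_support 1 1 1 (one_mul 1) k l (evC n k φ) (evC n l ψ)
    (fun _ h => ev_of_length_ne _ h) (fun _ h => ev_of_length_ne _ h)
    (fun _ => (one_smul ℂ _).symm) (fun _ => (one_smul ℂ _).symm)
    (fun _ _ => by simp [mul_comm])).trans ?_
  simp

theorem baseD_mem {k : ℕ} {a : Base n} (ha : a ∈ baseDeg n k) : baseD n a ∈ baseDeg n (k + 1) := by
  refine baseDeg_map (baseD n) _ (fun φ => ?_) ha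
  have h : baseD n (Base.of n k φ) = Base.of n (k + 1) (dTriv n k φ) := by
    simp [baseD, Base.of]
  rw [h]
  exact baseOf_mem _

theorem baseD_baseD (a : Base n) : baseD n (baseD n a) = 0 := by
  refine evB_injective ?_
  rw [evB_baseD, evB_baseD, map_zero]
  exact dL_dL adL_nabla_jacobi (evB_mem_altSub a)

theorem baseD_baseMul {k : ℕ} {a : Base n} (ha : a ∈ baseDeg n k) (b : Base n) :
    baseD n (baseMul n a b) = baseMul n (baseD n a) b + (-1 : ℂ) ^ k • baseMul n a (baseD n b) := by
  refine evB_injective ?_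
  simp only [evB_baseD, evB_baseMul, map_add, map_smul]
  rw [(oddDer_dL gradedMul_complex).leib, tw_evB ha, map_smul, LinearMap.smul_apply]

theorem baseData_isCDGA (n : ℕ) : (baseData n).IsCDGA where
  internal := isInternal_deg (d := fun q => q) mem_baseDeg
  one_mem := baseOf_mem (constCochain n 1)
  mul_mem _ _ _ _ ha hb := baseMul_mem ha hb
  one_mul := base_one_mul
  mul_assoc := baseMul_assoc
  mul_comm _ _ _ _ ha hb := baseMul_comm ha hb
  d_mem _ _ ha := baseD_mem ha
  d_d := baseD_baseD
  leibniz _ _ b ha := baseD_baseMul ha b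

/-- The exponential `e^ι`. -/
abbrev expIota (n : ℕ) : Module.End ℂ (Tot n) := expOp n (iota n)

theorem expIota_injective : Function.Injective (expIota n) := fun a b h => by
  have h1 := fun a => LinearMap.congr_fun (expOp_iota_inverse (n := n)).1 a
  have h2 := h1 a
  rw [Module.End.mul_apply, h, ← Module.End.mul_apply, h1] at h2
  exact h2.symm

theorem evT_val_altSub (a : Tot n) : evT n a ∈ valSub (Vect n) (altSub (Fin n → ℂ) (FormalFun n)) :=
  fun l => (evT_mem_valSub a l).1

theorem evT_exp_totD (a : Tot n) :
    evT n (expIota n (totD n a)) = dTot₀ (nabla n) (dRL n) (evT n (expIota n a)) := by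
  rw [evT_exp_iota, evT_exp_iota, evT_totD]
  exact expL_dTot (S := altSub (Fin n → ℂ) (FormalFun n)) (fun X ω hω => altSub_ixL X hω)
    (fun X Y ω hω => ixL_ixL hω X Y) ixL_add ixL_smul (fun X Y ω hω => lieOp_ixL hω X Y)
    (evT_mem_altSub a) (evT_val_altSub a)

theorem evT_exp_totMul (a b : Tot n) :
    evT n (expIota n (totMul n a b)) =
      sh (wedgeL n) (parL n) (evT n (expIota n a)) (evT n (expIota n b)) := by
  rw [evT_exp_iota, evT_exp_iota, evT_exp_iota, evT_totMul]
  exact expL_sh oddDer_ixL _ _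

theorem dTot₀_dTot₀ {φ : List (Vect n) → FormL n} (hφ : φ ∈ altSub (Vect n) (FormL n)) :
    dTot₀ (nabla n) (dRL n) (dTot₀ (nabla n) (dRL n) φ) = 0 := by
  have h : dRL n ∘ₗ dRL n = 0 := LinearMap.ext fun ω => dRL_dRL ω
  have h2 : post (M := Vect n) (0 : FormL n →ₗ[ℂ] FormL n) φ = 0 := rfl
  simp only [dTot₀, LinearMap.add_apply, map_add, dL_dL adL_nabla_jacobi hφ, dL_tw, tw_tw, h, h2]
  abel

theorem oddDer_dTot₀ :
    OddDer (sh (wedgeL n) (parL n)) (tw (parL n)) (dTot₀ (nabla n) (dRL n)) := by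
  have h1 := oddDer_dL (nab := nabla n) (gradedMul_wedgeL (n := n))
  have h2 := oddDer_tw (M := Vect n) (oddDer_dRL (n := n))
  refine ⟨fun x => ?_, fun x y => ?_⟩
  · simp only [dTot₀, LinearMap.add_apply, map_add, h1.anti, h2.anti]
    abel
  · simp only [dTot₀, LinearMap.add_apply, map_add, h1.leib, h2.leib]
    abel

theorem totMul_of {q p q' p' : ℕ} (φ : FormCochain n q p) (ψ : FormCochain n q' p') :
    totMul n (Tot.of n q p φ) (Tot.of n q' p' ψ) = (-1 : ℂ) ^ (p * q') •
      Tot.of n (q + q') (p + p') (cup n q q' (wedge n p p') (continuous_wedge n p p') φ ψ) := by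
  simp [totMul, Tot.of]

theorem totMul_mem {k l : ℕ} {a b : Tot n} (ha : a ∈ totDeg n k) (hb : b ∈ totDeg n l) :
    totMul n a b ∈ totDeg n (k + l) := by
  refine totDeg_map ((totMul n).flip b) _ (fun q p hk φ => ?_) ha
  refine totDeg_map (totMul n (Tot.of n q p φ)) _ (fun q' p' hl ψ => ?_) hb
  rw [totMul_of]
  exact Submodule.smul_mem _ _ (totOf_mem (by omega) _)

theorem tot_one_mul (a : Tot n) :
    totMul n (Tot.of n 0 0 (constCochain n (constForm n 1))) a = a := by
  refine evT_injective ((evT_totMul _ _).trans ?_)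
  have h1 : parL n (constL n 1) = constL n 1 := tw_pt _ _
  rw [evT_one, sh_pt _ _ h1]
  funext l
  rw [post_apply, constL_apply, sh_pt _ _ rfl]
  funext m
  rw [post_apply, map_one]
  exact one_mul _

theorem totMul_assoc (a b c : Tot n) :
    totMul n (totMul n a b) c = totMul n a (totMul n b c) := by
  refine evT_injective ?_
  simp only [evT_totMul]
  exact sh_assoc gradedMul_wedgeL _ _ _

theorem wedgeL_comm {p p' : ℕ} (ω : Form n p) (η : Form n p') : wedgeL n (ev p ω) (ev p' η) =
    (-1 : ℂ) ^ (p * p') • wedgeL n (ev p' η) (ev p ω) := by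
  refine (sh_comm_of_support 1 1 1 (one_mul 1) p p' (ev p ω) (ev p' η)
    (fun _ h => ev_of_length_ne _ h) (fun _ h => ev_of_length_ne _ h)
    (fun _ => (one_smul ℂ _).symm) (fun _ => (one_smul ℂ _).symm)
    (fun _ _ => by simp [mul_comm])).trans ?_
  simp

theorem totMul_comm {k l : ℕ} {a b : Tot n} (ha : a ∈ totDeg n k) (hb : b ∈ totDeg n l) :
    totMul n a b = (-1 : ℂ) ^ (k * l) • totMul n b a := by
  refine sub_eq_zero.1 ((Submodule.mem_bot ℂ).1 ?_)
  refine totDeg_map ((totMul n).flip b - (-1 : ℂ) ^ (k * l) • totMul n b) ⊥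
    (fun q p hk φ => ?_) ha
  refine totDeg_map (totMul n (Tot.of n q p φ) -
    (-1 : ℂ) ^ (k * l) • (totMul n).flip (Tot.of n q p φ)) ⊥ (fun q' p' hl ψ => ?_) hb
  refine (Submodule.mem_bot ℂ).2 (sub_eq_zero.2 (evT_injective ?_))
  have hpow : ∀ j : ℕ, (-1 : ℂ) ^ j * (-1) ^ j = 1 := fun j => by simp [← mul_pow]
  have hpar : ∀ {r : ℕ} (ω : Form n r), parL n (ev r ω) = (-1 : ℂ) ^ r • ev r ω :=
    fun ω => tw_ev _ ω
  have hsupp : ∀ {q p : ℕ} (φ : FormCochain n q p) (l : List (Vect n)), l.length ≠ q →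
      post (ev p) (evC n q φ) l = 0 := fun φ l h => by
    rw [post_apply, evC_apply, ev_of_length_ne _ h, map_zero]
  rw [LinearMap.smul_apply, LinearMap.flip_apply, map_smul, evT_totMul, evT_totMul, evT_of,
    evT_of]
  refine (sh_comm_of_support ((-1) ^ p) ((-1) ^ p') ((-1) ^ (p * p')) (hpow _) q q'
    (post (ev p) (evC n q φ)) (post (ev p') (evC n q' ψ)) (hsupp φ) (hsupp ψ) (fun _ => hpar _)
    (fun _ => hpar _) (fun _ _ => wedgeL_comm _ _)).trans ?_
  congr 1
  subst hk hl
  ring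

theorem totD_mem {k : ℕ} {a : Tot n} (ha : a ∈ totDeg n k) : totD n a ∈ totDeg n (k + 1) := by
  refine totDeg_map (totD n) _ (fun q p hk φ => ?_) ha
  have h : totD n (Tot.of n q p φ) = Tot.of n (q + 1) p (dCE n q p φ) +
      (-1 : ℂ) ^ q • Tot.of n q (p + 1) (dDR n q p φ) := by
    simp [totD, Tot.of]
  rw [h]
  exact add_mem (totOf_mem (by omega) _) (Submodule.smul_mem _ _ (totOf_mem (by omega) _))

/-- After conjugation by the injective `e^ι` the differential is the sum of two anticommuting
differentials of square zero. -/
theorem totD_totD (a : Tot n) : totD n (totD n a) = 0 := by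
  refine expIota_injective (evT_injective ?_)
  rw [evT_exp_totD, evT_exp_totD, map_zero, map_zero]
  exact dTot₀_dTot₀ (evT_mem_altSub _)

theorem totD_totMul {k : ℕ} {a : Tot n} (ha : a ∈ totDeg n k) (b : Tot n) :
    totD n (totMul n a b) = totMul n (totD n a) b + (-1 : ℂ) ^ k • totMul n a (totD n b) := by
  refine expIota_injective (evT_injective ?_)
  -- `e^ι` commutes with the parity of the total degree, so the Leibniz sign survives conjugation.
  have h : tw (parL n) (evT n (expIota n a)) = (-1 : ℂ) ^ k • evT n (expIota n a) := by
    rw [evT_exp_iota, ← expL_tw oddDer_ixL, tw_evT ha, map_smul]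
  rw [map_add, map_add, map_smul, map_smul, evT_exp_totD, evT_exp_totMul, evT_exp_totMul,
    evT_exp_totMul, evT_exp_totD, evT_exp_totD, oddDer_dTot₀.leib, h, map_smul,
    LinearMap.smul_apply]

theorem totData_isCDGA (n : ℕ) : (totData n).IsCDGA where
  internal := isInternal_deg mem_totDeg
  one_mem := totOf_mem (q := 0) (p := 0) rfl (constCochain n (constForm n 1))
  mul_mem _ _ _ _ ha hb := totMul_mem ha hb
  one_mul := tot_one_mul
  mul_assoc := totMul_assoc
  mul_comm _ _ _ _ ha hb := totMul_comm ha hb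
  d_mem _ _ ha := totD_mem ha
  d_d := totD_totD
  leibniz _ _ b ha := totD_totMul ha b

/-! ## The maps and the homotopy -/

theorem evalL_constL (c : ℂ) : evalL n (constL n c) = c := by
  rw [evalL_apply, constL_apply, pt_nil, MvPowerSeries.constantCoeff_C]

theorem ixL_constL (X : Vect n) : ixL n X ∘ₗ constL n = 0 :=
  LinearMap.ext fun c => by simp [ixL_eq, constL_apply, ins_pt]

theorem dRL_constL : dRL n ∘ₗ constL n = 0 := by
  refine LinearMap.ext fun c => ?_
  have h : ∀ v, dirD n v (MvPowerSeries.C c) = 0 := fun v => by simp [dirD_apply, partialD]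
  simp only [LinearMap.comp_apply, dRL_apply, constL_apply, post_pt, h, map_zero, altL_zero,
    LinearMap.zero_apply]

theorem evalL_dRL : evalL n ∘ₗ dRL n = 0 :=
  LinearMap.ext fun ω => by
    rw [LinearMap.comp_apply, evalL_apply, dRL_apply, altL_nil, map_zero, LinearMap.zero_apply]

theorem tw_zero {M N N' : Type} [AddCommGroup N] [Module ℂ N] [AddCommGroup N'] [Module ℂ N']
    (φ : List M → N) : tw (0 : N →ₗ[ℂ] N') φ = 0 :=
  funext fun l => by simp [tw_apply]

/-- Contractions kill `0`-forms, so the substitution acts on constants as if `τ` were zero. -/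
theorem expL_post_constL (β : List (Vect n) → ℂ) :
    expL (ixL n) (post (constL n) β) = post (constL n) β := by
  funext l
  induction l generalizing β with
  | nil => rfl
  | cons X l ih =>
    rw [expL_cons, tw_post, ixL_constL, tw_zero, sub_zero, ins_post, ih]
    rfl

theorem evB_Phi (a : Tot n) : evB n (Phi n a) = post (evalL n) (evT n (expIota n a)) :=
  evB_restrictZero _

theorem Phi_incl (b : Base n) : Phi n (incl n b) = b := by
  refine evB_injective ?_
  rw [evB_Phi, evT_exp_iota, evT_incl, expL_post_constL]
  funext l
  rw [post_apply, post_apply, evalL_constL]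

theorem incl_mem {k : ℕ} {a : Base n} (ha : a ∈ baseDeg n k) : incl n a ∈ totDeg n k := by
  refine baseDeg_map (incl n) _ (fun φ => ?_) ha
  have h : incl n (Base.of n k φ) =
      Tot.of n k 0 (postcomp n k (constForm n) (continuous_constForm n) φ) := by
    simp [incl, Tot.of, Base.of]
  rw [h]
  exact totOf_mem (add_zero k) _

theorem incl_one : incl n (Base.of n 0 (constCochain n 1)) =
    Tot.of n 0 0 (constCochain n (constForm n 1)) := by
  refine evT_injective ?_
  rw [evT_incl, evB_one, evT_one, post_pt]

theorem incl_baseMul (a b : Base n) : incl n (baseMul n a b) = totMul n (incl n a) (incl n b) := by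
  refine evT_injective ?_
  rw [evT_incl, evT_totMul, evB_baseMul, evT_incl, evT_incl]
  refine sh_map _ _ _ _ _ _ _ (fun x y => ?_) (fun x => ?_) _ _
  swap
  · exact (tw_pt LinearMap.id (MvPowerSeries.C x)).symm
  rw [constL_apply, constL_apply, constL_apply, sh_pt _ _ rfl, post_pt]
  simp

theorem incl_baseD (a : Base n) : incl n (baseD n a) = totD n (incl n a) := by
  refine evT_injective ?_
  have h : ∀ X, lieOp (dRL n) (ixL n) X ∘ₗ constL n = 0 := fun X => by
    rw [lieOp, LinearMap.add_comp, LinearMap.comp_assoc, LinearMap.comp_assoc, dRL_constL,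
      ixL_constL, LinearMap.comp_zero, LinearMap.comp_zero, add_zero]
  have h2 : post (M := Vect n) (0 : ℂ →ₗ[ℂ] FormL n) (evB n a) = 0 := rfl
  rw [evT_incl, evT_totD, evB_baseD, evT_incl]
  simp only [dTot, LinearMap.add_apply, altOp_apply, post_post, tw_post, h, dRL_constL, tw_zero,
    h2, altL_zero, dL_post, add_zero]

theorem incl_isDGAHom (n : ℕ) : IsDGAHom (baseData n) (totData n) (incl n) where
  map_mem _ _ ha := incl_mem ha
  map_one := incl_one
  map_mul := incl_baseMul
  map_d := incl_baseD

theorem iota_mem {k : ℕ} {a : Tot n} (ha : a ∈ totDeg n k) : iota n a ∈ totDeg n k := by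
  refine totDeg_map (iota n) _ (fun q p hk φ => ?_) ha
  rcases p with _ | p
  · have h : iota n (Tot.of n q 0 φ) = 0 := by simp [iota, Tot.of]
    rw [h]
    exact zero_mem _
  · have h : iota n (Tot.of n q (p + 1) φ) =
        (-1 : ℂ) ^ (q + 1) • Tot.of n (q + 1) p (contraction n q p φ) := by
      simp [iota, Tot.of]
    rw [h]
    exact Submodule.smul_mem _ _ (totOf_mem (by omega) _)

theorem expOp_mem {T : Module.End ℂ (Tot n)} {S : Submodule ℂ (Tot n)} (hT : ∀ a ∈ S, T a ∈ S)
    {a : Tot n} (ha : a ∈ S) : expOp n T a ∈ S := by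
  have hk : ∀ k : ℕ, (T ^ k) a ∈ S := by
    intro k
    induction k with
    | zero => exact ha
    | succ k ih => rw [pow_succ', Module.End.mul_apply]; exact hT _ ih
  rw [expOp, LinearMap.sum_apply]
  exact sum_mem fun k _ => S.smul_mem _ (hk k)

theorem Phi_mem {k : ℕ} {a : Tot n} (ha : a ∈ totDeg n k) : Phi n a ∈ baseDeg n k := by
  refine totDeg_map (restrictZero n) _ (fun q p hk φ => ?_) (expOp_mem (fun _ => iota_mem) ha)
  rcases p with _ | p
  · have h : restrictZero n (Tot.of n q 0 φ) =
        Base.of n q (postcomp n q (evalZero n) (continuous_evalZero n) φ) := by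
      simp [restrictZero, Tot.of]
    rw [h]
    subst hk
    exact baseOf_mem _
  · have h : restrictZero n (Tot.of n q (p + 1) φ) = 0 := by
      simp [restrictZero, Tot.of]
    rw [h]
    exact zero_mem _

theorem Phi_totMul (a b : Tot n) : Phi n (totMul n a b) = baseMul n (Phi n a) (Phi n b) := by
  refine evB_injective ?_
  rw [evB_baseMul, evB_Phi, evB_Phi, evB_Phi, evT_exp_totMul]
  refine sh_map _ _ _ _ _ _ _ (fun x y => ?_) (fun x => ?_) _ _
  · simp [evalL_apply, sh_nil]
  · simp [evalL_apply, tw_apply]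

/-- Evaluation sees only the `0`-form part, where the de Rham term of the conjugated differential
has no component. -/
theorem Phi_totD (a : Tot n) : Phi n (totD n a) = baseD n (Phi n a) := by
  refine evB_injective ?_
  rw [evB_baseD, evB_Phi, evB_Phi, evT_exp_totD]
  simp only [dTot₀, LinearMap.add_apply, map_add, dL_post, post_tw, evalL_dRL, tw_zero, add_zero]

theorem Phi_isDGAHom (n : ℕ) : IsDGAHom (totData n) (baseData n) (Phi n) where
  map_mem _ _ ha := Phi_mem ha
  map_one := (congrArg (Phi n) incl_one).symm.trans (Phi_incl _)
  map_mul := Phi_totMul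
  map_d := Phi_totD

theorem poincareTot_of_succ {q p : ℕ} (φ : FormCochain n q (p + 1)) :
    poincareTot n (Tot.of n q (p + 1) φ) = (-1 : ℂ) ^ (q + 1) • Tot.of n q p
        (postcomp n q (poincare n p) (continuous_poincare n p) φ) := by
  simp [poincareTot, Tot.of]

theorem poincareTot_of_zero {q : ℕ} (φ : FormCochain n q 0) :
    poincareTot n (Tot.of n q 0 φ) = 0 := by
  simp [poincareTot, Tot.of]

theorem Psi_mem (k : ℕ) (a : Tot n) (ha : a ∈ totDeg n (k + 1)) : Psi n a ∈ totDeg n k := by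
  refine expOp_mem (fun _ h => neg_mem (iota_mem h)) ?_
  refine totDeg_map (poincareTot n) _ (fun q p hk φ => ?_) (expOp_mem (fun _ => iota_mem) ha)
  rcases p with _ | p
  · rw [poincareTot_of_zero]
    exact zero_mem _
  · rw [poincareTot_of_succ]
    exact Submodule.smul_mem _ _ (totOf_mem (by omega) _)

theorem Psi_zero (a : Tot n) (ha : a ∈ totDeg n 0) : Psi n a = 0 := by
  have h : poincareTot n (expIota n a) ∈ (⊥ : Submodule ℂ (Tot n)) := by
    refine totDeg_map (poincareTot n) _ (fun q p hk φ => ?_) (expOp_mem (fun _ => iota_mem) ha)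
    obtain rfl : p = 0 := by omega
    exact poincareTot_of_zero φ
  rw [Psi, LinearMap.comp_apply, LinearMap.comp_apply, (Submodule.mem_bot ℂ).1 h, map_zero]

/-- Conjugation by `e^ι` reduces this to the formal Poincaré lemma on values. -/
theorem incl_Phi (a : Tot n) :
    incl n (Phi n a) - a = totD n (Psi n a) + Psi n (totD n a) := by
  refine expIota_injective (evT_injective ?_)
  have hPsi : ∀ b, expIota n (Psi n b) = poincareTot n (expIota n b) := fun b =>
    LinearMap.congr_fun (expOp_iota_inverse (n := n)).2 _
  rw [map_sub, map_sub, map_add, map_add, evT_exp_totD, hPsi, hPsi, evT_poincareTot,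
    evT_poincareTot, evT_exp_totD, evT_exp_iota (incl n _), evT_incl, expL_post_constL, evB_Phi]
  set φ := evT n (expIota n a)
  have h : post (dRL n ∘ₗ poincareL n + poincareL n ∘ₗ dRL n) φ =
      φ - post (constL n) (post (evalL n) φ) := by
    funext l
    have h2 := dRL_poincareL (evT_val_altSub (expIota n a) l)
    rw [Pi.sub_apply, post_apply, post_apply, post_apply, constL_apply, evalL_apply]
    exact h2
  -- `dL` anticommutes with the twisted homotopy and cancels. The two remaining products of `tw`
  -- operators lose their signs and leave minus the Poincaré identity.
  rw [← neg_sub, ← h, post_add_op]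
  simp only [dTot₀, LinearMap.add_apply, map_add, map_neg, dL_tw, tw_tw]
  abel

end Algebras

/-! ## Quasi-isomorphisms -/

theorem DGData.IsCDGA.complex_d {A : DGData} (hA : A.IsCDGA) (k : ℕ) :
    hA.complex.d k (k + 1) = ModuleCat.ofHom (A.d.restrict (hA.d_mem k)) :=
  CochainComplex.of_d (fun k => ModuleCat.of ℂ (A.deg k))
    (fun k => ModuleCat.ofHom (A.d.restrict (hA.d_mem k))) k

theorem quasiIso_of_homotopy {A B : DGData} (hA : A.IsCDGA) (hB : B.IsCDGA)
    {f : A.carrier →ₗ[ℂ] B.carrier} {g : B.carrier →ₗ[ℂ] A.carrier} (hf : IsDGAHom A B f)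
    (hg : IsDGAHom B A g) (hfg : ∀ b, f (g b) = b) (ψ : A.carrier →ₗ[ℂ] A.carrier)
    (hψ : ∀ k, ∀ a ∈ A.deg (k + 1), ψ a ∈ A.deg k) (hψ₀ : ∀ a ∈ A.deg 0, ψ a = 0)
    (h : ∀ a, g (f a) - a = A.d (ψ a) + ψ (A.d a)) :
    QuasiIso (hf.chainMap hA hB) ∧ QuasiIso (hg.chainMap hB hA) := by
  let hom (i j : ℕ) : hA.complex.X i ⟶ hA.complex.X j :=
    if hij : j + 1 = i then ModuleCat.ofHom (ψ.restrict (p := A.deg i) (q := A.deg j)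
      (fun a ha => hψ j a (hij ▸ ha))) else 0
  have hom_succ : ∀ i, hom (i + 1) i = ModuleCat.ofHom (ψ.restrict (hψ i)) :=
    fun i => dif_pos rfl
  let e : HomotopyEquiv hA.complex hB.complex :=
    { hom := hf.chainMap hA hB
      inv := hg.chainMap hB hA
      homotopyHomInvId :=
        { hom := hom
          zero := fun i j hij => dif_neg hij
          comm := fun i => by
            -- In degree `0` the homotopy has no incoming term, and `hψ₀` removes the corresponding
            -- summand of `h`.
            rcases i with _ | i
            · rw [Homotopy.dNext_cochainComplex, Homotopy.prevD_zero_cochainComplex, hom_succ,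
                hA.complex_d]
              ext a
              refine Subtype.ext ?_
              have h1 := h a.1
              rw [hψ₀ _ a.2, map_zero, zero_add, sub_eq_iff_eq_add] at h1
              exact h1.trans (congrArg (· + _) (add_zero _).symm)
            · rw [Homotopy.dNext_cochainComplex, Homotopy.prevD_succ_cochainComplex, hom_succ,
                hom_succ, hA.complex_d, hA.complex_d]
              ext a
              refine Subtype.ext ?_
              have h1 := h a.1
              rw [sub_eq_iff_eq_add, add_comm (A.d _)] at h1
              exact h1 }
      homotopyInvHomId := Homotopy.ofEq (by
        ext i b
        exact Subtype.ext (hfg b.1)) }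
  exact ⟨HomotopyEquiv.quasiIso_hom e, HomotopyEquiv.quasiIso_inv e⟩

end GelfandFuks

end

theorem mainTheorem3 (n : ℕ) :
    GelfandFuks.iota n ^ (n + 1) = 0 ∧
    ∃ (hT : (GelfandFuks.totData n).IsCDGA) (hB : (GelfandFuks.baseData n).IsCDGA)
      (hPhi : GelfandFuks.IsDGAHom (GelfandFuks.totData n) (GelfandFuks.baseData n)
        (GelfandFuks.Phi n))
      (hincl : GelfandFuks.IsDGAHom (GelfandFuks.baseData n) (GelfandFuks.totData n)
        (GelfandFuks.incl n)),
      QuasiIso (hPhi.chainMap hT hB) ∧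
      QuasiIso (hincl.chainMap hB hT) ∧
      (∀ b, GelfandFuks.Phi n (GelfandFuks.incl n b) = b) ∧
      (∀ k, ∀ a ∈ GelfandFuks.totDeg n (k + 1), GelfandFuks.Psi n a ∈ GelfandFuks.totDeg n k) ∧
      (∀ a ∈ GelfandFuks.totDeg n 0, GelfandFuks.Psi n a = 0) ∧
      (∀ a, GelfandFuks.incl n (GelfandFuks.Phi n a) - a =
        GelfandFuks.totD n (GelfandFuks.Psi n a) + GelfandFuks.Psi n (GelfandFuks.totD n a)) := by
  have h := GelfandFuks.quasiIso_of_homotopy (GelfandFuks.totData_isCDGA n)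
    (GelfandFuks.baseData_isCDGA n) (GelfandFuks.Phi_isDGAHom n) (GelfandFuks.incl_isDGAHom n)
    GelfandFuks.Phi_incl (GelfandFuks.Psi n) GelfandFuks.Psi_mem GelfandFuks.Psi_zero
    GelfandFuks.incl_Phi
  exact ⟨GelfandFuks.iota_pow, GelfandFuks.totData_isCDGA n, GelfandFuks.baseData_isCDGA n,
    GelfandFuks.Phi_isDGAHom n, GelfandFuks.incl_isDGAHom n, h.1, h.2, GelfandFuks.Phi_incl,
    GelfandFuks.Psi_mem, GelfandFuks.Psi_zero, GelfandFuks.incl_Phi⟩
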